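/- Let $\theta>0$, and for each $n$ let the symmetric group $S_n$ carry the Ewens measure with parameter $\theta$, i.e. $\mathbb{P}_\theta(\sigma)=\theta^{\ell(\sigma)}/\bigl(\theta(\theta+1)\cdots(\theta+n-1)\bigr)$, where $\ell(\sigma)$ is the number of cycles of $\sigma$, fixed points included. Let $S^1=\{z\in\mathbb{C}:|z|=1\}$, let $f:S^1\to\mathbb{C}$ be real analytic, and let $x\in S^1$. Let $C_m^{(n)}(\sigma)$ be the number of cycles of length $m$ of $\sigma\in S_n$, let $\log$ be the principal branch of the logarithm, with $\log(-y)=\log y+i\pi$ for $y>0$, and put $$w^n(f)(x)(\sigma)=\sum_{m=1}^n C_m^{(n)}(\sigma)\,\log\bigl(f(x^m)\bigr).$$ Put $m(f)(x)=\frac1p\sum_{m=1}^p\log\bigl(f(x^m)\bigr)$ if $x$ is a root of unity of order $p$ (that is, $p\ge 1$ is minimal with $x^p=1$), and $m(f)(x)=\int_0^1\log\bigl(f(e^{2\pi i s})\bigr)\,ds$ if $x$ is not a root of unity. The point $x=e^{2\pi i t}$ is of finite type if there are $K,\gamma>0$ such that the distance from $mt$ to the nearest integer is greater than $K/|m|^\gamma$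 for all $m\in\mathbb{Z}\setminus\{0\}$. A complex normal random variable is one whose real and imaginary parts are jointly Gaussian, possibly degenerate. (a) Suppose that $x$ is not a root of unity, that $x$ is of finite type, and that all zeros of $f$ are roots of unity. Then $\log f(e^{2\pi i s})$ and $\log^2 f(e^{2\pi i s})$ are integrable on $[0,1]$, and, as $n\to\infty$, $$\frac{w^n(f)(x)}{\sqrt{\log n}}-\theta\sqrt{\log n}\;m(f)(x)\xrightarrow{d}\mathcal N$$ for a complex normal random variable $\mathcal N$. The covariance of the real and the imaginary part of $\mathcal N$ is $$\frac{\theta}{2}\,\operatorname{Im}\left(\int_0^1\log^2\bigl(f(e^{2\pi i s})\bigr)\,ds\right),$$ and the real and the imaginary part of $\mathcal N$ are independent if and only if this covariance is $0$. (b) Suppose that $x$ is a root of unity of order $p$ and that $f(x^m)\neq0$ for all $1\le m\le p$. Then, as $n\to\infty$, $$\frac{w^n(f)(x)}{\sqrt{\log n}}-\theta\sqrt{\log n}\;m(f)(x)\xrightarrow{d}\mathcal N$$ for a complex normal random variable $\mathcal N$. The covariance of the real and the imaginary part of $\mathcal N$ is $$\frac{\theta}{2}\,\operatorname{Im}\left(\frac1p\sum_{m=1}^p\log^2\bigl(f(x^m)\bigr)\right),$$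 and the real and the imaginary part of $\mathcal N$ are independent if and only if this covariance is $0$. -/

import Mathlib

open MeasureTheory ProbabilityTheory Filter Topology
open scoped Manifold ContDiff

namespace EwensCLT

/-! ### Normalisation of the Ewens weights -/

theorem card_parts_partition_swap_mul {α : Type*} [Fintype α] [DecidableEq α]
    (g : Equiv.Perm α) (a b : α) (ha : g a = a) (hab : a ≠ b) :
    Multiset.card (Equiv.swap a b * g).partition.parts + 1 = Multiset.card g.partition.parts := by
  have hle : ∀ h : Equiv.Perm α, h.support.card ≤ Fintype.card α := fun h => Finset.card_le_univ _
  simp only [Equiv.Perm.parts_partition, Multiset.card_add, Multiset.card_replicate]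
  by_cases hb : g b = b
  · have hd : Equiv.Perm.Disjoint (Equiv.swap a b) g := by
      intro z
      by_cases h1 : z = a
      · right; rw [h1, ha]
      · by_cases h2 : z = b
        · right; rw [h2, hb]
        · left; exact Equiv.swap_apply_of_ne_of_ne h1 h2
    have h1 := hle (Equiv.swap a b * g)
    rw [hd.card_support_mul, Equiv.Perm.card_support_swap hab] at h1
    rw [hd.cycleType_mul, hd.card_support_mul, (Equiv.Perm.isCycle_swap hab).cycleType,
      Equiv.Perm.card_support_swap hab, Multiset.card_add, Multiset.card_singleton]
    omega
  · have hbs : b ∈ g.support := Equiv.Perm.mem_support.2 hb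
    obtain ⟨l, hl⟩ : ∃ l, g.toList b = b :: l := by
      have h0 := Equiv.Perm.length_toList_pos_of_mem_support g b hbs
      have h1 := Equiv.Perm.toList_getElem_zero g b hbs
      cases h : g.toList b with
      | nil => simp [h] at h0
      | cons y l => simp only [h, List.getElem_cons_zero] at h1; exact ⟨l, by rw [h1]⟩
    have hnd := g.nodup_toList b
    have hlen := Equiv.Perm.two_le_length_toList_iff_mem_support.2 hbs
    have hc := g.formPerm_toList b
    have hac : a ∉ g.toList b := by
      rw [Equiv.Perm.mem_toList_iff]
      rintro ⟨h, -⟩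
      exact hb (h.apply_eq_self_iff.2 ha)
    have hsc : (g.cycleOf b).support = (g.toList b).toFinset := by
      rw [← hc, List.support_formPerm_of_nodup _ hnd (fun x => g.toList_ne_singleton b x)]
    set c := g.cycleOf b with hcdef
    rw [hl] at hnd hlen hc hac hsc
    have hr : Equiv.Perm.Disjoint (g * c⁻¹) c :=
      Equiv.Perm.disjoint_mul_inv_of_mem_cycleFactorsFinset
        (Equiv.Perm.cycleOf_mem_cycleFactorsFinset_iff.2 hbs)
    have hg : g = c * (g * c⁻¹) := by
      rw [← hr.commute.eq]; simp
    set r := g * c⁻¹ with hrdef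
    have hd' : (Equiv.swap a b * c) = (a :: b :: l).formPerm := by
      rw [List.formPerm_cons_cons, hc]
    have hnd' : (a :: b :: l).Nodup := List.nodup_cons.2 ⟨hac, hnd⟩
    have hs' : (Equiv.swap a b * c).support = (a :: b :: l).toFinset := by
      rw [hd', List.support_formPerm_of_nodup _ hnd' (by simp)]
    have hcard : (Equiv.swap a b * c).support.card = c.support.card + 1 := by
      rw [hs', hsc, List.toFinset_cons, Finset.card_insert_of_notMem (by simpa using hac)]
    have hcyc : (Equiv.swap a b * c).IsCycle := by
      rw [hd']; exact List.isCycle_formPerm hnd' (by simp)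
    have hcyc' : c.IsCycle := by
      rw [← hc]; exact List.isCycle_formPerm hnd hlen
    have hca : c a = a := by
      rw [← Equiv.Perm.notMem_support, hsc]; simpa using hac
    have hra : r a = a := by
      have : c⁻¹ a = a := by rw [Equiv.Perm.inv_eq_iff_eq, hca]
      rw [hrdef, Equiv.Perm.mul_apply, this, ha]
    have hdis : Equiv.Perm.Disjoint (Equiv.swap a b * c) r := by
      rw [Equiv.Perm.disjoint_iff_disjoint_support, hs', List.toFinset_cons, ← hsc,
        Finset.disjoint_insert_left]
      exact ⟨by simpa using hra, Equiv.Perm.disjoint_iff_disjoint_support.1 hr.symm⟩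
    have e1 : Equiv.swap a b * g = (Equiv.swap a b * c) * r := by
      rw [mul_assoc, ← hg]
    have h1 := hle (Equiv.swap a b * g)
    rw [e1, hdis.card_support_mul, hcard] at h1
    rw [e1, hdis.cycleType_mul, hdis.card_support_mul, hcyc.cycleType, hcard]
    conv_rhs => rw [hg, hr.symm.cycleType_mul, hr.symm.card_support_mul, hcyc'.cycleType]
    simp only [Multiset.card_add, Multiset.card_singleton]
    omega

theorem card_parts_partition_decomposeFin {n : ℕ} (p : Fin (n + 1)) (e : Equiv.Perm (Fin n)) :
    Multiset.card (Equiv.Perm.decomposeFin.symm (p, e)).partition.parts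
      = Multiset.card e.partition.parts + if p = 0 then 1 else 0 := by
  have h0 : Equiv.Perm.decomposeFin.symm (0, e) = e.extendDomain (finSuccAboveEquiv 0) := by
    ext i
    refine Fin.cases ?_ (fun j => ?_) i
    · rw [Equiv.Perm.extendDomain_apply_not_subtype _ _ (by simp)]; simp
    · have := Equiv.Perm.extendDomain_apply_image e (finSuccAboveEquiv (0 : Fin (n+1))) j
      simp only [finSuccAboveEquiv_apply, Fin.succAbove_zero] at this
      rw [this]; simp
  have hz : Multiset.card (Equiv.Perm.decomposeFin.symm (0, e)).partition.parts
      = Multiset.card e.partition.parts + 1 := by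
    have : e.support.card ≤ n := by simpa using Finset.card_le_univ e.support
    rw [h0]
    simp only [Equiv.Perm.parts_partition, Multiset.card_add, Multiset.card_replicate,
      Equiv.Perm.cycleType_extendDomain, Equiv.Perm.card_support_extend_domain, Fintype.card_fin]
    omega
  split_ifs with hp
  · rw [hp, hz]
  · have hs : Equiv.Perm.decomposeFin.symm (p, e)
        = Equiv.swap 0 p * Equiv.Perm.decomposeFin.symm (0, e) := by
      ext i
      refine Fin.cases ?_ (fun j => ?_) i <;> simp
    have := card_parts_partition_swap_mul (Equiv.Perm.decomposeFin.symm (0, e)) 0 p (by simp)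
      (Ne.symm hp)
    rw [← hs, hz] at this
    omega

theorem sum_pow_card_parts_partition (θ : ℝ) (n : ℕ) :
    ∑ σ : Equiv.Perm (Fin n), θ ^ Multiset.card σ.partition.parts
      = ∏ i ∈ Finset.range n, (θ + i) := by
  induction n with
  | zero => simp [Equiv.Perm.parts_partition]
  | succ n ih =>
    rw [← Equiv.Perm.decomposeFin.symm.sum_comp, Fintype.sum_prod_type, Fin.sum_univ_succ,
      Finset.prod_range_succ, ← ih]
    simp only [card_parts_partition_decomposeFin, Fin.succ_ne_zero, if_true, if_false, pow_succ,
      add_zero, Finset.sum_const, Finset.card_univ, Fintype.card_fin, nsmul_eq_mul,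
      ← Finset.sum_mul]
    ring

/-! ### Cycle counts and the Ewens measure -/

/-- `cycleCount σ m` is the number of cycles of length `m` of `σ`; fixed points are cycles of
length one (`σ.partition` is the full cycle type of `σ`, fixed points included). -/
def cycleCount {n : ℕ} (σ : Equiv.Perm (Fin n)) (m : ℕ) : ℕ :=
  σ.partition.parts.count m

/-- The total number of cycles of `σ`, fixed points included. -/
def numCycles {n : ℕ} (σ : Equiv.Perm (Fin n)) : ℕ :=
  Multiset.card σ.partition.parts

/-- The symmetric group carries the discrete `σ`-algebra. -/
instance permMeasurableSpace (n : ℕ) : MeasurableSpace (Equiv.Perm (Fin n)) := ⊤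

instance permDiscreteMeasurableSpace (n : ℕ) :
    DiscreteMeasurableSpace (Equiv.Perm (Fin n)) := ⟨fun _ => trivial⟩

/-- The Ewens weight `θ ^ ℓ(σ) / (θ (θ + 1) ⋯ (θ + n - 1))`, where `ℓ(σ)` is the number of
cycles. -/
noncomputable def ewensWeight (θ : ℝ) {n : ℕ} (σ : Equiv.Perm (Fin n)) : ℝ :=
  θ ^ numCycles σ / ∏ i ∈ Finset.range n, (θ + i)

/-- The Ewens measure on `S_n` with parameter `θ > 0`. -/
noncomputable def ewensMeasure (θ : ℝ) (_hθ : 0 < θ) (n : ℕ) : Measure (Equiv.Perm (Fin n)) :=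
  ∑ σ : Equiv.Perm (Fin n), ENNReal.ofReal (ewensWeight θ σ) • Measure.dirac σ

instance isProbabilityMeasure_ewensMeasure (θ : ℝ) (hθ : 0 < θ) (n : ℕ) :
    IsProbabilityMeasure (ewensMeasure θ hθ n) := by
  have hpos : 0 < ∏ i ∈ Finset.range n, (θ + i) := Finset.prod_pos fun i _ => by positivity
  have hnn : ∀ σ : Equiv.Perm (Fin n), 0 ≤ ewensWeight θ σ := fun σ => by
    unfold ewensWeight; positivity
  constructor
  simp only [ewensMeasure, Measure.coe_finsetSum, Finset.sum_apply, Measure.smul_apply,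
    measure_univ, smul_eq_mul, mul_one]
  rw [← ENNReal.ofReal_sum_of_nonneg fun σ _ => hnn σ]
  simp only [ewensWeight, numCycles, ← Finset.sum_div, sum_pow_card_parts_partition]
  rw [div_self hpos.ne', ENNReal.ofReal_one]

/-! ### Multiplicative class functions -/

/-- `f` is real analytic on the unit circle, seen as a real analytic manifold. -/
def RealAnalyticOnCircle (f : Circle → ℂ) : Prop :=
  ContMDiff (𝓡 1) 𝓘(ℝ, ℂ) ω f

/-- `w^n(f)(x)(σ) = ∑_{m=1}^n C_m(σ) log (f (x ^ m))`, the logarithm of the multiplicative class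
function `∏_{m=1}^n f (x ^ m) ^ C_m(σ)`. Here `Complex.log` is the principal branch, with
`log (-y) = log y + i π` for `y > 0`. It is only used where `f (x ^ m) ≠ 0`. -/
noncomputable def logClassFun (f : Circle → ℂ) (x : Circle) {n : ℕ}
    (σ : Equiv.Perm (Fin n)) : ℂ :=
  ∑ m ∈ Finset.Icc 1 n, (cycleCount σ m : ℂ) * Complex.log (f (x ^ m))

/-- The function `s ↦ log (f (exp (2 π i s)))`. -/
noncomputable def logOnCircle (f : Circle → ℂ) (s : ℝ) : ℂ :=
  Complex.log (f (Circle.exp (2 * Real.pi * s)))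

open Classical in
/-- The logarithmic Mahler measure `m(f)(x)`: the mean of `log f` over the closed subgroup
generated by `x`, that is, over the powers of `x` if `x` is a root of unity, and over the whole
circle otherwise. It is only used where the sum has no term `log 0`, respectively where the
integral converges. -/
noncomputable def logMahler (f : Circle → ℂ) (x : Circle) : ℂ :=
  if IsOfFinOrder x then
    (1 / (orderOf x : ℂ)) * ∑ m ∈ Finset.Icc 1 (orderOf x), Complex.log (f (x ^ m))
  else ∫ s in (0 : ℝ)..1, logOnCircle f s

/-- The random variable `w^n(f)(x) / √(log n) - θ √(log n) m(f)(x)` on `S_n`. -/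
noncomputable def normalizedLog (θ : ℝ) (f : Circle → ℂ) (x : Circle) (n : ℕ)
    (σ : Equiv.Perm (Fin n)) : ℂ :=
  logClassFun f x σ / (√(Real.log n) : ℂ) - (θ : ℂ) * (√(Real.log n) : ℂ) * logMahler f x

/-! ### Finite type -/

/-- The distance of `s` to the nearest integer. -/
noncomputable def distNearestInt (s : ℝ) : ℝ :=
  min (Int.fract s) (1 - Int.fract s)

/-- `x = exp (2 π i t)` is of finite type: for some `K, γ > 0`, the distance of `m t` to the
nearest integer exceeds `K / |m| ^ γ` for all integers `m ≠ 0`. -/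
def IsFiniteType (x : Circle) : Prop :=
  ∃ t : ℝ, x = Circle.exp (2 * Real.pi * t) ∧
    ∃ K γ : ℝ, 0 < K ∧ 0 < γ ∧
      ∀ m : ℤ, m ≠ 0 → K / |(m : ℝ)| ^ γ < distNearestInt (m * t)

end EwensCLT

/-!
For cycle weights `t_m`, the Ewens mean `M_n` of `∏ t_m ^ C_m` satisfies a linear recursion: the
cycle through a given point is removed, which leaves a random number `j < n` of points, and `M_n` is
the average of `t_{n-j} M_j` over `j`. For a constant weight `s` the solution is
`∏ (θ s + j) / (θ + j)`, about `n ^ (θ (s - 1))`. For `t_m = exp (i α c_m)` with `α` of order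
`1 / √(log n)`, summation by parts shows that `t` enters the recursion only through its mean, up to
errors whose sum tends to zero; so `t` may be replaced by the constant
`s = 1 + i α μ - α ^ 2 ν / 2 + O(α ^ 3)`, where `μ` and `ν` are the means of `c_m` and `c_m ^ 2`,
and the Gaussian characteristic function with variance `θ ν` appears. What is asked of `c` is that
the averages of its powers up to the fourth converge with a power saving, and that it grows more
slowly than every power.

This is applied to `c_m = ⟪ξ, log f (x ^ m)⟫` for all `ξ ∈ ℂ`. At a root of unity, `c` is periodic.
At a point `x = exp (2 π i t)` of finite type, Dirichlet's theorem gives a rational approximation of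
`t` whose denominator is neither too small nor too large, so the `m t` are equidistributed with a
power saving for Lipschitz functions; `log f` is cut off to a Lipschitz function near its
singularities, where it is integrable. Individual terms stay small because `x ^ m` cannot come close
to a zero of `f`, which is a root of unity.
-/

namespace EwensCLT

/-! ### The cycle recursion for multiplicative statistics -/

section CycleIndex

/-- The number `∏ m ^ c_m c_m!` attached to a multiset of positive integers with multiplicities
`c_m`: the order of the centralizer of a permutation whose cycle lengths, fixed points included,
form that multiset. -/
def centralizerCard (s : Multiset ℕ) : ℕ :=
  s.prod * ∏ m ∈ s.toFinset, (s.count m).factorial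

theorem centralizerCard_cons (m : ℕ) (s : Multiset ℕ) :
    centralizerCard (m ::ₘ s) = (m ::ₘ s).count m * m * centralizerCard s := by
  have hinsert : ∏ i ∈ s.toFinset, (s.count i).factorial
      = ∏ i ∈ insert m s.toFinset, (s.count i).factorial :=
    Finset.prod_subset (Finset.subset_insert _ _) fun i _ hi => by
      rw [Multiset.count_eq_zero_of_notMem (by simpa using hi), Nat.factorial_zero]
  have herase : ∏ i ∈ (insert m s.toFinset).erase m, ((m ::ₘ s).count i).factorial
      = ∏ i ∈ (insert m s.toFinset).erase m, (s.count i).factorial :=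
    Finset.prod_congr rfl fun i hi => by
      rw [Multiset.count_cons_of_ne (Finset.ne_of_mem_erase hi)]
  have hm := Finset.mem_insert_self m s.toFinset
  rw [centralizerCard, centralizerCard, hinsert, Multiset.prod_cons, Multiset.toFinset_cons,
    ← Finset.mul_prod_erase _ _ hm, herase, ← Finset.mul_prod_erase _ _ hm,
    Multiset.count_cons_self, Nat.factorial_succ]
  ring

theorem centralizerCard_add_replicate_one {s : Multiset ℕ} (hs : 1 ∉ s) (k : ℕ) :
    centralizerCard (s + Multiset.replicate k 1) = k.factorial * centralizerCard s := by
  induction k with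
  | zero => simp
  | succ k ih =>
    rw [Multiset.replicate_succ, Multiset.add_cons, centralizerCard_cons, ih,
      Multiset.count_cons_self, Multiset.count_add, Multiset.count_eq_zero_of_notMem hs,
      Multiset.count_replicate_self, Nat.factorial_succ]
    ring

theorem centralizerCard_ne_zero {s : Multiset ℕ} (hs : 0 ∉ s) : centralizerCard s ≠ 0 :=
  mul_ne_zero (Multiset.prod_ne_zero hs)
    (Finset.prod_ne_zero_iff.2 fun _ _ => Nat.factorial_ne_zero _)

theorem filter_two_le_add_replicate_count_one {n : ℕ} (p : n.Partition) :
    p.parts.filter (2 ≤ ·) + Multiset.replicate (p.parts.count 1) 1 = p.parts := by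
  have hone : ∀ b ∈ p.parts, (¬ 2 ≤ b ↔ b = 1) := fun b hb => by
    have := p.parts_pos hb
    omega
  rw [← Multiset.filter_eq', ← Multiset.filter_congr hone, Multiset.filter_add_not]

theorem sum_filter_two_le_add_count_one {n : ℕ} (p : n.Partition) :
    (p.parts.filter (2 ≤ ·)).sum + p.parts.count 1 = n := by
  simpa [p.parts_sum] using congrArg Multiset.sum (filter_two_le_add_replicate_count_one p)

variable {α : Type*} [Fintype α] [DecidableEq α]

theorem partition_eq_iff_cycleType_eq (p : (Fintype.card α).Partition) (σ : Equiv.Perm α) :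
    σ.partition = p ↔ σ.cycleType = p.parts.filter (2 ≤ ·) := by
  rw [← Equiv.Perm.filter_parts_partition_eq_cycleType]
  refine ⟨fun h => by rw [h], fun h => Nat.Partition.ext ?_⟩
  have hσ := sum_filter_two_le_add_count_one σ.partition
  have hp := sum_filter_two_le_add_count_one p
  rw [h] at hσ
  rw [← filter_two_le_add_replicate_count_one σ.partition,
    ← filter_two_le_add_replicate_count_one p, h, show
      σ.partition.parts.count 1 = p.parts.count 1 by omega]

theorem card_partition_eq_mul_centralizerCard (p : (Fintype.card α).Partition) :
    (Finset.univ.filter fun σ : Equiv.Perm α => σ.partition = p).card * centralizerCard p.parts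
      = (Fintype.card α).factorial := by
  have hsum := sum_filter_two_le_add_count_one p
  have hcard := Equiv.Perm.card_of_cycleType_mul_eq (α := α) (p.parts.filter (2 ≤ ·))
  rw [if_pos ⟨by omega, fun _ ha => (Multiset.mem_filter.1 ha).2⟩, mul_assoc,
    show Fintype.card α - (p.parts.filter (2 ≤ ·)).sum = p.parts.count 1 by omega] at hcard
  have hz : centralizerCard p.parts
      = (p.parts.count 1).factorial * centralizerCard (p.parts.filter (2 ≤ ·)) := by
    rw [← centralizerCard_add_replicate_one (by simp), filter_two_le_add_replicate_count_one]
  simp only [partition_eq_iff_cycleType_eq]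
  rw [hz, centralizerCard, ← hcard]

/-- The contribution `∏ (a_m / m) ^ c_m / c_m!` to the cycle index of the symmetric group of the
permutations whose cycle lengths have multiplicities `c_m`. -/
noncomputable def cycleWeight (a : ℕ → ℂ) (s : Multiset ℕ) : ℂ :=
  (s.map a).prod / centralizerCard s

theorem sum_prod_map_parts (a : ℕ → ℂ) {n : ℕ} (hn : Fintype.card α = n) :
    ∑ σ : Equiv.Perm α, (σ.partition.parts.map a).prod
      = n.factorial * ∑ p : n.Partition, cycleWeight a p.parts := by
  subst hn
  rw [← Finset.sum_fiberwise_of_maps_to (s := Finset.univ) (t := Finset.univ)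
    (g := fun σ : Equiv.Perm α => σ.partition) (fun _ _ => Finset.mem_univ _), Finset.mul_sum]
  refine Finset.sum_congr rfl fun p _ => ?_
  have hp : (centralizerCard p.parts : ℂ) ≠ 0 :=
    Nat.cast_ne_zero.2 (centralizerCard_ne_zero fun h => (p.parts_pos h).ne' rfl)
  rw [Finset.sum_congr rfl fun σ hσ => by rw [(Finset.mem_filter.1 hσ).2], Finset.sum_const,
    nsmul_eq_mul, ← card_partition_eq_mul_centralizerCard p, cycleWeight]
  push_cast
  field_simp

end CycleIndex

theorem count_mul_cycleWeight_cons (a : ℕ → ℂ) {m : ℕ} (hm : m ≠ 0) (s : Multiset ℕ) :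
    ((m ::ₘ s).count m * m : ℂ) * cycleWeight a (m ::ₘ s) = a m * cycleWeight a s := by
  have hcount : ((m ::ₘ s).count m * m : ℂ) ≠ 0 := by
    simp [hm, Nat.cast_add_one_ne_zero]
  rw [cycleWeight, centralizerCard_cons, Multiset.map_cons, Multiset.prod_cons, cycleWeight]
  push_cast
  rw [mul_div_mul_comm, ← mul_assoc, mul_div_cancel₀ _ hcount]

theorem sum_count_mul_cycleWeight (a : ℕ → ℂ) {n m : ℕ} (hm : 1 ≤ m) (hmn : m ≤ n) :
    ∑ p : n.Partition, (p.parts.count m * m : ℂ) * cycleWeight a p.parts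
      = a m * ∑ ν : (n - m).Partition, cycleWeight a ν.parts := by
  have hvanish : ∑ p : {p : n.Partition // m ∉ p.parts},
      (p.1.parts.count m * m : ℂ) * cycleWeight a p.1.parts = 0 :=
    Finset.sum_eq_zero fun p _ => by simp [Multiset.count_eq_zero_of_notMem p.2]
  rw [← Fintype.sum_subtype_add_sum_subtype fun p : n.Partition => m ∈ p.parts, hvanish, add_zero,
    Finset.mul_sum,
    ← (Nat.Partition.partitionWithPartEquiv hm hmn).symm.sum_comp]
  refine Finset.sum_congr rfl fun ν _ => ?_
  rw [Nat.Partition.partitionWithPartEquiv_symm_apply_parts,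
    count_mul_cycleWeight_cons a (by omega)]

theorem nat_mul_sum_cycleWeight (a : ℕ → ℂ) (n : ℕ) :
    (n : ℂ) * ∑ p : n.Partition, cycleWeight a p.parts
      = ∑ m ∈ Finset.Icc 1 n, a m * ∑ ν : (n - m).Partition, cycleWeight a ν.parts := by
  have hparts : ∀ p : n.Partition, ∑ m ∈ Finset.Icc 1 n, p.parts.count m * m = n := fun p => by
    conv_rhs => rw [← p.parts_sum, Finset.sum_multiset_count_of_subset p.parts (Finset.Icc 1 n)
      fun i hi => Finset.mem_Icc.2 ⟨p.parts_pos (Multiset.mem_toFinset.1 hi),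
        Nat.Partition.le_of_mem_parts (Multiset.mem_toFinset.1 hi)⟩]
    rfl
  rw [← Finset.sum_congr rfl fun m hm => sum_count_mul_cycleWeight a
    (Finset.mem_Icc.1 hm).1 (Finset.mem_Icc.1 hm).2, Finset.sum_comm, Finset.mul_sum]
  refine Finset.sum_congr rfl fun p _ => ?_
  rw [← Finset.sum_mul]
  exact_mod_cast congrArg (fun k : ℕ => (k : ℂ) * cycleWeight a p.parts) (hparts p).symm

/-- `∏_{j < n} (θ + j) / (j + 1)`, the coefficient of `z ^ n` in `(1 - z) ^ (-θ)`. -/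
noncomputable def risingBinom (θ : ℝ) (n : ℕ) : ℝ := ∏ j ∈ Finset.range n, (θ + j) / (j + 1)

theorem risingBinom_eq_div_factorial (θ : ℝ) (n : ℕ) :
    risingBinom θ n = (∏ j ∈ Finset.range n, (θ + j)) / n.factorial := by
  rw [risingBinom, Finset.prod_div_distrib, ← Finset.prod_range_add_one_eq_factorial]
  push_cast
  rfl

/-- The expectation of `∏ t_m ^ C_m` under the Ewens measure. -/
noncomputable def ewensMean (θ : ℝ) (t : ℕ → ℂ) (n : ℕ) : ℂ :=
  ∑ σ : Equiv.Perm (Fin n), (ewensWeight θ σ : ℂ) * (σ.partition.parts.map t).prod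

theorem ewensMean_zero (θ : ℝ) (t : ℕ → ℂ) : ewensMean θ t 0 = 1 := by
  simp [ewensMean, ewensWeight, numCycles, Equiv.Perm.parts_partition]

theorem ewensMean_eq_sum_div (θ : ℝ) (t : ℕ → ℂ) (n : ℕ) :
    ewensMean θ t n = (∑ σ : Equiv.Perm (Fin n), (σ.partition.parts.map (fun m => θ * t m)).prod)
      / (∏ i ∈ Finset.range n, (θ + i) : ℝ) := by
  rw [ewensMean, Finset.sum_div]
  refine Finset.sum_congr rfl fun σ _ => ?_
  rw [Multiset.prod_map_mul, Multiset.map_const', Multiset.prod_replicate, ewensWeight, numCycles]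
  push_cast
  ring

section Positive

variable {θ : ℝ} (hθ : 0 < θ)
include hθ

theorem risingBinom_pos (n : ℕ) : 0 < risingBinom θ n :=
  Finset.prod_pos fun _ _ => by positivity

theorem risingBinom_mul_ewensMean (t : ℕ → ℂ) (n : ℕ) :
    (risingBinom θ n : ℂ) * ewensMean θ t n
      = ∑ p : n.Partition, cycleWeight (fun m => θ * t m) p.parts := by
  have hpos : 0 < ∏ i ∈ Finset.range n, (θ + i) := Finset.prod_pos fun i _ => by positivity
  have hprod : ((∏ i ∈ Finset.range n, (θ + i) : ℝ) : ℂ) ≠ 0 := by exact_mod_cast hpos.ne'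
  have hfact : (n.factorial : ℂ) ≠ 0 := by exact_mod_cast n.factorial_ne_zero
  rw [ewensMean_eq_sum_div, sum_prod_map_parts _ (Fintype.card_fin n),
    risingBinom_eq_div_factorial, Complex.ofReal_div, Complex.ofReal_natCast]
  field_simp

theorem ewensMean_rec (t : ℕ → ℂ) (n : ℕ) :
    (n * risingBinom θ n : ℂ) * ewensMean θ t n
      = θ * ∑ j ∈ Finset.range n, (risingBinom θ j : ℂ) * (t (n - j) * ewensMean θ t j) := by
  rw [mul_assoc, risingBinom_mul_ewensMean hθ, nat_mul_sum_cycleWeight, Finset.mul_sum]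
  refine Finset.sum_nbij' (n - ·) (n - ·) (by grind) (by grind) (by grind) (by grind) fun m hm => ?_
  rw [← risingBinom_mul_ewensMean hθ, Nat.sub_sub_self (Finset.mem_Icc.1 hm).2]
  ring

end Positive

/-! ### Averages over the size of the permutation left after removing a cycle -/

theorem succ_mul_risingBinom_succ (θ : ℝ) (n : ℕ) :
    ((n + 1 : ℕ) : ℝ) * risingBinom θ (n + 1) = (θ + n) * risingBinom θ n := by
  rw [risingBinom, Finset.prod_range_succ, ← risingBinom]
  push_cast
  field_simp

theorem mul_sum_risingBinom (θ : ℝ) (n : ℕ) :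
    θ * ∑ j ∈ Finset.range n, risingBinom θ j = n * risingBinom θ n := by
  induction n with
  | zero => simp
  | succ n ih =>
    rw [Finset.sum_range_succ, mul_add, ih, succ_mul_risingBinom_succ]
    ring

theorem sum_Ico_mul_sub {R : Type*} [CommRing R] (u v : ℕ → R) {J k : ℕ} (h : J ≤ k) :
    ∑ j ∈ Finset.Ico J k, u j * (v j - v (j + 1))
      = u J * v J - u k * v k + ∑ j ∈ Finset.Ico J k, (u (j + 1) - u j) * v (j + 1) := by
  induction k, h using Nat.le_induction with
  | base => simp
  | succ k hk ih =>
    rw [Finset.sum_Ico_succ_top hk, Finset.sum_Ico_succ_top hk, ih]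
    ring

/-- The averages of `c` over `{1, …, N}` tend to `μ` with a power saving. -/
def HasPowerMean (c : ℕ → ℝ) (μ : ℝ) : Prop :=
  ∃ δ C : ℝ, 0 < δ ∧ δ < 1 ∧ ∀ N : ℕ, 1 ≤ N →
    |∑ m ∈ Finset.Icc 1 N, c m - N * μ| ≤ C * (N : ℝ) ^ (1 - δ)

/-- The sequence `c` grows more slowly than every power. -/
def IsSubpoly (c : ℕ → ℝ) : Prop :=
  ∀ ε : ℝ, 0 < ε → ∃ C : ℝ, ∀ m : ℕ, 1 ≤ m → |c m| ≤ C * (m : ℝ) ^ ε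

/-- The modulating factors admitted in weighted averages over permutation sizes: they are bounded
by one, and their product with `risingBinom θ` varies slowly enough for summation by parts. -/
structure IsSlow (θ : ℝ) (Φ : ℕ → ℂ) : Prop where
  norm_le_one (j : ℕ) : ‖Φ j‖ ≤ 1
  norm_sub_le (j : ℕ) : ‖(risingBinom θ (j + 1) : ℂ) * Φ (j + 1) - risingBinom θ j * Φ j‖
    ≤ (θ + 1) * risingBinom θ j / (j + 1)

/-- The average of `F` over the size of a random permutation of `n` points from which a random
cycle has been removed; the weights add up to one by `mul_sum_risingBinom`. -/
noncomputable def cycleAvg (θ : ℝ) (F : ℕ → ℂ) (n : ℕ) : ℂ :=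
  (θ / (n * risingBinom θ n) : ℝ) * ∑ j ∈ Finset.range n, (risingBinom θ j : ℂ) * F j

theorem sum_Ico_one_div_mul_succ_le {J : ℕ} (hJ : 1 ≤ J) (n : ℕ) :
    ∑ j ∈ Finset.Ico J n, 1 / ((j : ℝ) * (j + 1)) ≤ 1 / J := by
  rcases le_total n J with h | h
  · simp [Finset.Ico_eq_empty_of_le h]
  have htelescope : ∀ j ∈ Finset.Ico J n,
      1 / ((j : ℝ) * (j + 1)) = 1 / (j : ℝ) - 1 / ((j + 1 : ℕ) : ℝ) := fun j hj => by
    have hj0 : (0 : ℝ) < j := by exact_mod_cast hJ.trans (Finset.mem_Ico.1 hj).1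
    push_cast
    field_simp
    ring
  have hparts := sum_Ico_mul_sub (fun _ => (1 : ℝ)) (fun j => 1 / (j : ℝ)) h
  simp only [one_mul, sub_self, zero_mul, Finset.sum_const_zero, add_zero] at hparts
  rw [Finset.sum_congr rfl htelescope, hparts]
  exact sub_le_self _ (by positivity)

theorem exists_nat_between_rpow {n : ℕ} (hn : 1 ≤ n) {a : ℝ} (ha : 0 ≤ a) (ha1 : a ≤ 1) :
    ∃ J : ℕ, 1 ≤ J ∧ J ≤ n ∧ (n : ℝ) ^ a ≤ J ∧ (J : ℝ) ≤ 2 * (n : ℝ) ^ a := by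
  have hn1 : (1 : ℝ) ≤ n := by exact_mod_cast hn
  have hroot : (1 : ℝ) ≤ (n : ℝ) ^ a := Real.one_le_rpow hn1 ha
  have hle : (n : ℝ) ^ a ≤ ⌈(n : ℝ) ^ a⌉₊ := Nat.le_ceil _
  refine ⟨⌈(n : ℝ) ^ a⌉₊, by exact_mod_cast hroot.trans hle, Nat.ceil_le.2 ?_, hle, ?_⟩
  · simpa using Real.rpow_le_rpow_of_exponent_le hn1 ha1
  · linarith [Nat.ceil_lt_add_one (zero_le_one.trans hroot)]

section Positive

variable {θ : ℝ} (hθ : 0 < θ)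
include hθ

theorem monotone_mul_risingBinom : Monotone fun n : ℕ => n * risingBinom θ n :=
  monotone_nat_of_le_succ fun n => by
    rw [succ_mul_risingBinom_succ]
    exact mul_le_mul_of_nonneg_right (by linarith) (risingBinom_pos hθ n).le

theorem risingBinom_le_mul_one_div {j n : ℕ} (hj : 1 ≤ j) (hjn : j ≤ n) :
    risingBinom θ j ≤ n * risingBinom θ n * (1 / j) := by
  rw [mul_one_div, le_div_iff₀ (by exact_mod_cast hj), mul_comm]
  exact monotone_mul_risingBinom hθ hjn

theorem mul_risingBinom_le_mul_div_rpow {J n : ℕ} (hJ : 1 ≤ J) (hJn : J ≤ n) :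
    J * risingBinom θ J ≤ n * risingBinom θ n * ((J : ℝ) / n) ^ min θ 1 := by
  have hJ0 : (0 : ℝ) < J := by exact_mod_cast hJ
  induction n, hJn using Nat.le_induction with
  | base => simp [hJ0.ne']
  | succ n hn ih =>
    have hn0 : (0 : ℝ) < n := by exact_mod_cast hJ.trans hn
    have hp := risingBinom_pos hθ n
    have hbernoulli : (1 + 1 / (n : ℝ)) ^ min θ 1 ≤ 1 + θ * (1 / n) :=
      (rpow_one_add_le_one_add_mul_self (by linarith [one_div_pos.2 hn0])
        (by positivity) (min_le_right _ _)).trans (by gcongr; exact min_le_left _ _)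
    have hsplit : ((J : ℝ) / n) ^ min θ 1
        = (1 + 1 / (n : ℝ)) ^ min θ 1 * ((J : ℝ) / (n + 1 : ℕ)) ^ min θ 1 := by
      rw [← Real.mul_rpow (by positivity) (by positivity)]
      push_cast
      field_simp
    calc J * risingBinom θ J ≤ n * risingBinom θ n * ((J : ℝ) / n) ^ min θ 1 := ih
      _ ≤ n * risingBinom θ n * ((1 + θ * (1 / n)) * ((J : ℝ) / (n + 1 : ℕ)) ^ min θ 1) := by
          rw [hsplit]
          gcongr
      _ = _ := by
          rw [succ_mul_risingBinom_succ]
          field_simp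
          ring

theorem norm_cycleAvg (F : ℕ → ℂ) (n : ℕ) :
    ‖cycleAvg θ F n‖
      = θ / (n * risingBinom θ n) * ‖∑ j ∈ Finset.range n, (risingBinom θ j : ℂ) * F j‖ := by
  have := risingBinom_pos hθ n
  rw [cycleAvg, norm_mul, Complex.norm_real, Real.norm_of_nonneg (by positivity)]

variable {Φ : ℕ → ℂ} (hΦ : IsSlow θ Φ) {g : ℕ → ℝ} {B : ℝ} {J n : ℕ}
include hΦ

theorem norm_sum_range_le (hJ : J ≤ n) (hB : ∀ m ∈ Finset.Icc 1 n, |g m| ≤ B) :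
    ‖∑ j ∈ Finset.range J, (risingBinom θ j : ℂ) * ((g (n - j) : ℂ) * Φ j)‖
      ≤ B * (J * risingBinom θ J) / θ := by
  rw [← mul_sum_risingBinom, mul_div_assoc, mul_div_cancel_left₀ _ hθ.ne', Finset.mul_sum]
  refine (norm_sum_le _ _).trans (Finset.sum_le_sum fun j hj => ?_)
  have hj' := Finset.mem_range.1 hj
  have hg := hB (n - j) (Finset.mem_Icc.2 (by omega))
  have hp := risingBinom_pos hθ j
  rw [norm_mul, norm_mul, Complex.norm_real, Complex.norm_real, Real.norm_of_nonneg hp.le,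
    Real.norm_eq_abs, mul_comm B]
  gcongr
  exact (mul_le_of_le_one_right (abs_nonneg _) (hΦ.norm_le_one j)).trans hg

theorem norm_sum_Ico_le (hJ : J ≤ n) (hB : ∀ j ≤ n, |∑ m ∈ Finset.Icc 1 j, g m| ≤ B) :
    ‖∑ j ∈ Finset.Ico J n, (risingBinom θ j : ℂ) * ((g (n - j) : ℂ) * Φ j)‖
      ≤ B * (risingBinom θ J + ∑ j ∈ Finset.Ico J n, (θ + 1) * risingBinom θ j / (j + 1)) := by
  set R : ℕ → ℂ := fun j => ((∑ m ∈ Finset.Icc 1 (n - j), g m : ℝ) : ℂ) with hR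
  have hRB : ∀ j, ‖R j‖ ≤ B := fun j => by
    rw [hR, Complex.norm_real]
    exact hB _ (Nat.sub_le _ _)
  have hRn : R n = 0 := by simp [hR]
  have hdiff : ∀ j ∈ Finset.Ico J n, (risingBinom θ j : ℂ) * ((g (n - j) : ℂ) * Φ j)
      = risingBinom θ j * Φ j * (R j - R (j + 1)) := fun j hj => by
    have hsub : n - j = n - (j + 1) + 1 := by have := (Finset.mem_Ico.1 hj).2; omega
    simp only [hR]
    rw [hsub, Finset.sum_Icc_succ_top (by omega)]
    push_cast
    ring
  rw [Finset.sum_congr rfl hdiff, sum_Ico_mul_sub (fun j => (risingBinom θ j * Φ j : ℂ)) R hJ,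
    hRn, mul_zero, sub_zero, mul_add, Finset.mul_sum]
  refine (norm_add_le _ _).trans (add_le_add ?_ ((norm_sum_le _ _).trans ?_))
  · rw [norm_mul, norm_mul, Complex.norm_real, Real.norm_of_nonneg (risingBinom_pos hθ J).le,
      mul_comm B]
    exact mul_le_mul (mul_le_of_le_one_right (risingBinom_pos hθ J).le (hΦ.norm_le_one J)) (hRB J)
      (norm_nonneg _) (risingBinom_pos hθ J).le
  · refine Finset.sum_le_sum fun j _ => ?_
    rw [norm_mul, mul_comm B]
    exact mul_le_mul (hΦ.norm_sub_le j) (hRB _) (norm_nonneg _)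
      ((norm_nonneg _).trans (hΦ.norm_sub_le j))

theorem norm_sum_Ico_le_mul_div (hJ1 : 1 ≤ J) (hJ : J ≤ n)
    (hB : ∀ j ≤ n, |∑ m ∈ Finset.Icc 1 j, g m| ≤ B) :
    ‖∑ j ∈ Finset.Ico J n, (risingBinom θ j : ℂ) * ((g (n - j) : ℂ) * Φ j)‖
      ≤ B * (n * risingBinom θ n * (θ + 2) / J) := by
  have hB0 : 0 ≤ B := (abs_nonneg _).trans (hB 0 n.zero_le)
  have hterm : ∀ j ∈ Finset.Ico J n, (θ + 1) * risingBinom θ j / (j + 1)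
      ≤ (θ + 1) * (n * risingBinom θ n) * (1 / ((j : ℝ) * (j + 1))) := fun j hj => by
    have hj' := Finset.mem_Ico.1 hj
    calc (θ + 1) * risingBinom θ j / (j + 1)
        ≤ (θ + 1) * (n * risingBinom θ n * (1 / j)) / (j + 1) := by
          gcongr
          exact risingBinom_le_mul_one_div hθ (hJ1.trans hj'.1) hj'.2.le
      _ = _ := by
        rw [one_div, one_div, mul_inv]
        ring
  have hpos := risingBinom_pos hθ n
  refine (norm_sum_Ico_le hθ hΦ hJ hB).trans (mul_le_mul_of_nonneg_left ?_ hB0)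
  calc risingBinom θ J + ∑ j ∈ Finset.Ico J n, (θ + 1) * risingBinom θ j / (j + 1)
      ≤ n * risingBinom θ n * (1 / J) + (θ + 1) * (n * risingBinom θ n) * (1 / J) := by
        refine add_le_add (risingBinom_le_mul_one_div hθ hJ1 hJ)
          ((Finset.sum_le_sum hterm).trans ?_)
        rw [← Finset.mul_sum]
        gcongr
        exact sum_Ico_one_div_mul_succ_le hJ1 n
    _ = _ := by ring

theorem norm_cycleAvg_le_of_cut {B' : ℝ} (hJ1 : 1 ≤ J) (hJ : J ≤ n)
    (hB : ∀ j ≤ n, |∑ m ∈ Finset.Icc 1 j, g m| ≤ B) (hB' : ∀ m ∈ Finset.Icc 1 n, |g m| ≤ B') :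
    ‖cycleAvg θ (fun j => (g (n - j) : ℂ) * Φ j) n‖
      ≤ B' * ((J : ℝ) / n) ^ min θ 1 + B * (θ * (θ + 2) / J) := by
  have hn : (0 : ℝ) < n := by exact_mod_cast hJ1.trans hJ
  have hp := risingBinom_pos hθ n
  have hB'0 : 0 ≤ B' := (abs_nonneg _).trans (hB' 1 (Finset.mem_Icc.2 ⟨le_rfl, hJ1.trans hJ⟩))
  have hhead : ‖∑ j ∈ Finset.range J, (risingBinom θ j : ℂ) * ((g (n - j) : ℂ) * Φ j)‖
      ≤ B' * (n * risingBinom θ n * ((J : ℝ) / n) ^ min θ 1) / θ :=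
    (norm_sum_range_le hθ hΦ hJ hB').trans
      (div_le_div_of_nonneg_right (mul_le_mul_of_nonneg_left
        (mul_risingBinom_le_mul_div_rpow hθ hJ1 hJ) hB'0) hθ.le)
  have htail := norm_sum_Ico_le_mul_div hθ hΦ hJ1 hJ hB
  rw [norm_cycleAvg hθ, ← Finset.sum_range_add_sum_Ico _ hJ]
  calc _ ≤ θ / (n * risingBinom θ n) * (B' * (n * risingBinom θ n * ((J : ℝ) / n) ^ min θ 1) / θ
        + B * (n * risingBinom θ n * (θ + 2) / J)) := by
        gcongr
        exact (norm_add_le _ _).trans (add_le_add hhead htail)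
    _ = _ := by field_simp

omit hΦ in
/-- A cycle is removed whose length is small only with small probability, so that the power saving
in the mean of `g` survives: cut at `J ≈ n ^ (1 - δ / 2)` and sum by parts above `J`. -/
theorem exists_norm_cycleAvg_le (hg : HasPowerMean g 0) (hs : IsSubpoly g) :
    ∃ δ C : ℝ, 0 < δ ∧ 0 ≤ C ∧ ∀ Φ : ℕ → ℂ, IsSlow θ Φ → ∀ n : ℕ, 1 ≤ n →
      ‖cycleAvg θ (fun j => (g (n - j) : ℂ) * Φ j) n‖ ≤ C * (n : ℝ) ^ (-δ) := by
  obtain ⟨δ, C, hδ, hδ1, hC⟩ := hg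
  set b := min θ 1
  have hb1 : b ≤ 1 := min_le_right _ _
  obtain ⟨C', hC'⟩ := hs (b * δ / 4) (by positivity)
  have hC0 : 0 ≤ C := by simpa using (abs_nonneg _).trans (hC 1 le_rfl)
  have hC'0 : 0 ≤ C' := by simpa using (abs_nonneg _).trans (hC' 1 le_rfl)
  refine ⟨b * δ / 4, C' * 2 ^ b + C * (θ * (θ + 2)), by positivity, by positivity,
    fun Φ hΦ n hn => ?_⟩
  have hn0 : (0 : ℝ) < n := by exact_mod_cast hn
  obtain ⟨J, hJ1, hJn, hJ_ge, hJ_le⟩ := exists_nat_between_rpow (a := 1 - δ / 2) hn (by linarith)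
    (by linarith)
  have hsum : ∀ j ≤ n, |∑ m ∈ Finset.Icc 1 j, g m| ≤ C * (n : ℝ) ^ (1 - δ) := fun j hj => by
    rcases j.eq_zero_or_pos with rfl | hj0
    · simpa using by positivity
    · simpa using (hC j hj0).trans (by gcongr)
  have hterm : ∀ m ∈ Finset.Icc 1 n, |g m| ≤ C' * (n : ℝ) ^ (b * δ / 4) := fun m hm =>
    (hC' m (Finset.mem_Icc.1 hm).1).trans (by gcongr; exact (Finset.mem_Icc.1 hm).2)
  have hratio : ((J : ℝ) / n) ^ b ≤ 2 ^ b * (n : ℝ) ^ (-(b * δ / 2)) := by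
    rw [show -(b * δ / 2) = (1 - δ / 2 - 1) * b by ring, Real.rpow_mul hn0.le,
      Real.rpow_sub_one hn0.ne', ← Real.mul_rpow (by positivity) (by positivity), ← mul_div_assoc]
    gcongr
  calc _ ≤ C' * (n : ℝ) ^ (b * δ / 4) * ((J : ℝ) / n) ^ b
        + C * (n : ℝ) ^ (1 - δ) * (θ * (θ + 2) / J) :=
        norm_cycleAvg_le_of_cut hθ hΦ hJ1 hJn hsum hterm
    _ ≤ C' * (n : ℝ) ^ (b * δ / 4) * (2 ^ b * (n : ℝ) ^ (-(b * δ / 2)))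
        + C * (n : ℝ) ^ (1 - δ) * (θ * (θ + 2) / (n : ℝ) ^ (1 - δ / 2)) := by gcongr
    _ = C' * 2 ^ b * (n : ℝ) ^ (-(b * δ / 4)) + C * (θ * (θ + 2)) * (n : ℝ) ^ (-(δ / 2)) := by
        rw [show -(b * δ / 4) = b * δ / 4 + -(b * δ / 2) by ring, Real.rpow_add hn0,
          show -(δ / 2) = 1 - δ - (1 - δ / 2) by ring, Real.rpow_sub hn0 (1 - δ) (1 - δ / 2)]
        ring
    _ ≤ _ := by
        rw [add_mul]
        gcongr
        · exact_mod_cast hn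
        · exact mul_le_of_le_one_left hδ.le hb1
        · norm_num

end Positive

theorem HasPowerMean.sub_const {c : ℕ → ℝ} {μ : ℝ} (h : HasPowerMean c μ) (a : ℝ) :
    HasPowerMean (fun m => c m - a) (μ - a) := by
  obtain ⟨δ, C, hδ, hδ1, hC⟩ := h
  refine ⟨δ, C, hδ, hδ1, fun N hN => ?_⟩
  simpa [Finset.sum_sub_distrib, mul_sub] using hC N hN

theorem HasPowerMean.sub_self {c : ℕ → ℝ} {μ : ℝ} (h : HasPowerMean c μ) :
    HasPowerMean (fun m => c m - μ) 0 := by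
  simpa using h.sub_const μ

theorem HasPowerMean.tendsto {c : ℕ → ℝ} {μ : ℝ} (h : HasPowerMean c μ) :
    Tendsto (fun N : ℕ => (∑ m ∈ Finset.Icc 1 N, c m) / N) atTop (𝓝 μ) := by
  obtain ⟨δ, C, hδ, -, hC⟩ := h
  have hbound : Tendsto (fun N : ℕ => C * (N : ℝ) ^ (-δ)) atTop (𝓝 0) := by
    simpa using ((tendsto_rpow_neg_atTop hδ).comp tendsto_natCast_atTop_atTop).const_mul C
  rw [tendsto_iff_norm_sub_tendsto_zero]
  refine squeeze_zero' (Eventually.of_forall fun _ => norm_nonneg _) ?_ hbound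
  filter_upwards [eventually_ge_atTop 1] with N hN
  have hN0 : (0 : ℝ) < N := by exact_mod_cast hN
  rw [div_sub' hN0.ne', norm_div, Real.norm_eq_abs, Real.norm_of_nonneg hN0.le, div_le_iff₀ hN0,
    mul_assoc, ← Real.rpow_add_one hN0.ne', neg_add_eq_sub]
  exact hC N hN

theorem HasPowerMean.sq_le {c : ℕ → ℝ} {μ ν : ℝ} (h : HasPowerMean c μ)
    (hsq : HasPowerMean (fun m => c m ^ 2) ν) : μ ^ 2 ≤ ν := by
  refine le_of_tendsto_of_tendsto' (h.tendsto.pow 2) hsq.tendsto fun N => ?_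
  simpa using sum_div_card_sq_le_sum_sq_div_card (s := Finset.Icc 1 N) (f := c)

theorem IsSubpoly.mul {c d : ℕ → ℝ} (hc : IsSubpoly c) (hd : IsSubpoly d) :
    IsSubpoly (fun m => c m * d m) := by
  intro ε hε
  obtain ⟨C, hC⟩ := hc (ε / 2) (by positivity)
  obtain ⟨D, hD⟩ := hd (ε / 2) (by positivity)
  refine ⟨C * D, fun m hm => ?_⟩
  have hm0 : (0 : ℝ) < m := by exact_mod_cast hm
  calc |c m * d m| ≤ (C * (m : ℝ) ^ (ε / 2)) * (D * (m : ℝ) ^ (ε / 2)) := by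
        rw [abs_mul]
        exact mul_le_mul (hC m hm) (hD m hm) (abs_nonneg _) ((abs_nonneg _).trans (hC m hm))
    _ = _ := by rw [mul_mul_mul_comm, ← Real.rpow_add hm0, add_halves]

theorem IsSubpoly.sub_const {c : ℕ → ℝ} (hc : IsSubpoly c) (μ : ℝ) :
    IsSubpoly (fun m => c m - μ) := by
  intro ε hε
  obtain ⟨C, hC⟩ := hc ε hε
  refine ⟨C + |μ|, fun m hm => ?_⟩
  have hpow : (1 : ℝ) ≤ (m : ℝ) ^ ε := Real.one_le_rpow (by exact_mod_cast hm) hε.le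
  calc |c m - μ| ≤ |c m| + |μ| := abs_sub _ _
    _ ≤ C * (m : ℝ) ^ ε + |μ| * (m : ℝ) ^ ε :=
        add_le_add (hC m hm) (le_mul_of_one_le_right (abs_nonneg _) hpow)
    _ = _ := by ring

theorem IsSubpoly.pow {c : ℕ → ℝ} (hc : IsSubpoly c) {k : ℕ} (hk : k ≠ 0) :
    IsSubpoly (fun m => c m ^ k) := by
  induction k, Nat.one_le_iff_ne_zero.2 hk using Nat.le_induction with
  | base => simpa using hc
  | succ k hk_pos ih =>
    simp only [pow_succ _ k]
    exact (ih (Nat.one_le_iff_ne_zero.1 hk_pos)).mul hc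

/-! ### Comparison with a constant cycle weight -/

theorem cycleAvg_add (θ : ℝ) (F G : ℕ → ℂ) (n : ℕ) :
    cycleAvg θ (fun j => F j + G j) n = cycleAvg θ F n + cycleAvg θ G n := by
  simp [cycleAvg, mul_add, Finset.sum_add_distrib]

theorem cycleAvg_const_mul (θ : ℝ) (a : ℂ) (F : ℕ → ℂ) (n : ℕ) :
    cycleAvg θ (fun j => a * F j) n = a * cycleAvg θ F n := by
  simp only [cycleAvg, Finset.mul_sum]
  exact Finset.sum_congr rfl fun _ _ => by ring

/-- The error in the recursion for the constant weight `s` when the weights `t` are put into it. -/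
noncomputable def defect (θ : ℝ) (t : ℕ → ℂ) (s : ℂ) (n : ℕ) : ℂ :=
  cycleAvg θ (fun j => (t (n - j) - s) * ewensMean θ (fun _ => s) j) n

section Positive

variable {θ : ℝ} (hθ : 0 < θ)
include hθ

theorem ofReal_risingBinom_ne_zero (n : ℕ) : (risingBinom θ n : ℂ) ≠ 0 :=
  Complex.ofReal_ne_zero.2 (risingBinom_pos hθ n).ne'

theorem ofReal_add_natCast_ne_zero (n : ℕ) : (θ + n : ℂ) ≠ 0 := by
  exact_mod_cast (show θ + n ≠ 0 by positivity)

theorem cycleAvg_const (a : ℂ) {n : ℕ} (hn : n ≠ 0) : cycleAvg θ (fun _ => a) n = a := by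
  have hsum : (θ : ℂ) * ∑ j ∈ Finset.range n, (risingBinom θ j : ℂ) = n * risingBinom θ n := by
    exact_mod_cast congrArg Complex.ofReal (mul_sum_risingBinom θ n)
  have hp := ofReal_risingBinom_ne_zero hθ n
  have hn' : (n : ℂ) ≠ 0 := by exact_mod_cast hn
  rw [cycleAvg, ← Finset.sum_mul]
  push_cast
  rw [← mul_assoc, div_mul_eq_mul_div, hsum, div_self (mul_ne_zero hn' hp), one_mul]

theorem cycleAvg_succ (F : ℕ → ℂ) (n : ℕ) :
    cycleAvg θ F (n + 1) = θ / (θ + n) * F n + n / (θ + n) * cycleAvg θ F n := by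
  have hp := ofReal_risingBinom_ne_zero hθ n
  have hn := ofReal_add_natCast_ne_zero hθ n
  rw [cycleAvg, cycleAvg, succ_mul_risingBinom_succ, Finset.sum_range_succ]
  push_cast
  rcases n.eq_zero_or_pos with rfl | hn'
  · field_simp
    simp
  · have hn0 : (n : ℂ) ≠ 0 := by exact_mod_cast hn'.ne'
    field_simp
    ring

theorem norm_cycleAvg_le_sum {F : ℕ → ℂ} {h : ℕ → ℝ} {n : ℕ} (hF : ∀ j < n, ‖F j‖ ≤ h j) :
    ‖cycleAvg θ F n‖
      ≤ θ / (n * risingBinom θ n) * ∑ j ∈ Finset.range n, risingBinom θ j * h j := by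
  have hp := risingBinom_pos hθ n
  rw [norm_cycleAvg hθ]
  gcongr
  refine (norm_sum_le _ _).trans (Finset.sum_le_sum fun j hj => ?_)
  have hpj := risingBinom_pos hθ j
  rw [norm_mul, Complex.norm_real, Real.norm_of_nonneg hpj.le]
  exact mul_le_mul_of_nonneg_left (hF j (Finset.mem_range.1 hj)) hpj.le

theorem norm_cycleAvg_le_norm_cycleAvg {F : ℕ → ℂ} {h : ℕ → ℝ} {n : ℕ}
    (hF : ∀ j < n, ‖F j‖ ≤ h j) : ‖cycleAvg θ F n‖ ≤ ‖cycleAvg θ (fun j => (h j : ℂ)) n‖ := by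
  refine (norm_cycleAvg_le_sum hθ hF).trans ((le_abs_self _).trans_eq ?_)
  rw [← Real.norm_eq_abs, ← Complex.norm_real, cycleAvg]
  push_cast
  rfl

theorem ewensMean_eq_cycleAvg (t : ℕ → ℂ) {n : ℕ} (hn : n ≠ 0) :
    ewensMean θ t n = cycleAvg θ (fun j => t (n - j) * ewensMean θ t j) n := by
  have hp := ofReal_risingBinom_ne_zero hθ n
  have hn' : (n : ℂ) ≠ 0 := by exact_mod_cast hn
  rw [cycleAvg]
  push_cast
  rw [div_mul_eq_mul_div, ← ewensMean_rec hθ t n]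
  field_simp

theorem ewensMean_const_succ (s : ℂ) (n : ℕ) :
    ewensMean θ (fun _ => s) (n + 1)
      = ewensMean θ (fun _ => s) n * ((θ * s + n) / (θ + n)) := by
  have hn := ofReal_add_natCast_ne_zero hθ n
  rw [ewensMean_eq_cycleAvg hθ _ n.succ_ne_zero, cycleAvg_succ hθ]
  rcases eq_or_ne n 0 with rfl | hn0
  · simp
    ring
  · rw [← ewensMean_eq_cycleAvg hθ (fun _ => s) hn0]
    ring

theorem ewensMean_const (s : ℂ) (n : ℕ) :
    ewensMean θ (fun _ => s) n = ∏ j ∈ Finset.range n, (θ * s + j) / (θ + j) := by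
  induction n with
  | zero => simp [ewensMean_zero]
  | succ n ih => rw [ewensMean_const_succ hθ, ih, Finset.prod_range_succ]

theorem norm_mul_add_div_add_le_one {s : ℂ} (hs : ‖s‖ ≤ 1) (j : ℕ) :
    ‖(θ * s + j) / (θ + j)‖ ≤ 1 := by
  have hnorm : ‖(θ + j : ℂ)‖ = θ + j := by
    rw [← Complex.ofReal_natCast, ← Complex.ofReal_add, Complex.norm_real,
      Real.norm_of_nonneg (by positivity)]
  rw [norm_div, hnorm, div_le_one (by positivity)]
  refine (norm_add_le _ _).trans ?_
  rw [norm_mul, Complex.norm_real, Real.norm_of_nonneg hθ.le, Complex.norm_natCast]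
  gcongr
  exact mul_le_of_le_one_right hθ.le hs

theorem norm_ewensMean_const_le_one {s : ℂ} (hs : ‖s‖ ≤ 1) (n : ℕ) :
    ‖ewensMean θ (fun _ => s) n‖ ≤ 1 := by
  rw [ewensMean_const hθ, norm_prod]
  exact Finset.prod_le_one (fun _ _ => norm_nonneg _) fun j _ =>
    norm_mul_add_div_add_le_one hθ hs j

theorem isSlow_ewensMean_const {s : ℂ} (hs : ‖s‖ ≤ 1) : IsSlow θ (ewensMean θ fun _ => s) := by
  refine ⟨norm_ewensMean_const_le_one hθ hs, fun j => ?_⟩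
  have hp := risingBinom_pos hθ j
  have hn := ofReal_add_natCast_ne_zero hθ j
  have hsucc : (risingBinom θ (j + 1) : ℂ) = risingBinom θ j * ((θ + j) / (j + 1)) := by
    rw [risingBinom, Finset.prod_range_succ, ← risingBinom]
    push_cast
    rfl
  have hdiff : (risingBinom θ (j + 1) : ℂ) * ewensMean θ (fun _ => s) (j + 1)
      - risingBinom θ j * ewensMean θ (fun _ => s) j
      = ewensMean θ (fun _ => s) j * (θ * s - 1) * ((risingBinom θ j / (j + 1) : ℝ) : ℂ) := by
    have hj : (j + 1 : ℂ) ≠ 0 := by exact_mod_cast j.succ_ne_zero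
    rw [hsucc, ewensMean_const_succ hθ]
    push_cast
    field_simp
    ring
  have hfactor : ‖(θ * s - 1 : ℂ)‖ ≤ θ + 1 := by
    refine (norm_sub_le _ _).trans ?_
    rw [norm_mul, Complex.norm_real, Real.norm_of_nonneg hθ.le, norm_one]
    gcongr
    exact mul_le_of_le_one_right hθ.le hs
  rw [hdiff, norm_mul, norm_mul, Complex.norm_real, Real.norm_of_nonneg (by positivity),
    mul_div_assoc]
  gcongr
  exact (mul_le_of_le_one_left (norm_nonneg _) (norm_ewensMean_const_le_one hθ hs j)).trans hfactor

theorem isSlow_one : IsSlow θ fun _ => 1 := by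
  have hone : ewensMean θ (fun _ => 1) = fun _ => 1 := by
    funext n
    rw [ewensMean_const hθ]
    exact Finset.prod_eq_one fun j _ => by rw [mul_one, div_self (ofReal_add_natCast_ne_zero hθ j)]
  exact hone ▸ isSlow_ewensMean_const hθ (s := 1) (by simp)

theorem mul_sum_risingBinom_mul (ρ : ℕ → ℝ) (n : ℕ) :
    θ * ∑ j ∈ Finset.range n, risingBinom θ j *
        (ρ j + ∑ i ∈ Finset.range j, θ / (θ + i) * ρ i)
      = n * risingBinom θ n * ∑ i ∈ Finset.range n, θ / (θ + i) * ρ i := by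
  induction n with
  | zero => simp
  | succ n ih =>
    have hn : θ + n ≠ 0 := by positivity
    rw [Finset.sum_range_succ, mul_add, ih, succ_mul_risingBinom_succ, Finset.sum_range_succ]
    field_simp
    ring

theorem ewensMean_sub_ewensMean_const (t : ℕ → ℂ) (s : ℂ) {n : ℕ} (hn : n ≠ 0) :
    ewensMean θ t n - ewensMean θ (fun _ => s) n = defect θ t s n +
      cycleAvg θ (fun j => t (n - j) * (ewensMean θ t j - ewensMean θ (fun _ => s) j)) n := by
  rw [defect, ← cycleAvg_add, ewensMean_eq_cycleAvg hθ t hn, ewensMean_eq_cycleAvg hθ _ hn,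
    sub_eq_add_neg, neg_eq_neg_one_mul, ← cycleAvg_const_mul, ← cycleAvg_add]
  congr 1
  funext j
  ring

theorem norm_ewensMean_sub_le {t : ℕ → ℂ} (ht : ∀ m, ‖t m‖ ≤ 1) (s : ℂ) (n : ℕ) :
    ‖ewensMean θ t n - ewensMean θ (fun _ => s) n‖
      ≤ ‖defect θ t s n‖ + ∑ i ∈ Finset.range n, θ / (θ + i) * ‖defect θ t s i‖ := by
  induction n using Nat.strong_induction_on with
  | _ n ih =>
    rcases n.eq_zero_or_pos with rfl | hn
    · simp [ewensMean_zero]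
    have hp := risingBinom_pos hθ n
    rw [ewensMean_sub_ewensMean_const hθ t s hn.ne']
    refine (norm_add_le _ _).trans (add_le_add le_rfl ?_)
    refine (norm_cycleAvg_le_sum hθ (h := fun j => ‖defect θ t s j‖ +
      ∑ i ∈ Finset.range j, θ / (θ + i) * ‖defect θ t s i‖) fun j hj => ?_).trans_eq ?_
    · rw [norm_mul]
      exact (mul_le_of_le_one_left (norm_nonneg _) (ht _)).trans (ih j hj)
    · rw [div_mul_eq_mul_div, mul_sum_risingBinom_mul hθ]
      field_simp

end Positive

/-! ### Characteristic functions of additive statistics -/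

theorem norm_exp_sub_taylor_two_le {w : ℂ} (hw : w.re ≤ 0) :
    ‖Complex.exp w - (1 + w + w ^ 2 / 2)‖ ≤ 4 * ‖w‖ ^ 3 := by
  rcases le_total ‖w‖ 1 with h | h
  · have hsum : ∑ m ∈ Finset.range 3, w ^ m / (m.factorial : ℂ) = 1 + w + w ^ 2 / 2 := by
      simp [Finset.sum_range_succ, Nat.factorial]
    calc ‖Complex.exp w - (1 + w + w ^ 2 / 2)‖ ≤ ‖w‖ ^ 3 * Real.exp ‖w‖ :=
          hsum ▸ Complex.norm_exp_sub_sum_le_norm_mul_exp w 3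
      _ ≤ ‖w‖ ^ 3 * Real.exp 1 := by gcongr
      _ ≤ ‖w‖ ^ 3 * 4 := by gcongr; linarith [Real.exp_one_lt_d9]
      _ = _ := mul_comm _ _
  · have hexp : ‖Complex.exp w‖ ≤ 1 := by rwa [Complex.norm_exp, Real.exp_le_one_iff]
    have hpoly : ‖1 + w + w ^ 2 / 2‖ ≤ 1 + ‖w‖ + ‖w‖ ^ 2 / 2 :=
      norm_add₃_le.trans_eq (by simp)
    have hlinear : ‖w‖ ≤ ‖w‖ ^ 3 := le_self_pow₀ h three_ne_zero
    have hquadratic : ‖w‖ ^ 2 ≤ ‖w‖ ^ 3 := pow_le_pow_right₀ h (by norm_num)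
    linarith [norm_sub_le (Complex.exp w) (1 + w + w ^ 2 / 2)]

/-- The constant cycle weight that agrees to second order in `α` with the mean of `exp (i α c)`
when `c` has mean `μ` and second moment `ν`. The exponential form keeps it in the unit disc. -/
noncomputable def flatWeight (μ ν α : ℝ) : ℂ :=
  Complex.exp ((α * μ : ℝ) * Complex.I - (α ^ 2 * (ν - μ ^ 2) / 2 : ℝ))

/-- The cycle weight `exp (i α c_m)`. -/
noncomputable def phaseWeight (c : ℕ → ℝ) (α : ℝ) (m : ℕ) : ℂ :=
  Complex.exp ((α * c m : ℝ) * Complex.I)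

section FlatWeight

variable {μ ν : ℝ} (h : μ ^ 2 ≤ ν)
include h

theorem norm_flatWeight_le_one (α : ℝ) : ‖flatWeight μ ν α‖ ≤ 1 := by
  have hnonneg : 0 ≤ α ^ 2 * (ν - μ ^ 2) / 2 := by
    have := sub_nonneg.2 h
    positivity
  rw [flatWeight, Complex.norm_exp, Real.exp_le_one_iff, Complex.sub_re, Complex.re_ofReal_mul,
    Complex.I_re, Complex.ofReal_re]
  linarith

theorem exists_norm_flatWeight_sub_le : ∃ K : ℝ, 0 ≤ K ∧ ∀ α : ℝ, |α| ≤ 1 →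
    ‖flatWeight μ ν α - (1 + (α * μ : ℝ) * Complex.I - (α ^ 2 * ν / 2 : ℝ))‖ ≤ K * |α| ^ 3 := by
  obtain ⟨v, rfl⟩ : ∃ v, ν = v + μ ^ 2 := ⟨ν - μ ^ 2, by ring⟩
  have hv : 0 ≤ v := by linarith
  refine ⟨4 * (|μ| + v) ^ 3 + (v ^ 2 + |μ| * v), by positivity, fun α hα => ?_⟩
  set w : ℂ := (α * μ : ℝ) * Complex.I - (α ^ 2 * v / 2 : ℝ) with hw
  have hflat : flatWeight μ (v + μ ^ 2) α = Complex.exp w := by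
    rw [flatWeight, add_sub_cancel_right]
  have hre : w.re ≤ 0 := by
    simp only [hw, Complex.sub_re, Complex.re_ofReal_mul, Complex.I_re, Complex.ofReal_re]
    linarith [show 0 ≤ α ^ 2 * v / 2 by positivity]
  have hnorm : ‖w‖ ≤ |α| * (|μ| + v) := by
    have hsq : |α| ^ 2 * v ≤ |α| * v := by
      gcongr
      exact pow_le_of_le_one (abs_nonneg _) hα two_ne_zero
    refine (norm_sub_le _ _).trans ?_
    rw [norm_mul, Complex.norm_I, mul_one, Complex.norm_real, Complex.norm_real, Real.norm_eq_abs,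
      Real.norm_eq_abs, abs_div, abs_mul, abs_mul, abs_pow, abs_two, abs_of_nonneg hv]
    linarith [mul_nonneg (abs_nonneg α) hv]
  have hquad : (1 + w + w ^ 2 / 2) - (1 + (α * μ : ℝ) * Complex.I
      - (α ^ 2 * (v + μ ^ 2) / 2 : ℝ))
      = ((α ^ 4 * v ^ 2 / 8 : ℝ) : ℂ) - ((α ^ 3 * μ * v / 2 : ℝ) : ℂ) * Complex.I := by
    rw [hw]
    push_cast
    linear_combination ((α : ℂ) * μ) ^ 2 / 2 * Complex.I_sq
  have hquad_norm : ‖((α ^ 4 * v ^ 2 / 8 : ℝ) : ℂ) - ((α ^ 3 * μ * v / 2 : ℝ) : ℂ) * Complex.I‖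
      ≤ (v ^ 2 + |μ| * v) * |α| ^ 3 := by
    have hfour : |α| ^ 4 * v ^ 2 ≤ |α| ^ 3 * v ^ 2 := by
      gcongr ?_ * _
      exact pow_le_pow_of_le_one (abs_nonneg _) hα (by norm_num)
    refine (norm_sub_le _ _).trans ?_
    rw [norm_mul, Complex.norm_I, mul_one, Complex.norm_real, Complex.norm_real, Real.norm_eq_abs,
      Real.norm_eq_abs, abs_div, abs_div, abs_mul, abs_mul, abs_mul, abs_pow, abs_pow, abs_pow,
      abs_two, abs_of_nonneg hv, abs_of_pos (by norm_num : (0 : ℝ) < 8)]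
    linarith [show 0 ≤ |α| ^ 3 * v ^ 2 by positivity, show 0 ≤ |α| ^ 3 * |μ| * v by positivity]
  calc _ ≤ ‖Complex.exp w - (1 + w + w ^ 2 / 2)‖ + (v ^ 2 + |μ| * v) * |α| ^ 3 := by
        rw [hflat, ← sub_add_sub_cancel _ (1 + w + w ^ 2 / 2), hquad]
        exact (norm_add_le _ _).trans (by gcongr)
    _ ≤ 4 * (|α| * (|μ| + v)) ^ 3 + (v ^ 2 + |μ| * v) * |α| ^ 3 := by
        gcongr
        exact (norm_exp_sub_taylor_two_le hre).trans (by gcongr)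
    _ = _ := by ring

theorem exists_norm_exp_sub_flatWeight_sub_le : ∃ K : ℝ, 0 ≤ K ∧ ∀ α : ℝ, |α| ≤ 1 → ∀ x : ℝ,
    ‖Complex.exp ((α * x : ℝ) * Complex.I) - flatWeight μ ν α
        - ((α * (x - μ) : ℝ) * Complex.I - (α ^ 2 / 2 * (x ^ 2 - ν) : ℝ))‖
      ≤ K * |α| ^ 3 * (x ^ 4 + 1) := by
  obtain ⟨K, hK0, hK⟩ := exists_norm_flatWeight_sub_le h
  refine ⟨4 + K, by positivity, fun α hα x => ?_⟩
  have hcube : |x| ^ 3 ≤ x ^ 4 + 1 := by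
    rw [← Even.pow_abs (by decide : Even 4)]
    nlinarith [sq_nonneg (|x| ^ 2 - |x|), sq_nonneg (|x| - 1), sq_nonneg (|x| ^ 2 - 1)]
  have hexp : ‖Complex.exp ((α * x : ℝ) * Complex.I)
      - (1 + (α * x : ℝ) * Complex.I - (α ^ 2 * x ^ 2 / 2 : ℝ))‖ ≤ 4 * (|α| ^ 3 * |x| ^ 3) := by
    have htaylor := norm_exp_sub_taylor_two_le (w := (α * x : ℝ) * Complex.I) (by simp)
    rw [norm_mul, Complex.norm_I, mul_one, Complex.norm_real, Real.norm_eq_abs, abs_mul,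
      mul_pow |α|] at htaylor
    convert htaylor using 3
    rw [mul_pow, Complex.I_sq]
    push_cast
    ring
  calc _ = ‖(Complex.exp ((α * x : ℝ) * Complex.I)
        - (1 + (α * x : ℝ) * Complex.I - (α ^ 2 * x ^ 2 / 2 : ℝ)))
        - (flatWeight μ ν α - (1 + (α * μ : ℝ) * Complex.I - (α ^ 2 * ν / 2 : ℝ)))‖ := by
        congr 1
        push_cast
        ring
    _ ≤ 4 * (|α| ^ 3 * (x ^ 4 + 1)) + K * |α| ^ 3 * (x ^ 4 + 1) := by
        refine (norm_sub_le _ _).trans (add_le_add (hexp.trans (by gcongr)) ((hK α hα).trans ?_))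
        exact le_mul_of_one_le_right (by positivity) (by linarith [show 0 ≤ x ^ 4 by positivity])
    _ = _ := by ring

end FlatWeight

/-- The hypotheses on cycle statistics `c` under which `∑ c_m C_m` satisfies a central limit
theorem: mean `μ`, second moment `ν`, some fourth moment, all with a power saving, and growth
slower than every power. -/
structure HasCycleMoments (c : ℕ → ℝ) (μ ν : ℝ) : Prop where
  mean : HasPowerMean c μ
  mean_sq : HasPowerMean (fun m => c m ^ 2) ν
  exists_mean_pow_four : ∃ κ, HasPowerMean (fun m => c m ^ 4) κ
  isSubpoly : IsSubpoly c

theorem HasCycleMoments.sq_le {c : ℕ → ℝ} {μ ν : ℝ} (h : HasCycleMoments c μ ν) : μ ^ 2 ≤ ν :=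
  h.mean.sq_le h.mean_sq

theorem defect_eq_add {θ : ℝ} {t f g e : ℕ → ℂ} {s a b : ℂ}
    (h : ∀ m, t m - s = a * f m + (b * g m + e m)) (n : ℕ) :
    defect θ t s n = a * cycleAvg θ (fun j => f (n - j) * ewensMean θ (fun _ => s) j) n
      + (b * cycleAvg θ (fun j => g (n - j) * ewensMean θ (fun _ => s) j) n
      + cycleAvg θ (fun j => e (n - j) * ewensMean θ (fun _ => s) j) n) := by
  simp only [defect, ← cycleAvg_const_mul, ← cycleAvg_add, h]
  congr 1
  funext j
  ring

section Positive

variable {θ : ℝ} (hθ : 0 < θ)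
include hθ

theorem exists_norm_cycleAvg_le_of_norm_le {d : ℕ → ℝ} {κ : ℝ} (hd : HasPowerMean d κ)
    (hs : IsSubpoly d) :
    ∃ C : ℝ, 0 ≤ C ∧ ∀ A : ℝ, 0 ≤ A → ∀ n : ℕ, 1 ≤ n → ∀ F : ℕ → ℂ,
      (∀ j < n, ‖F j‖ ≤ A * d (n - j)) → ‖cycleAvg θ F n‖ ≤ A * C := by
  obtain ⟨δ, C, hδ, hC, hbound⟩ := exists_norm_cycleAvg_le hθ hd.sub_self (hs.sub_const κ)
  refine ⟨|κ| + C, by positivity, fun A hA n hn F hF => ?_⟩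
  have hdecay : C * (n : ℝ) ^ (-δ) ≤ C :=
    mul_le_of_le_one_right hC
      (Real.rpow_le_one_of_one_le_of_nonpos (by exact_mod_cast hn) (by linarith))
  have hsplit : cycleAvg θ (fun j => ((A * d (n - j) : ℝ) : ℂ)) n
      = A * (κ + cycleAvg θ (fun j => ((d (n - j) - κ : ℝ) : ℂ) * 1) n) := by
    rw [← cycleAvg_const hθ (κ : ℂ) (by omega : n ≠ 0), ← cycleAvg_add, ← cycleAvg_const_mul]
    congr 1
    funext j
    push_cast
    ring
  calc ‖cycleAvg θ F n‖ ≤ A * ‖κ + cycleAvg θ (fun j => ((d (n - j) - κ : ℝ) : ℂ) * 1) n‖ := by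
        refine (norm_cycleAvg_le_norm_cycleAvg hθ hF).trans_eq ?_
        rw [hsplit, norm_mul, Complex.norm_real, Real.norm_of_nonneg hA]
    _ ≤ A * (|κ| + C) := by
        gcongr
        refine (norm_add_le _ _).trans (add_le_add ?_ ?_)
        · rw [Complex.norm_real, Real.norm_eq_abs]
        · exact (hbound _ (isSlow_one hθ) n hn).trans hdecay

theorem exists_norm_defect_le {c : ℕ → ℝ} {μ ν : ℝ} (hc : HasCycleMoments c μ ν) :
    ∃ C δ : ℝ, 0 ≤ C ∧ 0 < δ ∧ ∀ α : ℝ, |α| ≤ 1 → ∀ n : ℕ, 1 ≤ n →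
      ‖defect θ (phaseWeight c α) (flatWeight μ ν α) n‖
        ≤ C * (|α| * (n : ℝ) ^ (-δ) + |α| ^ 3) := by
  obtain ⟨κ, hκ⟩ := hc.exists_mean_pow_four
  obtain ⟨δ₁, C₁, hδ₁, hC₁, hmean⟩ := exists_norm_cycleAvg_le hθ hc.mean.sub_self
    (hc.isSubpoly.sub_const μ)
  obtain ⟨δ₂, C₂, hδ₂, hC₂, hmean_sq⟩ := exists_norm_cycleAvg_le hθ hc.mean_sq.sub_self
    ((hc.isSubpoly.pow two_ne_zero).sub_const ν)
  obtain ⟨C₄, hC₄, hmean_four⟩ := exists_norm_cycleAvg_le_of_norm_le hθ (hκ.sub_const (-1))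
    ((hc.isSubpoly.pow four_ne_zero).sub_const (-1))
  obtain ⟨K, hK0, hK⟩ := exists_norm_exp_sub_flatWeight_sub_le hc.sq_le
  refine ⟨C₁ + C₂ + K * C₄, min δ₁ δ₂, by positivity, by positivity, fun α hα n hn => ?_⟩
  have hn1 : (1 : ℝ) ≤ n := by exact_mod_cast hn
  have hslow := isSlow_ewensMean_const hθ (norm_flatWeight_le_one hc.sq_le α)
  have hsq : |α| ^ 2 / 2 ≤ |α| := by
    linarith [pow_le_of_le_one (abs_nonneg α) hα two_ne_zero, abs_nonneg α]
  have hdecay : 0 ≤ |α| * (n : ℝ) ^ (-min δ₁ δ₂) := by positivity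
  have hcube : 0 ≤ |α| ^ 3 := by positivity
  rw [defect_eq_add (a := α * Complex.I) (b := (-(α ^ 2 / 2) : ℝ))
    (f := fun m => (c m - μ : ℝ)) (g := fun m => (c m ^ 2 - ν : ℝ))
    (e := fun m => phaseWeight c α m - flatWeight μ ν α
      - ((α * (c m - μ) : ℝ) * Complex.I - (α ^ 2 / 2 * (c m ^ 2 - ν) : ℝ)))
    fun m => by push_cast; ring]
  calc _ ≤ |α| * (C₁ * (n : ℝ) ^ (-min δ₁ δ₂))
        + (|α| * (C₂ * (n : ℝ) ^ (-min δ₁ δ₂)) + K * |α| ^ 3 * C₄) := by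
        refine (norm_add_le _ _).trans (add_le_add ?_ ((norm_add_le _ _).trans (add_le_add ?_ ?_)))
        · rw [norm_mul, norm_mul, Complex.norm_I, mul_one, Complex.norm_real, Real.norm_eq_abs]
          gcongr
          exact (hmean _ hslow n hn).trans (by gcongr; exact min_le_left _ _)
        · rw [norm_mul, Complex.norm_real, Real.norm_eq_abs, abs_neg, abs_div, abs_pow, abs_two]
          gcongr
          exact (hmean_sq _ hslow n hn).trans (by gcongr; exact min_le_right _ _)
        · refine hmean_four _ (by positivity) n hn _ fun j _ => ?_
          rw [norm_mul, sub_neg_eq_add]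
          exact (mul_le_of_le_one_right (norm_nonneg _) (hslow.norm_le_one j)).trans (hK α hα _)
    _ ≤ _ := by
        nlinarith [mul_nonneg (mul_nonneg hK0 hC₄) hdecay, mul_nonneg hC₁ hcube,
          mul_nonneg hC₂ hcube]

/-- The expected number of cycles of a permutation with the Ewens law. -/
noncomputable def meanCycles (θ : ℝ) (n : ℕ) : ℝ :=
  ∑ j ∈ Finset.range n, θ / (θ + j)

theorem meanCycles_nonneg (n : ℕ) : 0 ≤ meanCycles θ n :=
  Finset.sum_nonneg fun _ _ => by positivity

theorem exists_sum_norm_defect_le {c : ℕ → ℝ} {μ ν : ℝ} (hc : HasCycleMoments c μ ν) :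
    ∃ C : ℝ, 0 ≤ C ∧ ∀ α : ℝ, |α| ≤ 1 → ∀ n : ℕ,
      ∑ j ∈ Finset.range n, θ / (θ + j) * ‖defect θ (phaseWeight c α) (flatWeight μ ν α) j‖
        ≤ C * (|α| + |α| ^ 3 * meanCycles θ n) := by
  obtain ⟨C, δ, hC, hδ, hdefect⟩ := exists_norm_defect_le hθ hc
  have hsummable : Summable fun j : ℕ => (j : ℝ) ^ (-δ - 1) :=
    Real.summable_nat_rpow.2 (by linarith)
  set S := ∑' j : ℕ, (j : ℝ) ^ (-δ - 1)
  have hS : 0 ≤ θ * S := mul_nonneg hθ.le (tsum_nonneg fun _ => by positivity)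
  refine ⟨C * (1 + θ * S), mul_nonneg hC (by linarith), fun α hα n => ?_⟩
  have hterm (j : ℕ) : θ / (θ + j) * ‖defect θ (phaseWeight c α) (flatWeight μ ν α) j‖
      ≤ C * (θ * |α| * (j : ℝ) ^ (-δ - 1) + |α| ^ 3 * (θ / (θ + j))) := by
    rcases Nat.eq_zero_or_pos j with rfl | hj
    · simp only [defect, cycleAvg, Finset.range_zero, Finset.sum_empty, mul_zero, norm_zero]
      positivity
    have hj0 : (0 : ℝ) < j := by exact_mod_cast hj
    calc _ ≤ θ / (θ + j) * (C * (|α| * (j : ℝ) ^ (-δ) + |α| ^ 3)) := by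
          gcongr
          exact hdefect α hα j hj
      _ = C * (θ / (θ + j) * (|α| * (j : ℝ) ^ (-δ)) + |α| ^ 3 * (θ / (θ + j))) := by ring
      _ ≤ C * (θ / j * (|α| * (j : ℝ) ^ (-δ)) + |α| ^ 3 * (θ / (θ + j))) := by
          gcongr
          linarith
      _ = _ := by rw [Real.rpow_sub_one hj0.ne']; ring
  have hcube : 0 ≤ |α| ^ 3 * meanCycles θ n := mul_nonneg (by positivity) (meanCycles_nonneg hθ n)
  calc _ ≤ C * (θ * |α| * S + |α| ^ 3 * meanCycles θ n) := by
        refine (Finset.sum_le_sum fun j _ => hterm j).trans ?_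
        rw [← Finset.mul_sum, Finset.sum_add_distrib, ← Finset.mul_sum, ← Finset.mul_sum,
          meanCycles]
        gcongr
        exact hsummable.sum_le_tsum (Finset.range n) fun _ _ => by positivity
    _ ≤ C * (1 + θ * S) * (|α| + |α| ^ 3 * meanCycles θ n) := by
        rw [mul_assoc C, mul_assoc θ]
        refine mul_le_mul_of_nonneg_left ?_ hC
        linarith [mul_nonneg hS hcube, abs_nonneg α]

theorem exists_norm_ewensMean_sub_le {c : ℕ → ℝ} {μ ν : ℝ} (hc : HasCycleMoments c μ ν) :
    ∃ C : ℝ, ∀ α : ℝ, |α| ≤ 1 → ∀ n : ℕ, 1 ≤ n →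
      ‖ewensMean θ (phaseWeight c α) n - ewensMean θ (fun _ => flatWeight μ ν α) n‖
        ≤ C * (|α| + |α| ^ 3 * (1 + meanCycles θ n)) := by
  obtain ⟨C₁, δ, hC₁, hδ, hdefect⟩ := exists_norm_defect_le hθ hc
  obtain ⟨C₂, hC₂, hsum⟩ := exists_sum_norm_defect_le hθ hc
  refine ⟨C₁ + C₂, fun α hα n hn => ?_⟩
  have hlast : ‖defect θ (phaseWeight c α) (flatWeight μ ν α) n‖ ≤ C₁ * (|α| + |α| ^ 3) := by
    refine (hdefect α hα n hn).trans ?_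
    gcongr
    exact mul_le_of_le_one_right (abs_nonneg _)
      (Real.rpow_le_one_of_one_le_of_nonpos (by exact_mod_cast hn) (by linarith))
  have hcycles := meanCycles_nonneg hθ n
  calc _ ≤ C₁ * (|α| + |α| ^ 3) + C₂ * (|α| + |α| ^ 3 * meanCycles θ n) :=
        (norm_ewensMean_sub_le hθ (fun m => by rw [phaseWeight, Complex.norm_exp_ofReal_mul_I])
          _ n).trans (add_le_add hlast (hsum α hα n))
    _ ≤ C₁ * (|α| + |α| ^ 3 * (1 + meanCycles θ n))
        + C₂ * (|α| + |α| ^ 3 * (1 + meanCycles θ n)) := by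
        gcongr
        · exact le_mul_of_one_le_right (by positivity) (by linarith)
        · linarith
    _ = _ := by ring

theorem exists_sum_div_add_sq_le :
    ∃ S : ℝ, ∀ n : ℕ, ∑ j ∈ Finset.range n, (θ / (θ + j)) ^ 2 ≤ S := by
  have hsummable : Summable fun j : ℕ => (θ / (θ + j)) ^ 2 := by
    rw [← summable_nat_add_iff 1]
    refine ((Real.summable_nat_pow_inv.2 one_lt_two).comp_injective
      (add_left_injective 1)).mul_left (θ ^ 2) |>.of_nonneg_of_le (fun j => by positivity)
      fun j => ?_
    rw [div_pow, div_eq_mul_inv, Function.comp_apply]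
    gcongr
    linarith
  exact ⟨_, fun n => hsummable.sum_le_tsum _ fun _ _ => by positivity⟩

theorem exists_abs_meanCycles_sub_le :
    ∃ C : ℝ, ∀ n : ℕ, 1 ≤ n → |meanCycles θ n - θ * Real.log n| ≤ C := by
  obtain ⟨S, hS⟩ := exists_sum_div_add_sq_le hθ
  refine ⟨|1 - θ| * (1 + θ) / θ * S + θ, fun n hn => ?_⟩
  have hterm (j : ℕ) : |θ / (θ + j) - θ * ((j : ℝ) + 1)⁻¹|
      ≤ |1 - θ| * (1 + θ) / θ * (θ / (θ + j)) ^ 2 := by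
    have hcompare : ((j : ℝ) + 1)⁻¹ ≤ (1 + θ) / (θ + j) := by
      rw [inv_eq_one_div, div_le_div_iff₀ (by positivity) (by positivity)]
      nlinarith [(Nat.cast_nonneg j : (0 : ℝ) ≤ j)]
    calc _ = θ / (θ + j) * (|1 - θ| * ((j : ℝ) + 1)⁻¹) := by
          rw [← abs_of_pos (by positivity : 0 < θ / (θ + j)),
            ← abs_of_pos (by positivity : 0 < ((j : ℝ) + 1)⁻¹), ← abs_mul, ← abs_mul,
            abs_of_pos (by positivity : 0 < θ / (θ + j)),
            abs_of_pos (by positivity : 0 < ((j : ℝ) + 1)⁻¹)]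
          congr 1
          field_simp
          ring
      _ ≤ θ / (θ + j) * (|1 - θ| * ((1 + θ) / (θ + j))) := by gcongr
      _ = _ := by field_simp
  have hharmonic : |meanCycles θ n - θ * (harmonic n : ℝ)| ≤ |1 - θ| * (1 + θ) / θ * S := by
    rw [meanCycles, harmonic]
    push_cast
    rw [Finset.mul_sum, ← Finset.sum_sub_distrib]
    refine ((Finset.abs_sum_le_sum_abs _ _).trans (Finset.sum_le_sum fun j _ => hterm j)).trans ?_
    rw [← Finset.mul_sum]
    gcongr
    exact hS n
  have hlog : |(harmonic n : ℝ) - Real.log n| ≤ 1 := by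
    have hmono : Real.log n ≤ Real.log ((n + 1 : ℕ) : ℝ) :=
      Real.log_le_log (by exact_mod_cast hn) (by push_cast; linarith)
    rw [abs_le]
    constructor <;> linarith [harmonic_le_one_add_log n, log_add_one_le_harmonic n]
  calc |meanCycles θ n - θ * Real.log n|
      = |(meanCycles θ n - θ * (harmonic n : ℝ)) + θ * ((harmonic n : ℝ) - Real.log n)| := by
        congr 1
        ring
    _ ≤ |1 - θ| * (1 + θ) / θ * S + θ := by
        refine (abs_add_le _ _).trans (add_le_add hharmonic ?_)
        rw [abs_mul, abs_of_pos hθ]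
        exact mul_le_of_le_one_right hθ.le hlog

theorem tendsto_meanCycles_div_log :
    Tendsto (fun n : ℕ => meanCycles θ n / Real.log n) atTop (𝓝 θ) := by
  obtain ⟨C, hC⟩ := exists_abs_meanCycles_sub_le hθ
  have hlog : Tendsto (fun n : ℕ => Real.log n) atTop atTop :=
    Real.tendsto_log_atTop.comp tendsto_natCast_atTop_atTop
  rw [tendsto_iff_norm_sub_tendsto_zero]
  refine squeeze_zero' (Eventually.of_forall fun _ => norm_nonneg _) ?_ (hlog.const_div_atTop C)
  filter_upwards [eventually_ge_atTop 1, hlog.eventually_gt_atTop 0] with n hn hpos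
  rw [div_sub' hpos.ne', norm_div, Real.norm_eq_abs, Real.norm_of_nonneg hpos.le,
    mul_comm (Real.log n)]
  gcongr
  exact hC n hn

end Positive

theorem norm_prod_sub_prod_le_sum {ι R : Type*} [NormedCommRing R] [NormOneClass R] {a b : ι → R}
    (ha : ∀ j, ‖a j‖ ≤ 1) (hb : ∀ j, ‖b j‖ ≤ 1) (s : Finset ι) :
    ‖∏ j ∈ s, a j - ∏ j ∈ s, b j‖ ≤ ∑ j ∈ s, ‖a j - b j‖ := by
  induction s using Finset.cons_induction with
  | empty => simp
  | cons i s hi ih =>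
    have hprod : ‖∏ j ∈ s, b j‖ ≤ 1 :=
      (s.norm_prod_le b).trans (Finset.prod_le_one (fun _ _ => norm_nonneg _) fun j _ => hb j)
    rw [Finset.prod_cons, Finset.prod_cons, Finset.sum_cons,
      show a i * ∏ j ∈ s, a j - b i * ∏ j ∈ s, b j
        = (a i - b i) * ∏ j ∈ s, b j + a i * (∏ j ∈ s, a j - ∏ j ∈ s, b j) by ring]
    refine (norm_add_le _ _).trans (add_le_add ?_ ?_)
    · exact (norm_mul_le _ _).trans (mul_le_of_le_one_right (norm_nonneg _) hprod)
    · exact (norm_mul_le _ _).trans ((mul_le_of_le_one_left (norm_nonneg _) (ha i)).trans ih)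

theorem exists_norm_ewensMean_const_sub_exp_le {θ : ℝ} (hθ : 0 < θ) :
    ∃ C : ℝ, ∀ s : ℂ, ‖s‖ ≤ 1 → ‖s - 1‖ ≤ 1 → ∀ n : ℕ,
      ‖ewensMean θ (fun _ => s) n - Complex.exp ((s - 1) * meanCycles θ n)‖
        ≤ C * ‖s - 1‖ ^ 2 := by
  obtain ⟨S, hS⟩ := exists_sum_div_add_sq_le hθ
  refine ⟨S, fun s hs hs1 n => ?_⟩
  set w : ℕ → ℂ := fun j => (s - 1) * (θ / (θ + j) : ℝ) with hw
  have hfactor (j : ℕ) : (θ * s + j) / (θ + j) = 1 + w j := by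
    have := ofReal_add_natCast_ne_zero hθ j
    simp only [hw, Complex.ofReal_div, Complex.ofReal_add, Complex.ofReal_natCast]
    field_simp
    ring
  have hexp : Complex.exp ((s - 1) * meanCycles θ n)
      = ∏ j ∈ Finset.range n, Complex.exp (w j) := by
    rw [← Complex.exp_sum, ← Finset.mul_sum, meanCycles, Complex.ofReal_sum]
  have hexp_le (j : ℕ) : ‖Complex.exp (w j)‖ ≤ 1 := by
    have hre : (s - 1).re ≤ 0 := by
      rw [Complex.sub_re, Complex.one_re]
      linarith [Complex.re_le_norm s]
    rw [Complex.norm_exp, Real.exp_le_one_iff, hw, Complex.re_mul_ofReal]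
    exact mul_nonpos_of_nonpos_of_nonneg hre (by positivity)
  have hnorm (j : ℕ) : ‖w j‖ = ‖s - 1‖ * (θ / (θ + j)) := by
    rw [norm_mul, Complex.norm_real, Real.norm_of_nonneg (by positivity)]
  have hterm (j : ℕ) : ‖(θ * s + j) / (θ + j) - Complex.exp (w j)‖
      ≤ ‖s - 1‖ ^ 2 * (θ / (θ + j)) ^ 2 := by
    have hsmall : ‖w j‖ ≤ 1 := by
      rw [hnorm]
      exact mul_le_one₀ hs1 (by positivity)
        ((div_le_one (by positivity)).2 (by linarith [(Nat.cast_nonneg j : (0 : ℝ) ≤ j)]))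
    rw [hfactor, norm_sub_rev, ← sub_sub, ← mul_pow, ← hnorm]
    exact Complex.norm_exp_sub_one_sub_id_le hsmall
  rw [hexp, ewensMean_const hθ]
  calc _ ≤ ∑ j ∈ Finset.range n, ‖(θ * s + j) / (θ + j) - Complex.exp (w j)‖ :=
        norm_prod_sub_prod_le_sum (norm_mul_add_div_add_le_one hθ hs) hexp_le _
    _ ≤ ∑ j ∈ Finset.range n, ‖s - 1‖ ^ 2 * (θ / (θ + j)) ^ 2 :=
        Finset.sum_le_sum fun j _ => hterm j
    _ ≤ S * ‖s - 1‖ ^ 2 := by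
        rw [← Finset.mul_sum, mul_comm]
        gcongr
        exact hS n

section Limit

variable {θ : ℝ} (hθ : 0 < θ) (u : ℝ)

theorem tendsto_log_natCast_atTop : Tendsto (fun n : ℕ => Real.log n) atTop atTop :=
  Real.tendsto_log_atTop.comp tendsto_natCast_atTop_atTop

theorem tendsto_div_sqrt_log : Tendsto (fun n : ℕ => u / √(Real.log n)) atTop (𝓝 0) :=
  (Real.tendsto_sqrt_atTop.comp tendsto_log_natCast_atTop).const_div_atTop u

theorem tendsto_abs_div_sqrt_log : Tendsto (fun n : ℕ => |u / √(Real.log n)|) atTop (𝓝 0) := by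
  simpa using (tendsto_div_sqrt_log u).abs

theorem eventually_abs_div_sqrt_log_le_one : ∀ᶠ n : ℕ in atTop, |u / √(Real.log n)| ≤ 1 :=
  ((tendsto_abs_div_sqrt_log u).eventually_lt_const zero_lt_one).mono fun _ h => h.le

theorem tendsto_flatWeight_div_sqrt_log (μ ν : ℝ) :
    Tendsto (fun n : ℕ => flatWeight μ ν (u / √(Real.log n))) atTop (𝓝 1) := by
  have hcont : Continuous (flatWeight μ ν) := by
    unfold flatWeight
    fun_prop
  have hzero : flatWeight μ ν 0 = 1 := by simp [flatWeight]
  exact hzero ▸ (hcont.tendsto 0).comp (tendsto_div_sqrt_log u)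

include hθ

theorem tendsto_sq_mul_meanCycles :
    Tendsto (fun n : ℕ => (u / √(Real.log n)) ^ 2 * meanCycles θ n) atTop (𝓝 (u ^ 2 * θ)) := by
  refine ((tendsto_meanCycles_div_log hθ).const_mul (u ^ 2)).congr' ?_
  filter_upwards [tendsto_log_natCast_atTop.eventually_gt_atTop 0] with n hpos
  rw [div_pow, Real.sq_sqrt hpos.le]
  ring

theorem tendsto_abs_pow_three_mul_meanCycles :
    Tendsto (fun n : ℕ => |u / √(Real.log n)| ^ 3 * meanCycles θ n) atTop (𝓝 0) := by
  have hmul := (tendsto_abs_div_sqrt_log u).mul (tendsto_sq_mul_meanCycles hθ u)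
  rw [zero_mul] at hmul
  refine hmul.congr fun n => ?_
  rw [← sq_abs (u / √(Real.log n))]
  ring

theorem tendsto_ewensMean_phaseWeight_sub {c : ℕ → ℝ} {μ ν : ℝ} (hc : HasCycleMoments c μ ν) :
    Tendsto (fun n : ℕ => ewensMean θ (phaseWeight c (u / √(Real.log n))) n
      - ewensMean θ (fun _ => flatWeight μ ν (u / √(Real.log n))) n) atTop (𝓝 0) := by
  obtain ⟨C, hC⟩ := exists_norm_ewensMean_sub_le hθ hc
  have hsmall := tendsto_abs_div_sqrt_log u
  have hlim := (hsmall.add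
    ((hsmall.pow 3).add (tendsto_abs_pow_three_mul_meanCycles hθ u))).const_mul C
  simp only [ne_eq, OfNat.ofNat_ne_zero, not_false_eq_true, zero_pow, add_zero, mul_zero] at hlim
  refine squeeze_zero_norm' ?_ hlim
  filter_upwards [eventually_abs_div_sqrt_log_le_one u, eventually_ge_atTop 1] with n hα hn
  rw [← mul_one_add]
  exact hC _ hα n hn

theorem tendsto_ewensMean_flatWeight_sub_exp {μ ν : ℝ} (h : μ ^ 2 ≤ ν) :
    Tendsto (fun n : ℕ => ewensMean θ (fun _ => flatWeight μ ν (u / √(Real.log n))) n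
      - Complex.exp ((flatWeight μ ν (u / √(Real.log n)) - 1) * meanCycles θ n))
      atTop (𝓝 0) := by
  obtain ⟨D, hD⟩ := exists_norm_ewensMean_const_sub_exp_le hθ
  have hone := tendsto_iff_norm_sub_tendsto_zero.1 (tendsto_flatWeight_div_sqrt_log u μ ν)
  refine squeeze_zero_norm' ?_ (by simpa using (hone.pow 2).const_mul D)
  filter_upwards [hone.eventually_lt_const zero_lt_one] with n hn
  exact hD _ (norm_flatWeight_le_one h _) hn.le n

theorem tendsto_flatWeight_exponent {μ ν : ℝ} (h : μ ^ 2 ≤ ν) :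
    Tendsto (fun n : ℕ => ((-(u * θ * μ * √(Real.log n)) : ℝ) : ℂ) * Complex.I
      + (flatWeight μ ν (u / √(Real.log n)) - 1) * meanCycles θ n) atTop
      (𝓝 ((-(θ * ν * u ^ 2 / 2) : ℝ) : ℂ)) := by
  obtain ⟨K, -, hK⟩ := exists_norm_flatWeight_sub_le h
  obtain ⟨B, hB⟩ := exists_abs_meanCycles_sub_le hθ
  set α : ℕ → ℝ := fun n => u / √(Real.log n) with hα
  have htaylor : Tendsto (fun n => (flatWeight μ ν (α n)
      - (1 + (α n * μ : ℝ) * Complex.I - (α n ^ 2 * ν / 2 : ℝ))) * meanCycles θ n)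
      atTop (𝓝 0) := by
    refine squeeze_zero_norm' ?_
      (by simpa using (tendsto_abs_pow_three_mul_meanCycles hθ u).const_mul K)
    filter_upwards [eventually_abs_div_sqrt_log_le_one u] with n hn
    rw [norm_mul, Complex.norm_real, Real.norm_of_nonneg (meanCycles_nonneg hθ n), ← mul_assoc]
    exact mul_le_mul_of_nonneg_right (hK _ hn) (meanCycles_nonneg hθ n)
  have hmean : Tendsto (fun n => ((μ * (α n * (meanCycles θ n - θ * Real.log n)) : ℝ) : ℂ)
      * Complex.I) atTop (𝓝 0) := by
    refine squeeze_zero_norm' ?_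
      (by simpa using ((tendsto_abs_div_sqrt_log u).mul_const B).const_mul |μ|)
    filter_upwards [eventually_ge_atTop 1] with n hn
    rw [norm_mul, Complex.norm_I, mul_one, Complex.norm_real, Real.norm_eq_abs, abs_mul, abs_mul]
    gcongr
    exact hB n hn
  have hvar : Tendsto (fun n => ((-(ν / 2 * (α n ^ 2 * meanCycles θ n)) : ℝ) : ℂ)) atTop
      (𝓝 ((-(ν / 2 * (u ^ 2 * θ)) : ℝ) : ℂ)) :=
    (Complex.continuous_ofReal.tendsto _).comp
      ((tendsto_sq_mul_meanCycles hθ u).const_mul _).neg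
  have hsum := (htaylor.add hmean).add hvar
  rw [zero_add, zero_add, show ν / 2 * (u ^ 2 * θ) = θ * ν * u ^ 2 / 2 by ring] at hsum
  refine hsum.congr' ?_
  filter_upwards [tendsto_log_natCast_atTop.eventually_gt_atTop 0] with n hpos
  have hcenter : (u : ℂ) * (√(Real.log n) : ℝ) = α n * (Real.log n : ℝ) := by
    norm_cast
    rw [hα, div_mul_eq_mul_div, eq_div_iff (Real.sqrt_pos.2 hpos).ne', mul_assoc,
      Real.mul_self_sqrt hpos.le]
  simp only [Complex.ofReal_neg, Complex.ofReal_mul, Complex.ofReal_sub, Complex.ofReal_div,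
    Complex.ofReal_pow, Complex.ofReal_ofNat]
  linear_combination (θ * μ * Complex.I) * hcenter

theorem tendsto_exp_mul_ewensMean {c : ℕ → ℝ} {μ ν : ℝ} (hc : HasCycleMoments c μ ν) :
    Tendsto (fun n : ℕ => Complex.exp (((-(u * θ * μ * √(Real.log n)) : ℝ) : ℂ) * Complex.I)
      * ewensMean θ (phaseWeight c (u / √(Real.log n))) n) atTop
      (𝓝 (Complex.exp ((-(θ * ν * u ^ 2 / 2) : ℝ) : ℂ))) := by
  have hdiff := (tendsto_ewensMean_phaseWeight_sub hθ u hc).add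
    (tendsto_ewensMean_flatWeight_sub_exp hθ u hc.sq_le)
  simp only [sub_add_sub_cancel, add_zero] at hdiff
  have hzero : Tendsto (fun n : ℕ =>
      Complex.exp (((-(u * θ * μ * √(Real.log n)) : ℝ) : ℂ) * Complex.I)
        * (ewensMean θ (phaseWeight c (u / √(Real.log n))) n
          - Complex.exp ((flatWeight μ ν (u / √(Real.log n)) - 1) * meanCycles θ n)))
      atTop (𝓝 0) := by
    rw [tendsto_zero_iff_norm_tendsto_zero] at hdiff ⊢
    simpa only [norm_mul, Complex.norm_exp_ofReal_mul_I, one_mul] using hdiff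
  have hexp := (Complex.continuous_exp.tendsto _).comp (tendsto_flatWeight_exponent hθ u hc.sq_le)
  refine (zero_add (Complex.exp _) ▸ hzero.add hexp).congr fun n => ?_
  rw [Function.comp_apply, Complex.exp_add]
  ring

end Limit

/-! ### Equidistribution of `m t` for Lipschitz functions -/

/-- The multiples of `t` keep a polynomially small distance from the integers: the condition on
`t` that makes `exp (2 π i t)` a point of finite type. -/
def IsDiophantine (t : ℝ) : Prop :=
  ∃ K γ : ℝ, 0 < K ∧ 0 < γ ∧ ∀ m : ℤ, m ≠ 0 → K / |(m : ℝ)| ^ γ < distNearestInt (m * t)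

theorem sum_range_natCast_zmod {M : Type*} [AddCommMonoid M] {q : ℕ} [NeZero q] (F : ZMod q → M) :
    ∑ j ∈ Finset.range q, F j = ∑ z, F z :=
  Finset.sum_nbij' (fun j => (j : ZMod q)) ZMod.val (by simp)
    (fun z _ => Finset.mem_range.2 z.val_lt)
    (fun j hj => ZMod.val_cast_of_lt (Finset.mem_range.1 hj)) (by simp) (by simp)

section Periodic

variable {h : ℝ → ℝ} (hp : Function.Periodic h 1)
include hp

theorem sum_range_mul_rat (y : ℝ) (r : ℚ) :
    ∑ j ∈ Finset.range r.den, h (y + j * r) = ∑ j ∈ Finset.range r.den, h (y + j / r.den) := by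
  have : NeZero r.den := ⟨r.den_nz⟩
  set F : ZMod r.den → ℝ := fun z => hp.lift ((y : UnitAddCircle) + ZMod.toAddCircle z) with hF
  have hcoprime : IsUnit (r.num : ZMod r.den) :=
    (ZMod.coe_int_isUnit_iff_isCoprime _ _).2 (Int.isCoprime_iff_nat_coprime.2 r.reduced).symm
  have hleft (j : ℕ) : h (y + j * r) = F (j * r.num) := by
    simp only [hF]
    rw [← Int.cast_natCast (R := ZMod r.den), ← Int.cast_mul, ZMod.toAddCircle_intCast,
      ← AddCircle.coe_add, hp.lift_coe]
    congr 2
    rw [Rat.cast_def r]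
    push_cast
    ring
  have hright (j : ℕ) : h (y + j / r.den) = F j := by
    simp only [hF]
    rw [ZMod.toAddCircle_natCast, ← AddCircle.coe_add, hp.lift_coe]
  simp only [hleft, hright]
  rw [sum_range_natCast_zmod F, sum_range_natCast_zmod fun z => F (z * (r.num : ZMod r.den))]
  exact Equiv.sum_comp (Units.mulRight hcoprime.unit) F

theorem integral_add_one (y : ℝ) : ∫ s in y..(y + 1), h s = ∫ s in (0 : ℝ)..1, h s := by
  simpa using hp.intervalIntegral_add_eq y 0

end Periodic

section Lipschitz

variable {h : ℝ → ℝ} {L : NNReal} (hL : LipschitzWith L h)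
include hL

theorem abs_mul_sub_integral_le (a : ℝ) {d : ℝ} (hd : 0 ≤ d) :
    |d * h a - ∫ s in a..(a + d), h s| ≤ L * d * d := by
  have hdiff : d * h a - ∫ s in a..(a + d), h s = ∫ s in a..(a + d), (h a - h s) := by
    rw [intervalIntegral.integral_sub (by simp) (hL.continuous.intervalIntegrable _ _)]
    simp
  have hbound : ∀ s ∈ Set.uIoc a (a + d), ‖h a - h s‖ ≤ L * d := fun s hs => by
    rw [Set.uIoc_of_le (by linarith)] at hs
    refine (hL.norm_sub_le a s).trans ?_
    gcongr
    rw [Real.norm_eq_abs, abs_le]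
    constructor <;> linarith [hs.1, hs.2]
  simpa [hdiff, abs_of_nonneg hd] using intervalIntegral.norm_integral_le_of_norm_le_const hbound

theorem abs_sum_range_mul_sub_le {q : ℕ} {t r : ℝ} (hr : |t - r| ≤ 1 / (q : ℝ) ^ 2) (y : ℝ) :
    |∑ j ∈ Finset.range q, h (y + j * t) - ∑ j ∈ Finset.range q, h (y + j * r)| ≤ L := by
  rcases Nat.eq_zero_or_pos q with rfl | hq
  · simp
  have hq0 : (0 : ℝ) < q := by exact_mod_cast hq
  have hterm : ∀ j ∈ Finset.range q, |h (y + j * t) - h (y + j * r)| ≤ L / q := fun j hj => by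
    have hjq : (j : ℝ) ≤ q := by exact_mod_cast (Finset.mem_range.1 hj).le
    refine (hL.norm_sub_le _ _).trans ?_
    rw [add_sub_add_left_eq_sub, ← mul_sub, norm_mul, Real.norm_natCast, Real.norm_eq_abs]
    calc L * (j * |t - r|) ≤ L * (q * (1 / (q : ℝ) ^ 2)) := by gcongr
      _ = _ := by field_simp
  rw [← Finset.sum_sub_distrib]
  refine ((Finset.abs_sum_le_sum_abs _ _).trans (Finset.sum_le_sum hterm)).trans_eq ?_
  rw [Finset.sum_const, Finset.card_range, nsmul_eq_mul, mul_div_cancel₀ _ hq0.ne']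

variable (hp : Function.Periodic h 1)
include hp

theorem abs_sub_integral_le (x : ℝ) : |h x - ∫ s in (0 : ℝ)..1, h s| ≤ L := by
  simpa [integral_add_one hp] using abs_mul_sub_integral_le hL x zero_le_one

theorem abs_sum_equispaced_sub_le (y : ℝ) {q : ℕ} (hq : q ≠ 0) :
    |∑ j ∈ Finset.range q, h (y + j / q) - q * ∫ s in (0 : ℝ)..1, h s| ≤ L := by
  have hq0 : (0 : ℝ) < q := by exact_mod_cast Nat.pos_of_ne_zero hq
  have hpieces : ∫ s in (0 : ℝ)..1, h s
      = ∑ j ∈ Finset.range q, ∫ s in (y + j / q)..(y + j / q + 1 / q), h s := by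
    have hadjacent := intervalIntegral.sum_integral_adjacent_intervals (μ := volume) (f := h)
      (a := fun j : ℕ => y + j / q) (n := q) fun _ _ => hL.continuous.intervalIntegrable _ _
    simp only [Nat.cast_zero, zero_div, add_zero, div_self hq0.ne', Nat.cast_succ, add_div,
      ← add_assoc] at hadjacent
    rw [← integral_add_one hp y, ← hadjacent]
  have hterm (j : ℕ) : |h (y + j / q) - q * ∫ s in (y + j / q)..(y + j / q + 1 / q), h s|
      ≤ L / q := by
    have hpiece := abs_mul_sub_integral_le hL (y + j / q) (one_div_nonneg.2 hq0.le)
    calc _ = q * |1 / q * h (y + j / q) - ∫ s in (y + j / q)..(y + j / q + 1 / q), h s| := by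
          rw [← abs_of_pos hq0, ← abs_mul, abs_of_pos hq0, mul_sub, ← mul_assoc,
            mul_one_div_cancel hq0.ne', one_mul]
      _ ≤ q * (L * (1 / q) * (1 / q)) := by gcongr
      _ = _ := by field_simp
  rw [hpieces, Finset.mul_sum, ← Finset.sum_sub_distrib]
  refine ((Finset.abs_sum_le_sum_abs _ _).trans (Finset.sum_le_sum fun j _ => hterm j)).trans_eq ?_
  rw [Finset.sum_const, Finset.card_range, nsmul_eq_mul, mul_div_cancel₀ _ hq0.ne']

variable {t : ℝ} {r : ℚ} (hr : |t - r| ≤ 1 / (r.den : ℝ) ^ 2)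
include hr

theorem abs_sum_range_den_sub_le (y : ℝ) :
    |∑ j ∈ Finset.range r.den, h (y + j * t) - r.den * ∫ s in (0 : ℝ)..1, h s| ≤ 2 * L := by
  rw [two_mul]
  refine (abs_sub_le _ _ _).trans (add_le_add (abs_sum_range_mul_sub_le hL hr y) ?_)
  rw [sum_range_mul_rat hp]
  exact abs_sum_equispaced_sub_le hL hp y r.den_nz

theorem abs_sum_range_den_mul_sub_le (y : ℝ) (B : ℕ) :
    |∑ m ∈ Finset.range (r.den * B), h (y + m * t) - (r.den * B : ℕ) * ∫ s in (0 : ℝ)..1, h s|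
      ≤ 2 * L * B := by
  induction B with
  | zero => simp
  | succ B ih =>
    have hblock := abs_sum_range_den_sub_le hL hp hr (y + (r.den * B : ℕ) * t)
    rw [Nat.mul_succ, Finset.sum_range_add]
    simp only [add_assoc, ← add_mul, ← Nat.cast_add] at hblock
    calc _ = |(∑ m ∈ Finset.range (r.den * B), h (y + m * t)
            - (r.den * B : ℕ) * ∫ s in (0 : ℝ)..1, h s)
          + (∑ j ∈ Finset.range r.den, h (y + (r.den * B + j : ℕ) * t)
            - r.den * ∫ s in (0 : ℝ)..1, h s)| := by
          congr 1
          push_cast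
          ring
      _ ≤ 2 * L * B + 2 * L := (abs_add_le _ _).trans (add_le_add ih hblock)
      _ = _ := by push_cast; ring

theorem abs_sum_Icc_sub_le (N : ℕ) :
    |∑ m ∈ Finset.Icc 1 N, h (m * t) - N * ∫ s in (0 : ℝ)..1, h s|
      ≤ L * (2 * (N / r.den) + r.den) := by
  have hshift : ∑ m ∈ Finset.Icc 1 N, h (m * t) = ∑ m ∈ Finset.range N, h (t + m * t) := by
    rw [← Finset.Ico_add_one_right_eq_Icc, Finset.sum_Ico_eq_sum_range, Nat.add_sub_cancel]
    refine Finset.sum_congr rfl fun m _ => ?_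
    rw [Nat.cast_add, Nat.cast_one, one_add_mul]
  have hdivmod := Nat.div_add_mod N r.den
  have hblocks := abs_sum_range_den_mul_sub_le hL hp hr t (N / r.den)
  have hrest : |∑ j ∈ Finset.range (N % r.den), h (t + (r.den * (N / r.den) + j : ℕ) * t)
      - (N % r.den : ℕ) * ∫ s in (0 : ℝ)..1, h s| ≤ L * r.den := by
    have hconst : (N % r.den : ℕ) * ∫ s in (0 : ℝ)..1, h s
        = ∑ _j ∈ Finset.range (N % r.den), ∫ s in (0 : ℝ)..1, h s := by
      rw [Finset.sum_const, Finset.card_range, nsmul_eq_mul]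
    rw [hconst, ← Finset.sum_sub_distrib]
    refine ((Finset.abs_sum_le_sum_abs _ _).trans
      (Finset.sum_le_sum fun _ _ => abs_sub_integral_le hL hp _)).trans ?_
    rw [Finset.sum_const, Finset.card_range, nsmul_eq_mul, mul_comm]
    gcongr
    exact (Nat.mod_lt N r.pos).le
  calc _ = |(∑ m ∈ Finset.range (r.den * (N / r.den)), h (t + m * t)
          - (r.den * (N / r.den) : ℕ) * ∫ s in (0 : ℝ)..1, h s)
        + (∑ j ∈ Finset.range (N % r.den), h (t + (r.den * (N / r.den) + j : ℕ) * t)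
          - (N % r.den : ℕ) * ∫ s in (0 : ℝ)..1, h s)| := by
        rw [hshift, sub_add_sub_comm, ← Finset.sum_range_add, ← add_mul, ← Nat.cast_add, hdivmod]
    _ ≤ 2 * L * (N / r.den : ℕ) + L * r.den := (abs_add_le _ _).trans (add_le_add hblocks hrest)
    _ ≤ 2 * L * (N / r.den) + L * r.den := by gcongr; exact Nat.cast_div_le
    _ = _ := by ring

end Lipschitz

theorem distNearestInt_eq_abs_sub_round (s : ℝ) : distNearestInt s = |s - round s| :=
  (abs_sub_round_eq_min s).symm

theorem distNearestInt_le (s : ℝ) (k : ℤ) : distNearestInt s ≤ |s - k| :=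
  distNearestInt_eq_abs_sub_round s ▸ round_le s k

theorem rpow_half_le_sqrt_add_one (N : ℕ) : (N : ℝ) ^ (1 / 2 : ℝ) ≤ (Nat.sqrt N : ℝ) + 1 := by
  rw [← Real.sqrt_eq_rpow, Real.sqrt_le_left (by positivity), sq]
  exact_mod_cast (Nat.lt_succ_sqrt N).le

theorem exists_rat_rpow_le_den {t K γ : ℝ} (hK : 0 < K) (hγ : 0 < γ)
    (ht : ∀ m : ℤ, m ≠ 0 → K / |(m : ℝ)| ^ γ < distNearestInt (m * t)) {N : ℕ} (hN : 1 ≤ N) :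
    ∃ r : ℚ, |t - r| ≤ 1 / (r.den : ℝ) ^ 2 ∧ (r.den : ℝ) ≤ (N : ℝ) ^ (1 / 2 : ℝ) ∧
      K ^ (1 / γ) * (N : ℝ) ^ (1 / (2 * γ)) ≤ r.den := by
  obtain ⟨r, hr, hden⟩ := Real.exists_rat_abs_sub_le_and_den_le t (Nat.sqrt_pos.2 hN)
  have hq : (0 : ℝ) < r.den := by exact_mod_cast r.pos
  have hden' : (r.den : ℝ) ≤ Nat.sqrt N := by exact_mod_cast hden
  refine ⟨r, hr.trans ?_, hden'.trans ?_, ?_⟩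
  · rw [sq]
    gcongr
    linarith
  · rw [← Real.sqrt_eq_rpow]
    exact Real.nat_sqrt_le_real_sqrt
  have hclose : |((r.den : ℤ) : ℝ) * t - r.num| ≤ 1 / ((Nat.sqrt N : ℝ) + 1) := by
    calc |((r.den : ℤ) : ℝ) * t - r.num| = r.den * |t - r| := by
          rw [Int.cast_natCast, ← Nat.abs_cast r.den, ← abs_mul, mul_sub, Nat.abs_cast,
            Rat.cast_def r, mul_div_cancel₀ _ hq.ne']
      _ ≤ r.den * (1 / (((Nat.sqrt N : ℝ) + 1) * r.den)) := by gcongr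
      _ = _ := by field_simp
  have hfar := ((ht r.den (by exact_mod_cast r.den_nz)).trans_le
    (distNearestInt_le _ r.num)).trans_le hclose
  rw [Int.cast_natCast, Nat.abs_cast, div_lt_div_iff₀ (by positivity) (by positivity),
    one_mul] at hfar
  have hpow : K * (N : ℝ) ^ (1 / 2 : ℝ) ≤ (r.den : ℝ) ^ γ :=
    (mul_le_mul_of_nonneg_left (rpow_half_le_sqrt_add_one N) hK.le).trans hfar.le
  calc K ^ (1 / γ) * (N : ℝ) ^ (1 / (2 * γ)) = (K * (N : ℝ) ^ (1 / 2 : ℝ)) ^ (1 / γ) := by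
        rw [Real.mul_rpow hK.le (by positivity), ← Real.rpow_mul (by positivity)]
        congr 2
        field_simp
    _ ≤ ((r.den : ℝ) ^ γ) ^ (1 / γ) := by gcongr
    _ = r.den := by rw [← Real.rpow_mul hq.le, mul_one_div_cancel hγ.ne', Real.rpow_one]

theorem IsDiophantine.exists_abs_sum_sub_le {t : ℝ} (ht : IsDiophantine t) :
    ∃ β C : ℝ, 0 < β ∧ β < 1 ∧ 0 ≤ C ∧ ∀ (h : ℝ → ℝ) (L : NNReal), Function.Periodic h 1 →
      LipschitzWith L h → ∀ N : ℕ, 1 ≤ N →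
      |∑ m ∈ Finset.Icc 1 N, h (m * t) - N * ∫ s in (0 : ℝ)..1, h s|
        ≤ C * L * (N : ℝ) ^ (1 - β) := by
  obtain ⟨K, γ, hK, hγ, ht⟩ := ht
  set β := min (1 / 2) (1 / (2 * γ))
  have hβ_half : β ≤ 1 / 2 := min_le_left _ _
  refine ⟨β, 2 * (K ^ (1 / γ))⁻¹ + 1, by positivity, by linarith, by positivity,
    fun h L hp hL N hN => ?_⟩
  have hN1 : (1 : ℝ) ≤ N := by exact_mod_cast hN
  have hN0 : (0 : ℝ) < N := by linarith
  obtain ⟨r, hr, hden_le, hle_den⟩ := exists_rat_rpow_le_den hK hγ ht hN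
  have hblocks : (N : ℝ) / r.den ≤ (K ^ (1 / γ))⁻¹ * (N : ℝ) ^ (1 - β) := by
    calc (N : ℝ) / r.den ≤ N / (K ^ (1 / γ) * (N : ℝ) ^ (1 / (2 * γ))) := by gcongr
      _ = (K ^ (1 / γ))⁻¹ * (N : ℝ) ^ (1 - 1 / (2 * γ)) := by
          rw [Real.rpow_sub hN0, Real.rpow_one]
          field_simp
      _ ≤ _ := by
          gcongr
          exact min_le_right _ _
  have hden : (r.den : ℝ) ≤ (N : ℝ) ^ (1 - β) :=
    hden_le.trans (Real.rpow_le_rpow_of_exponent_le hN1 (by linarith))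
  calc _ ≤ (L : ℝ) * (2 * (N / r.den) + r.den) := abs_sum_Icc_sub_le hL hp hr N
    _ ≤ L * (2 * ((K ^ (1 / γ))⁻¹ * (N : ℝ) ^ (1 - β)) + (N : ℝ) ^ (1 - β)) := by gcongr
    _ = _ := by ring

/-! ### Equidistribution of `m t` for functions with mild singularities -/

/-- A periodic function whose zeros mark the singular points of other functions, and which
vanishes slowly enough for a small negative power to be integrable. -/
structure IsGauge (Q : ℝ → ℝ) : Prop where
  periodic : Function.Periodic Q 1
  exists_lipschitzWith : ∃ Λ, LipschitzWith Λ Q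
  ae_pos : ∀ᵐ s, 0 < Q s
  exists_integrable : ∃ η : ℝ, 0 < η ∧ IntervalIntegrable (fun s => Q s ^ (-η)) volume 0 1

/-- `g` is controlled by the gauge `Q`: it grows more slowly than any negative power of `Q`, and
its Lipschitz constant on an interval where `ρ ≤ Q` is at most a power of `ρ⁻¹`. -/
structure IsTame (Q g : ℝ → ℝ) : Prop where
  periodic : Function.Periodic g 1
  measurable : Measurable g
  bound : ∀ ε : ℝ, 0 < ε → ∃ C : ℝ, 0 ≤ C ∧ ∀ s, 0 < Q s → |g s| ≤ C * Q s ^ (-ε)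
  lipschitz : ∃ (C : ℝ) (A : ℕ), 0 ≤ C ∧ ∀ ρ : ℝ, 0 < ρ → ρ ≤ 1 → ∀ y z,
    (∀ w ∈ Set.uIcc y z, ρ ≤ Q w) → |g y - g z| ≤ C * ρ⁻¹ ^ A * |y - z|

section Tame

variable {Q f g : ℝ → ℝ}

theorem IsTame.exists_abs_le_inv (hg : IsTame Q g) :
    ∃ C : ℝ, 0 ≤ C ∧ ∀ ρ : ℝ, 0 < ρ → ∀ s, ρ ≤ Q s → |g s| ≤ C * ρ⁻¹ := by
  obtain ⟨C, hC, hbound⟩ := hg.bound 1 one_pos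
  refine ⟨C, hC, fun ρ hρ s hs => (hbound s (hρ.trans_le hs)).trans ?_⟩
  rw [Real.rpow_neg_one]
  gcongr

theorem IsTame.mul (hf : IsTame Q f) (hg : IsTame Q g) : IsTame Q (fun s => f s * g s) where
  periodic := hf.periodic.mul hg.periodic
  measurable := hf.measurable.mul hg.measurable
  bound ε hε := by
    obtain ⟨C, hC, hfC⟩ := hf.bound (ε / 2) (by positivity)
    obtain ⟨D, hD, hgD⟩ := hg.bound (ε / 2) (by positivity)
    refine ⟨C * D, by positivity, fun s hs => ?_⟩
    rw [abs_mul]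
    calc |f s| * |g s| ≤ (C * Q s ^ (-(ε / 2))) * (D * Q s ^ (-(ε / 2))) :=
          mul_le_mul (hfC s hs) (hgD s hs) (abs_nonneg _) ((abs_nonneg _).trans (hfC s hs))
      _ = C * D * (Q s ^ (-(ε / 2)) * Q s ^ (-(ε / 2))) := by ring
      _ = _ := by rw [← Real.rpow_add hs, ← neg_add, add_halves]
  lipschitz := by
    obtain ⟨C, hC, hfC⟩ := hf.exists_abs_le_inv
    obtain ⟨D, hD, hgD⟩ := hg.exists_abs_le_inv
    obtain ⟨C', A, hC', hfA⟩ := hf.lipschitz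
    obtain ⟨D', B, hD', hgB⟩ := hg.lipschitz
    refine ⟨C * D' + D * C', A + B + 1, by positivity, fun ρ hρ hρ1 y z hQ => ?_⟩
    have hinv : 1 ≤ ρ⁻¹ := (one_le_inv₀ hρ).2 hρ1
    have hsplit : f y * g y - f z * g z = f y * (g y - g z) + g z * (f y - f z) := by ring
    rw [hsplit]
    refine (abs_add_le _ _).trans ?_
    rw [abs_mul, abs_mul]
    calc _ ≤ (C * ρ⁻¹) * (D' * ρ⁻¹ ^ B * |y - z|) + (D * ρ⁻¹) * (C' * ρ⁻¹ ^ A * |y - z|) := by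
          gcongr
          · exact hfC ρ hρ y (hQ y Set.left_mem_uIcc)
          · exact hgB ρ hρ hρ1 y z hQ
          · exact hgD ρ hρ z (hQ z Set.right_mem_uIcc)
          · exact hfA ρ hρ hρ1 y z hQ
      _ = (C * D' * ρ⁻¹ ^ (B + 1) + D * C' * ρ⁻¹ ^ (A + 1)) * |y - z| := by ring
      _ ≤ (C * D' * ρ⁻¹ ^ (A + B + 1) + D * C' * ρ⁻¹ ^ (A + B + 1)) * |y - z| := by
          gcongr <;> first | exact hinv | omega
      _ = _ := by ring

theorem IsTame.pow (hg : IsTame Q g) {k : ℕ} (hk : k ≠ 0) : IsTame Q (fun s => g s ^ k) := by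
  induction k, Nat.one_le_iff_ne_zero.2 hk using Nat.le_induction with
  | base => simpa using hg
  | succ k hk ih => simpa only [pow_succ] using (ih (by omega)).mul hg

/-- A cutoff that vanishes where `Q ≤ ρ` and equals one where `2 ρ ≤ Q`; it truncates a tame
function to a Lipschitz one. -/
noncomputable def cutoff (Q : ℝ → ℝ) (ρ s : ℝ) : ℝ := max 0 (min 1 (Q s / ρ - 1))

theorem cutoff_nonneg (Q : ℝ → ℝ) (ρ s : ℝ) : 0 ≤ cutoff Q ρ s := le_max_left _ _

theorem cutoff_le_one (Q : ℝ → ℝ) (ρ s : ℝ) : cutoff Q ρ s ≤ 1 :=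
  max_le zero_le_one (min_le_left _ _)

theorem continuous_cutoff (hc : Continuous Q) (ρ : ℝ) : Continuous (cutoff Q ρ) := by
  unfold cutoff
  fun_prop

theorem periodic_cutoff (hp : Function.Periodic Q 1) (ρ : ℝ) :
    Function.Periodic (cutoff Q ρ) 1 := fun s => by rw [cutoff, cutoff, hp]

section Cutoff

variable {ρ : ℝ} (hρ : 0 < ρ)
include hρ

theorem cutoff_eq_zero {s : ℝ} (h : Q s ≤ ρ) : cutoff Q ρ s = 0 :=
  max_eq_left ((min_le_right _ _).trans (sub_nonpos.2 ((div_le_one hρ).2 h)))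

theorem cutoff_eq_one {s : ℝ} (h : 2 * ρ ≤ Q s) : cutoff Q ρ s = 1 := by
  have hle : 1 ≤ Q s / ρ - 1 := by rw [le_sub_iff_add_le, le_div_iff₀ hρ]; linarith
  rw [cutoff, min_eq_left hle, max_eq_right zero_le_one]

theorem one_sub_cutoff_le {s a : ℝ} (ha : 0 ≤ a) (hs : 0 < Q s) :
    1 - cutoff Q ρ s ≤ (2 * ρ) ^ a * Q s ^ (-a) := by
  rcases le_total (2 * ρ) (Q s) with h | h
  · rw [cutoff_eq_one hρ h, sub_self]
    positivity
  · refine (sub_le_self _ (cutoff_nonneg Q ρ s)).trans ?_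
    rw [Real.rpow_neg hs.le, ← div_eq_mul_inv, one_le_div (by positivity)]
    gcongr

theorem abs_cutoff_sub_le {Λ : NNReal} (hΛ : LipschitzWith Λ Q) (y z : ℝ) :
    |cutoff Q ρ y - cutoff Q ρ z| ≤ Λ / ρ * |y - z| := by
  have hclamp := ((LipschitzWith.id.const_min (1 : ℝ)).const_max 0).norm_sub_le
    (Q y / ρ - 1) (Q z / ρ - 1)
  rw [NNReal.coe_one, one_mul, sub_sub_sub_cancel_right, ← sub_div, norm_div,
    Real.norm_of_nonneg hρ.le] at hclamp
  refine hclamp.trans ?_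
  rw [div_mul_eq_mul_div]
  gcongr
  exact hΛ.norm_sub_le y z

theorem abs_mul_cutoff_sub_le {Λ : NNReal} (hΛ : LipschitzWith Λ Q) {B L : ℝ} (hB : 0 ≤ B)
    (hL : 0 ≤ L) (hgB : ∀ s, ρ ≤ Q s → |g s| ≤ B)
    (hgL : ∀ y z, (∀ w ∈ Set.uIcc y z, ρ ≤ Q w) → |g y - g z| ≤ L * |y - z|) (y z : ℝ) :
    |g y * cutoff Q ρ y - g z * cutoff Q ρ z| ≤ (B * (Λ / ρ) + L) * |y - z| := by
  have hvanish (s w : ℝ) (hw : Q w ≤ ρ) : |g s * cutoff Q ρ s| ≤ B * (Λ / ρ * |s - w|) := by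
    rcases le_total (Q s) ρ with h | h
    · rw [cutoff_eq_zero hρ h, mul_zero, abs_zero]
      positivity
    · rw [abs_mul, ← sub_zero (cutoff Q ρ s), ← cutoff_eq_zero hρ hw]
      exact mul_le_mul (hgB s h) (abs_cutoff_sub_le hρ hΛ s w) (abs_nonneg _) hB
  by_cases hseg : ∀ w ∈ Set.uIcc y z, ρ ≤ Q w
  · have hsplit : g y * cutoff Q ρ y - g z * cutoff Q ρ z
        = g z * (cutoff Q ρ y - cutoff Q ρ z) + (g y - g z) * cutoff Q ρ y := by ring
    rw [hsplit, add_mul, mul_assoc]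
    refine (abs_add_le _ _).trans (add_le_add ?_ ?_)
    · rw [abs_mul]
      exact mul_le_mul (hgB z (hseg z Set.right_mem_uIcc)) (abs_cutoff_sub_le hρ hΛ y z)
        (abs_nonneg _) hB
    · rw [abs_mul, abs_of_nonneg (cutoff_nonneg Q ρ y)]
      exact (mul_le_of_le_one_right (abs_nonneg _) (cutoff_le_one Q ρ y)).trans (hgL y z hseg)
  · push Not at hseg
    obtain ⟨w, hw, hQw⟩ := hseg
    have hdist : |y - w| + |z - w| = |y - z| := by
      rw [Set.mem_uIcc] at hw
      rcases hw with ⟨h1, h2⟩ | ⟨h1, h2⟩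
      · rw [abs_of_nonpos (by linarith), abs_of_nonneg (by linarith), abs_of_nonpos (by linarith)]
        ring
      · rw [abs_of_nonneg (by linarith), abs_of_nonpos (by linarith), abs_of_nonneg (by linarith)]
        ring
    calc _ ≤ |g y * cutoff Q ρ y| + |g z * cutoff Q ρ z| := abs_sub _ _
      _ ≤ B * (Λ / ρ * |y - w|) + B * (Λ / ρ * |z - w|) :=
          add_le_add (hvanish y w hQw.le) (hvanish z w hQw.le)
      _ = B * (Λ / ρ) * |y - z| := by rw [← hdist]; ring
      _ ≤ _ := by gcongr; linarith

theorem abs_integral_mul_one_sub_cutoff_le {u : ℝ → ℝ} {D b η : ℝ} (hb : b ≤ η)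
    (hpos : ∀ᵐ s, 0 < Q s) (hint : IntervalIntegrable (fun s => Q s ^ (-η)) volume 0 1)
    (hu : ∀ s, 0 < Q s → |u s| ≤ D * Q s ^ (-b)) :
    |∫ s in (0 : ℝ)..1, u s * (1 - cutoff Q ρ s)|
      ≤ D * (2 * ρ) ^ (η - b) * ∫ s in (0 : ℝ)..1, Q s ^ (-η) := by
  rw [← intervalIntegral.integral_const_mul, ← Real.norm_eq_abs]
  refine intervalIntegral.norm_integral_le_of_norm_le zero_le_one ?_ (hint.const_mul _)
  filter_upwards [hpos] with s hs _
  have hone_sub : 0 ≤ 1 - cutoff Q ρ s := sub_nonneg.2 (cutoff_le_one Q ρ s)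
  rw [norm_mul, Real.norm_eq_abs, Real.norm_of_nonneg hone_sub]
  calc _ ≤ (D * Q s ^ (-b)) * ((2 * ρ) ^ (η - b) * Q s ^ (-(η - b))) :=
        mul_le_mul (hu s hs) (one_sub_cutoff_le hρ (sub_nonneg.2 hb) hs) hone_sub
          ((abs_nonneg _).trans (hu s hs))
    _ = D * (2 * ρ) ^ (η - b) * (Q s ^ (-b) * Q s ^ (-(η - b))) := by ring
    _ = _ := by rw [← Real.rpow_add hs, ← neg_add, add_sub_cancel]

end Cutoff

theorem IsTame.exists_lipschitzWith_mul_cutoff (hg : IsTame Q g) {Λ : NNReal}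
    (hΛ : LipschitzWith Λ Q) :
    ∃ (C : ℝ) (A : ℕ), 0 ≤ C ∧ ∀ ρ : ℝ, 0 < ρ → ρ ≤ 1 →
      LipschitzWith (Real.toNNReal (C * ρ⁻¹ ^ A)) (fun s => g s * cutoff Q ρ s) := by
  obtain ⟨C, hC, hgC⟩ := hg.exists_abs_le_inv
  obtain ⟨D, A, hD, hgA⟩ := hg.lipschitz
  refine ⟨C * Λ + D, A + 2, by positivity, fun ρ hρ hρ1 =>
    LipschitzWith.of_dist_le' fun y z => ?_⟩
  have hinv : 1 ≤ ρ⁻¹ := (one_le_inv₀ hρ).2 hρ1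
  calc _ ≤ (C * ρ⁻¹ * (Λ / ρ) + D * ρ⁻¹ ^ A) * |y - z| :=
        abs_mul_cutoff_sub_le hρ hΛ (by positivity) (by positivity) (hgC ρ hρ) (hgA ρ hρ hρ1) y z
    _ = (C * Λ * ρ⁻¹ ^ 2 + D * ρ⁻¹ ^ A) * |y - z| := by ring
    _ ≤ (C * Λ * ρ⁻¹ ^ (A + 2) + D * ρ⁻¹ ^ (A + 2)) * |y - z| := by
        gcongr <;> first | exact hinv | omega
    _ = _ := by rw [← add_mul]; rfl

theorem IsTame.intervalIntegrable (hQ : IsGauge Q) (hg : IsTame Q g) :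
    IntervalIntegrable g volume 0 1 := by
  obtain ⟨η, hη, hint⟩ := hQ.exists_integrable
  obtain ⟨C, -, hbound⟩ := hg.bound η hη
  refine (hint.const_mul C).mono_fun hg.measurable.aestronglyMeasurable (ae_restrict_of_ae ?_)
  filter_upwards [hQ.ae_pos] with s hs
  exact (hbound s hs).trans (le_abs_self _)

/-- An error term that is smaller than the number of terms by a power. -/
def IsPowerSaving (e : ℕ → ℝ) : Prop :=
  ∃ δ C : ℝ, 0 < δ ∧ ∀ N : ℕ, 1 ≤ N → |e N| ≤ C * (N : ℝ) ^ (1 - δ)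

theorem IsPowerSaving.add {e e' : ℕ → ℝ} (he : IsPowerSaving e) (he' : IsPowerSaving e') :
    IsPowerSaving (fun N => e N + e' N) := by
  obtain ⟨δ, C, hδ, hC⟩ := he
  obtain ⟨δ', C', hδ', hC'⟩ := he'
  have hC0 : 0 ≤ C := by simpa using (abs_nonneg _).trans (hC 1 le_rfl)
  have hC'0 : 0 ≤ C' := by simpa using (abs_nonneg _).trans (hC' 1 le_rfl)
  refine ⟨min δ δ', C + C', by positivity, fun N hN => ?_⟩
  have hN1 : (1 : ℝ) ≤ N := by exact_mod_cast hN
  calc _ ≤ C * (N : ℝ) ^ (1 - δ) + C' * (N : ℝ) ^ (1 - δ') :=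
        (abs_add_le _ _).trans (add_le_add (hC N hN) (hC' N hN))
    _ ≤ C * (N : ℝ) ^ (1 - min δ δ') + C' * (N : ℝ) ^ (1 - min δ δ') := by
        gcongr
        exacts [min_le_left _ _, min_le_right _ _]
    _ = _ := by ring

theorem IsPowerSaving.congr {e e' : ℕ → ℝ} (he : IsPowerSaving e) (h : ∀ N, e N = e' N) :
    IsPowerSaving e' :=
  funext h ▸ he

theorem IsPowerSaving.neg {e : ℕ → ℝ} (he : IsPowerSaving e) : IsPowerSaving (fun N => -e N) := by
  simpa only [IsPowerSaving, abs_neg] using he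

theorem IsPowerSaving.sum_mul {b : ℕ → ℝ} {w : ℕ → ℕ → ℝ} (hw0 : ∀ N m, 0 ≤ w N m)
    (hw : IsPowerSaving fun N => ∑ m ∈ Finset.Icc 1 N, w N m) (hb : IsSubpoly b) :
    IsPowerSaving fun N => ∑ m ∈ Finset.Icc 1 N, b m * w N m := by
  obtain ⟨δ, C, hδ, hC⟩ := hw
  obtain ⟨B, hB⟩ := hb (δ / 2) (by positivity)
  have hB0 : 0 ≤ B := by simpa using (abs_nonneg _).trans (hB 1 le_rfl)
  refine ⟨δ / 2, B * C, by positivity, fun N hN => ?_⟩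
  have hN0 : (0 : ℝ) < N := by exact_mod_cast hN
  calc |∑ m ∈ Finset.Icc 1 N, b m * w N m|
      ≤ ∑ m ∈ Finset.Icc 1 N, B * (N : ℝ) ^ (δ / 2) * w N m := by
        refine (Finset.abs_sum_le_sum_abs _ _).trans (Finset.sum_le_sum fun m hm => ?_)
        obtain ⟨hm1, hmN⟩ := Finset.mem_Icc.1 hm
        rw [abs_mul, abs_of_nonneg (hw0 N m)]
        refine mul_le_mul_of_nonneg_right ((hB m hm1).trans ?_) (hw0 N m)
        gcongr
    _ ≤ B * (N : ℝ) ^ (δ / 2) * (C * (N : ℝ) ^ (1 - δ)) := by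
        rw [← Finset.mul_sum]
        exact mul_le_mul_of_nonneg_left ((le_abs_self _).trans (hC N hN)) (by positivity)
    _ = B * C * ((N : ℝ) ^ (δ / 2) * (N : ℝ) ^ (1 - δ)) := by ring
    _ = _ := by rw [← Real.rpow_add hN0]; ring_nf

theorem IsPowerSaving.hasPowerMean {c : ℕ → ℝ} {μ : ℝ}
    (h : IsPowerSaving fun N => ∑ m ∈ Finset.Icc 1 N, c m - N * μ) : HasPowerMean c μ := by
  obtain ⟨δ, C, hδ, hC⟩ := h
  have hC0 : 0 ≤ C := by simpa using (abs_nonneg _).trans (hC 1 le_rfl)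
  refine ⟨min δ (1 / 2), C, by positivity, (min_le_right _ _).trans_lt (by norm_num),
    fun N hN => (hC N hN).trans ?_⟩
  gcongr
  exacts [by exact_mod_cast hN, min_le_left _ _]

theorem IsGauge.isTame_one (hQ : IsGauge Q) : IsTame Q (fun _ => 1) where
  periodic _ := rfl
  measurable := measurable_const
  bound ε hε := by
    obtain ⟨Λ, hΛ⟩ := hQ.exists_lipschitzWith
    obtain ⟨M, hM⟩ :=
      (hQ.periodic.isBounded_of_continuous one_ne_zero hΛ.continuous).exists_norm_le
    have hM0 : 0 ≤ M := (norm_nonneg _).trans (hM _ ⟨0, rfl⟩)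
    refine ⟨M ^ ε, by positivity, fun s hs => ?_⟩
    rw [abs_one, Real.rpow_neg hs.le, ← div_eq_mul_inv, one_le_div (by positivity)]
    exact Real.rpow_le_rpow hs.le ((le_abs_self _).trans (hM _ ⟨s, rfl⟩)) hε.le
  lipschitz := ⟨0, 0, le_rfl, by simp⟩

section Truncation

variable (hQ : IsGauge Q) {t : ℝ} (ht : IsDiophantine t)
include hQ

theorem IsTame.isPowerSaving_integral_mul_one_sub_cutoff (hg : IsTame Q g) {κ : ℝ} (hκ : 0 < κ) :
    IsPowerSaving fun N : ℕ =>
      N * ∫ s in (0 : ℝ)..1, g s * (1 - cutoff Q ((N : ℝ) ^ (-κ)) s) := by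
  obtain ⟨η, hη, hint⟩ := hQ.exists_integrable
  obtain ⟨D, -, hbound⟩ := hg.bound (η / 2) (by positivity)
  refine ⟨κ * (η / 2), D * 2 ^ (η / 2) * ∫ s in (0 : ℝ)..1, Q s ^ (-η), by positivity,
    fun N hN => ?_⟩
  have hN0 : (0 : ℝ) < N := by exact_mod_cast hN
  have hintegral := abs_integral_mul_one_sub_cutoff_le (Real.rpow_pos_of_pos hN0 (-κ))
    (half_le_self hη.le) hQ.ae_pos hint hbound
  rw [abs_mul, Nat.abs_cast]
  refine (mul_le_mul_of_nonneg_left hintegral hN0.le).trans_eq ?_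
  rw [sub_half, Real.mul_rpow zero_le_two (by positivity), ← Real.rpow_mul hN0.le, neg_mul,
    sub_eq_add_neg, Real.rpow_add hN0, Real.rpow_one]
  ring

include ht

theorem IsTame.eventually_isPowerSaving_sum_mul_cutoff (hg : IsTame Q g) :
    ∀ᶠ κ in 𝓝[>] (0 : ℝ), IsPowerSaving fun N : ℕ =>
      ∑ m ∈ Finset.Icc 1 N, g (m * t) * cutoff Q ((N : ℝ) ^ (-κ)) (m * t)
        - N * ∫ s in (0 : ℝ)..1, g s * cutoff Q ((N : ℝ) ^ (-κ)) s := by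
  obtain ⟨Λ, hΛ⟩ := hQ.exists_lipschitzWith
  obtain ⟨β, B, hβ, -, -, hdiscrepancy⟩ := ht.exists_abs_sum_sub_le
  obtain ⟨C, A, hC, hlip⟩ := hg.exists_lipschitzWith_mul_cutoff hΛ
  have hsmall : ∀ᶠ κ in 𝓝[>] (0 : ℝ), κ * A < β :=
    ((continuous_mul_const (A : ℝ)).tendsto' 0 0 (zero_mul _)).mono_left nhdsWithin_le_nhds
      |>.eventually_lt_const hβ
  filter_upwards [hsmall, self_mem_nhdsWithin] with κ hκA (hκ : 0 < κ)
  refine ⟨β - κ * A, B * C, by linarith, fun N hN => ?_⟩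
  have hN1 : (1 : ℝ) ≤ N := by exact_mod_cast hN
  have hN0 : (0 : ℝ) < N := by linarith
  refine (hdiscrepancy _ _ (hg.periodic.mul (periodic_cutoff hQ.periodic _))
    (hlip _ (by positivity) (Real.rpow_le_one_of_one_le_of_nonpos hN1 (by linarith)))
    N hN).trans_eq ?_
  rw [Real.coe_toNNReal _ (by positivity), Real.rpow_neg hN0.le, inv_inv, ← Real.rpow_mul_natCast
    hN0.le, ← mul_assoc, mul_assoc _ _ ((N : ℝ) ^ (1 - β)), ← Real.rpow_add hN0]
  ring_nf

theorem IsGauge.eventually_isPowerSaving_sum_one_sub_cutoff :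
    ∀ᶠ κ in 𝓝[>] (0 : ℝ), IsPowerSaving fun N : ℕ =>
      ∑ m ∈ Finset.Icc 1 N, (1 - cutoff Q ((N : ℝ) ^ (-κ)) (m * t)) := by
  filter_upwards [hQ.isTame_one.eventually_isPowerSaving_sum_mul_cutoff hQ ht,
    self_mem_nhdsWithin] with κ hsum hκ
  obtain ⟨Λ, hΛ⟩ := hQ.exists_lipschitzWith
  refine (hsum.neg.add (hQ.isTame_one.isPowerSaving_integral_mul_one_sub_cutoff hQ hκ)).congr
    fun N => ?_
  simp only [one_mul]
  rw [intervalIntegral.integral_sub (by simp)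
    ((continuous_cutoff hΛ.continuous _).intervalIntegrable _ _), Finset.sum_sub_distrib]
  simp
  ring

theorem IsTame.hasPowerMean (hg : IsTame Q g) (hsub : IsSubpoly fun m => g (m * t)) :
    HasPowerMean (fun m => g (m * t)) (∫ s in (0 : ℝ)..1, g s) := by
  obtain ⟨Λ, hΛ⟩ := hQ.exists_lipschitzWith
  obtain ⟨κ, hκ, hsum, hsing⟩ := (eventually_mem_nhdsWithin.and
    ((hg.eventually_isPowerSaving_sum_mul_cutoff hQ ht).and
      (hQ.eventually_isPowerSaving_sum_one_sub_cutoff ht))).exists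
  refine IsPowerSaving.hasPowerMean <| (((hsing.sum_mul
    (fun N m => sub_nonneg.2 (cutoff_le_one Q _ _)) hsub).add hsum).add
    (hg.isPowerSaving_integral_mul_one_sub_cutoff hQ hκ).neg).congr fun N => ?_
  have hint := hg.intervalIntegrable hQ
  have hcut := hint.mul_continuousOn (continuous_cutoff hΛ.continuous ((N : ℝ) ^ (-κ))).continuousOn
  simp only [mul_one_sub]
  rw [intervalIntegral.integral_sub hint hcut, Finset.sum_sub_distrib]
  ring

end Truncation

end Tame

/-! ### Zeros of periodic real analytic functions -/

theorem exists_norm_le_of_periodic {E : Type*} [NormedAddCommGroup E] {u : ℝ → E}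
    (hp : Function.Periodic u 1) (hu : Continuous u) : ∃ M : ℝ, 0 < M ∧ ∀ s, ‖u s‖ ≤ M :=
  let ⟨M, hM, hu⟩ := (hp.isBounded_of_continuous one_ne_zero hu).exists_pos_norm_le
  ⟨M, hM, fun s => hu _ ⟨s, rfl⟩⟩

theorem periodic_deriv {E : Type*} [NormedAddCommGroup E] [NormedSpace ℝ E] {u : ℝ → E} {T : ℝ}
    (hp : Function.Periodic u T) : Function.Periodic (deriv u) T := fun s => by
  rw [← deriv_comp_add_const, funext hp]

theorem integrableOn_ball_rpow_neg {Q : ℝ → ℝ} (hQ : Measurable Q) {s₀ c r η : ℝ} {k : ℕ}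
    (hc : 0 < c) (hη : 0 < η) (hkη : k * η < 1)
    (h : ∀ s ∈ Metric.ball s₀ r, c * |s - s₀| ^ k ≤ Q s) :
    IntegrableOn (fun s => Q s ^ (-η)) (Metric.ball s₀ r) := by
  have hshift := measurePreserving_add_right (volume : Measure ℝ) s₀
  rw [← hshift.integrableOn_comp_preimage (measurableEmbedding_addRight s₀)]
  have hball : (· + s₀) ⁻¹' Metric.ball s₀ r = Metric.ball 0 r := by
    ext s
    simp
  rw [hball]
  refine integrableOn_ball_of_norm_le_rpow (C := c ^ (-η)) (α := k * η) (by simp) (by simpa) ?_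
    ((hQ.pow_const _).comp (measurable_add_const s₀)).aestronglyMeasurable
  filter_upwards [ae_restrict_mem Metric.isOpen_ball.measurableSet,
    ae_restrict_of_ae (volume.ae_ne 0)] with s hs hs0
  have hlow : c * |s| ^ k ≤ Q (s + s₀) := by
    simpa using h (s + s₀) (by simpa [Real.dist_eq] using hs)
  have hpos : 0 < c * |s| ^ k := by positivity
  calc ‖Q (s + s₀) ^ (-η)‖ = Q (s + s₀) ^ (-η) :=
        Real.norm_of_nonneg (Real.rpow_nonneg (hpos.le.trans hlow) _)
    _ ≤ (c * |s| ^ k) ^ (-η) := Real.rpow_le_rpow_of_nonpos hpos hlow (by linarith)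
    _ = c ^ (-η) * ‖s‖ ^ (-(k * η)) := by
      rw [Real.mul_rpow hc.le (by positivity), ← Real.rpow_natCast, ← Real.rpow_mul (abs_nonneg s),
        mul_neg, Real.norm_eq_abs]

section Analytic

variable {F : ℝ → ℂ} (hF : AnalyticOnNhd ℝ F Set.univ) (hF0 : F ≠ 0)
include hF hF0

theorem exists_pow_mul_le_norm (s₀ : ℝ) :
    ∃ (k : ℕ) (c : ℝ), 0 < c ∧ ∀ᶠ s in 𝓝 s₀, c * |s - s₀| ^ k ≤ ‖F s‖ := by
  have hne : ¬ ∀ᶠ s in 𝓝 s₀, F s = 0 := fun h => hF0 <| funext fun s =>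
    hF.eqOn_zero_of_preconnected_of_eventuallyEq_zero isPreconnected_univ (Set.mem_univ s₀) h
      (Set.mem_univ s)
  obtain ⟨k, g, hg, hg0, hFg⟩ :=
    ((hF s₀ (Set.mem_univ _)).exists_eventuallyEq_pow_smul_nonzero_iff).2 hne
  have hpos : 0 < ‖g s₀‖ := norm_pos_iff.2 hg0
  refine ⟨k, ‖g s₀‖ / 2, by positivity, ?_⟩
  filter_upwards [hFg, hg.continuousAt.norm.eventually_const_lt (half_lt_self hpos)] with s hs hgs
  rw [hs, norm_smul, norm_pow, Real.norm_eq_abs, mul_comm]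
  gcongr

theorem eventually_integrableOn_rpow_neg_norm {K : Set ℝ} (hK : IsCompact K) :
    ∀ᶠ η in 𝓝[>] (0 : ℝ), IntegrableOn (fun s => ‖F s‖ ^ (-η)) K := by
  refine hK.induction_on (p := fun U => ∀ᶠ η in 𝓝[>] (0 : ℝ),
    IntegrableOn (fun s => ‖F s‖ ^ (-η)) U) (.of_forall fun _ => integrableOn_empty)
    (fun U V hUV h => ?_) (fun U V hU hV => ?_) fun s₀ _ => ?_
  · filter_upwards [h] with η hη using hη.mono_set hUV
  · filter_upwards [hU, hV] with η hηU hηV using hηU.union hηV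
  obtain ⟨k, c, hc, h⟩ := exists_pow_mul_le_norm hF hF0 s₀
  obtain ⟨r, hr, hball⟩ := Metric.eventually_nhds_iff_ball.1 h
  refine ⟨Metric.ball s₀ r, mem_nhdsWithin_of_mem_nhds (Metric.ball_mem_nhds s₀ hr), ?_⟩
  have hsmall : ∀ᶠ η in 𝓝[>] (0 : ℝ), (k : ℝ) * η < 1 := by
    refine (Tendsto.eventually_lt_const one_pos ?_).filter_mono nhdsWithin_le_nhds
    simpa using (continuous_const_mul (k : ℝ)).tendsto 0
  filter_upwards [hsmall, self_mem_nhdsWithin] with η hkη hη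
  exact integrableOn_ball_rpow_neg (hF.contDiff (n := ω)).continuous.norm.measurable hc hη hkη hball

theorem ae_ne_zero_of_analyticOnNhd : ∀ᵐ s, F s ≠ 0 := by
  obtain ⟨a, ha⟩ := Function.ne_iff.1 hF0
  have := ae_restrict_le_codiscreteWithin (μ := volume) MeasurableSet.univ
    (hF.preimage_zero_mem_codiscrete ha)
  rwa [Measure.restrict_univ] at this

theorem isGauge_norm (hp : Function.Periodic F 1) : IsGauge (fun s => ‖F s‖) where
  periodic s := by simp only [hp s]
  exists_lipschitzWith := by
    have hdiff : ContDiff ℝ ω F := hF.contDiff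
    obtain ⟨Λ, -, hΛ⟩ := exists_norm_le_of_periodic (periodic_deriv hp)
      (hdiff.continuous_deriv (by simp))
    have hlip : LipschitzWith Λ.toNNReal F :=
      lipschitzWith_of_nnnorm_deriv_le (hdiff.differentiable (by simp))
        fun s => NNReal.le_toNNReal_of_coe_le (hΛ s)
    exact ⟨1 * Λ.toNNReal, lipschitzWith_one_norm.comp hlip⟩
  ae_pos := (ae_ne_zero_of_analyticOnNhd hF hF0).mono fun _ hs => norm_pos_iff.2 hs
  exists_integrable := by
    obtain ⟨η, hint, hη⟩ := ((eventually_integrableOn_rpow_neg_norm hF hF0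
      isCompact_Icc).and self_mem_nhdsWithin).exists
    exact ⟨η, hη, (intervalIntegrable_iff_integrableOn_Icc_of_le zero_le_one).2 hint⟩

end Analytic

theorem distNearestInt_nonneg (s : ℝ) : 0 ≤ distNearestInt s :=
  le_min (Int.fract_nonneg s) (sub_nonneg.2 (Int.fract_lt_one s).le)

theorem distNearestInt_le_one (s : ℝ) : distNearestInt s ≤ 1 :=
  (min_le_left _ _).trans (Int.fract_lt_one s).le

theorem periodic_distNearestInt_natCast_mul (q : ℕ) :
    Function.Periodic (fun s => distNearestInt (q * s)) 1 := fun s => by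
  simp only [distNearestInt, mul_add, mul_one, Int.fract_add_natCast]

theorem distNearestInt_natCast_mul_le (n : ℕ) (s : ℝ) :
    distNearestInt (n * s) ≤ n * distNearestInt s := by
  refine (distNearestInt_le (n * s) (n * round s)).trans_eq ?_
  rw [distNearestInt_eq_abs_sub_round, Int.cast_mul, Int.cast_natCast, ← mul_sub, abs_mul,
    Nat.abs_cast]

theorem distNearestInt_natCast_mul_pow_le (n k j : ℕ) (s : ℝ) :
    distNearestInt (n * s) ^ (k + j) ≤ n ^ k * distNearestInt s ^ k :=
  calc distNearestInt (n * s) ^ (k + j)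
      ≤ distNearestInt (n * s) ^ k :=
        pow_le_pow_of_le_one (distNearestInt_nonneg _) (distNearestInt_le_one _) (k.le_add_right j)
    _ ≤ (n * distNearestInt s) ^ k :=
        pow_le_pow_left₀ (distNearestInt_nonneg _) (distNearestInt_natCast_mul_le n s) k
    _ = n ^ k * distNearestInt s ^ k := mul_pow _ _ _

/-- On `U`, the norm of `F` is at least a power of the distance to the fractions with one fixed
denominator. This is how rationality of the zeros of `F` is used. -/
def HasRationalLowerBound (F : ℝ → ℂ) (U : Set ℝ) : Prop :=
  ∃ (q k : ℕ) (c : ℝ), 0 < q ∧ 0 < c ∧ ∀ s ∈ U, c * distNearestInt (q * s) ^ k ≤ ‖F s‖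

section RationalLowerBound

variable {F : ℝ → ℂ} {U V : Set ℝ}

theorem HasRationalLowerBound.mono (hUV : U ⊆ V) :
    HasRationalLowerBound F V → HasRationalLowerBound F U :=
  fun ⟨q, k, c, hq, hc, h⟩ => ⟨q, k, c, hq, hc, fun s hs => h s (hUV hs)⟩

theorem HasRationalLowerBound.union (hU : HasRationalLowerBound F U)
    (hV : HasRationalLowerBound F V) : HasRationalLowerBound F (U ∪ V) := by
  obtain ⟨q₁, k₁, c₁, hq₁, hc₁, hU⟩ := hU
  obtain ⟨q₂, k₂, c₂, hq₂, hc₂, hV⟩ := hV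
  have refine_denominator {n q k j : ℕ} {c c' s : ℝ} (hn : 0 < n) (hc : 0 < c)
      (hc' : c' ≤ c / n ^ k) (h : c * distNearestInt (q * s) ^ k ≤ ‖F s‖) :
      c' * distNearestInt (n * (q * s)) ^ (k + j) ≤ ‖F s‖ :=
    calc c' * distNearestInt (n * (q * s)) ^ (k + j)
        ≤ c / n ^ k * (n ^ k * distNearestInt (q * s) ^ k) := by
          refine mul_le_mul hc' (distNearestInt_natCast_mul_pow_le n k j _)
            (pow_nonneg (distNearestInt_nonneg _) _) (by positivity)
      _ = c * distNearestInt (q * s) ^ k := by field_simp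
      _ ≤ ‖F s‖ := h
  refine ⟨q₂ * q₁, k₁ + k₂, min (c₁ / q₂ ^ k₁) (c₂ / q₁ ^ k₂), by positivity, by positivity, ?_⟩
  rintro s (hs | hs)
  · rw [Nat.cast_mul, mul_assoc]
    exact refine_denominator hq₂ hc₁ (min_le_left _ _) (hU s hs)
  · rw [Nat.cast_mul, mul_comm (q₂ : ℝ), mul_assoc, add_comm k₁]
    exact refine_denominator hq₁ hc₂ (min_le_right _ _) (hV s hs)

section AnalyticRational

variable (hF : AnalyticOnNhd ℝ F Set.univ) (hF0 : F ≠ 0)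
  (hrat : ∀ s, F s = 0 → ∃ (q : ℕ) (k : ℤ), 0 < q ∧ q * s = k)
include hF hF0 hrat

theorem exists_mem_nhds_hasRationalLowerBound (s₀ : ℝ) :
    ∃ U ∈ 𝓝 s₀, HasRationalLowerBound F U := by
  by_cases h0 : F s₀ = 0
  · obtain ⟨q, b, hq, hb⟩ := hrat s₀ h0
    obtain ⟨k, c, hc, hpow⟩ := exists_pow_mul_le_norm hF hF0 s₀
    refine ⟨_, hpow, q, k, c / q ^ k, hq, by positivity, fun s hs => le_trans ?_ hs⟩
    have hdist : distNearestInt (q * s) ≤ q * |s - s₀| := by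
      refine (distNearestInt_le _ b).trans_eq ?_
      rw [← hb, ← mul_sub, abs_mul, Nat.abs_cast]
    calc c / q ^ k * distNearestInt (q * s) ^ k ≤ c / q ^ k * (q * |s - s₀|) ^ k := by
          gcongr
          exact distNearestInt_nonneg _
      _ = c * |s - s₀| ^ k := by
          rw [mul_pow]
          field_simp
  · have hpos : 0 < ‖F s₀‖ := norm_pos_iff.2 h0
    refine ⟨_, (hF s₀ (Set.mem_univ _)).continuousAt.norm.eventually_const_lt (half_lt_self hpos),
      1, 0, ‖F s₀‖ / 2, one_pos, by positivity, fun s hs => ?_⟩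
    rw [pow_zero, mul_one]
    exact le_of_lt hs

theorem hasRationalLowerBound_univ (hp : Function.Periodic F 1) :
    HasRationalLowerBound F Set.univ := by
  have hIcc : HasRationalLowerBound F (Set.Icc 0 1) :=
    isCompact_Icc.induction_on ⟨1, 0, 1, one_pos, one_pos, by simp⟩
      (fun _ _ hUV hV => hV.mono hUV) (fun _ _ hU hV => hU.union hV) fun s₀ _ =>
        let ⟨U, hU, h⟩ := exists_mem_nhds_hasRationalLowerBound hF hF0 hrat s₀
        ⟨U, mem_nhdsWithin_of_mem_nhds hU, h⟩
  obtain ⟨q, k, c, hq, hc, h⟩ := hIcc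
  refine ⟨q, k, c, hq, hc, fun s _ => ?_⟩
  have hfract {E : Type} {u : ℝ → E} (hu : Function.Periodic u 1) : u (Int.fract s) = u s := by
    simpa [Int.self_sub_floor] using hu.sub_int_mul_eq (x := s) ⌊s⌋
  rw [← hfract hp, ← hfract (periodic_distNearestInt_natCast_mul q)]
  exact h _ ⟨Int.fract_nonneg s, (Int.fract_lt_one s).le⟩

theorem exists_mul_rpow_neg_le_norm_natCast_mul (hp : Function.Periodic F 1) {t : ℝ}
    (ht : IsDiophantine t) :
    ∃ b A : ℝ, 0 < b ∧ 0 ≤ A ∧ ∀ m : ℕ, 1 ≤ m → b * (m : ℝ) ^ (-A) ≤ ‖F (m * t)‖ := by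
  obtain ⟨K, γ, hK, hγ, ht⟩ := ht
  obtain ⟨q, k, c, hq, hc, h⟩ := hasRationalLowerBound_univ hF hF0 hrat hp
  refine ⟨c * (K / q ^ γ) ^ k, γ * k, by positivity, by positivity, fun m hm => ?_⟩
  have hdist : K / ((q : ℝ) ^ γ * (m : ℝ) ^ γ) ≤ distNearestInt (q * (m * t)) := by
    have := (ht ((q * m : ℕ) : ℤ) (by positivity)).le
    rwa [Int.cast_natCast, Nat.abs_cast, Nat.cast_mul,
      Real.mul_rpow q.cast_nonneg m.cast_nonneg, mul_assoc] at this
  calc c * (K / (q : ℝ) ^ γ) ^ k * (m : ℝ) ^ (-(γ * k))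
      = c * (K / ((q : ℝ) ^ γ * (m : ℝ) ^ γ)) ^ k := by
        rw [Real.rpow_neg m.cast_nonneg, Real.rpow_mul m.cast_nonneg, Real.rpow_natCast,
          ← div_div, div_pow (K / (q : ℝ) ^ γ), ← div_eq_mul_inv, mul_div_assoc]
    _ ≤ c * distNearestInt (q * (m * t)) ^ k := by gcongr
    _ ≤ ‖F (m * t)‖ := h _ (Set.mem_univ _)

end AnalyticRational

end RationalLowerBound

/-! ### The logarithm of a periodic analytic function -/

theorem exists_norm_log_le_rpow_neg {M ε : ℝ} (hM : 0 < M) (hε : 0 < ε) :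
    ∃ C : ℝ, 0 ≤ C ∧ ∀ (z : ℂ) (r : ℝ), 0 < r → r ≤ ‖z‖ → ‖z‖ ≤ M →
      ‖Complex.log z‖ ≤ C * r ^ (-ε) := by
  refine ⟨(|Real.log M| + Real.pi) * M ^ ε + 1 / ε, by positivity, fun z r hr hrz hzM => ?_⟩
  have hz : 0 < ‖z‖ := hr.trans_le hrz
  have hre : |Real.log ‖z‖| ≤ |Real.log M| + r ^ (-ε) / ε := by
    have hinv : -Real.log r ≤ r ^ (-ε) / ε := by
      rw [← Real.log_inv, Real.rpow_neg hr.le, ← Real.inv_rpow hr.le]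
      exact Real.log_le_rpow_div (by positivity) hε
    have hmax := (Real.log_le_log hz hzM).trans (le_abs_self _)
    have hmin := Real.log_le_log hr hrz
    have hnonneg : 0 ≤ r ^ (-ε) / ε := by positivity
    rw [abs_le]
    constructor <;> linarith [abs_nonneg (Real.log M)]
  have hone : 1 ≤ M ^ ε * r ^ (-ε) := by
    rw [Real.rpow_neg hr.le, ← div_eq_mul_inv, one_le_div (by positivity)]
    exact Real.rpow_le_rpow hr.le (hrz.trans hzM) hε.le
  calc ‖Complex.log z‖ ≤ |(Complex.log z).re| + |(Complex.log z).im| :=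
        Complex.norm_le_abs_re_add_abs_im _
    _ ≤ |Real.log M| + r ^ (-ε) / ε + Real.pi := by
        rw [Complex.log_re, Complex.log_im]
        exact add_le_add hre (Complex.abs_arg_le_pi z)
    _ = (|Real.log M| + Real.pi) * 1 + r ^ (-ε) / ε := by ring
    _ ≤ (|Real.log M| + Real.pi) * (M ^ ε * r ^ (-ε)) + r ^ (-ε) / ε := by gcongr
    _ = ((|Real.log M| + Real.pi) * M ^ ε + 1 / ε) * r ^ (-ε) := by ring

theorem hasDerivAt_log_of_im_eq_zero {F : ℝ → ℂ} {F' : ℂ} {s : ℝ} (hF : HasDerivAt F F' s)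
    (hs : F s ≠ 0) (him : ∀ u, (F u).im = 0) :
    HasDerivAt (fun u => Complex.log (F u)) (F' / F s) s := by
  by_cases hslit : F s ∈ Complex.slitPlane
  · exact hF.clog_real hslit
  have hneg : (F s).re < 0 := by
    rw [Complex.mem_slitPlane_iff, not_or] at hslit
    exact lt_of_le_of_ne (not_lt.1 hslit.1) fun h => hs (Complex.ext h (him s))
  have hlog : (fun u => Complex.log (F u)) =ᶠ[𝓝 s]
      fun u => Complex.log (-F u) + Real.pi * Complex.I := by
    filter_upwards [(Complex.continuous_re.continuousAt.comp hF.continuousAt).eventually_lt_const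
      hneg] with u hu
    have hreal : -F u = ((-(F u).re : ℝ) : ℂ) := Complex.ext (by simp) (by simp [him u])
    have hpos : 0 < -(F u).re := neg_pos.2 hu
    calc Complex.log (F u) = Complex.log ((-(F u).re : ℝ) * -1) := by
          rw [← hreal, neg_mul_neg, mul_one]
      _ = Complex.log (-F u) + Real.pi * Complex.I := by
          rw [Complex.log_ofReal_mul hpos (by simp), Complex.ofReal_log hpos.le, hreal,
            Complex.log_neg_one]
  have hderiv := (hF.neg.clog_real (Or.inl (by simpa using hneg))).add_const
    (Real.pi * Complex.I : ℂ)
  rw [Pi.neg_apply, neg_div_neg_eq] at hderiv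
  exact hderiv.congr_of_eventuallyEq hlog

theorem norm_log_sub_log_le {F : ℝ → ℂ} (hF : Differentiable ℝ F) {M r y z : ℝ}
    (hM : ∀ s, ‖deriv F s‖ ≤ M) (hr : 0 < r) (hlow : ∀ w ∈ Set.uIcc y z, r ≤ ‖F w‖)
    (him : (∀ u, (F u).im = 0) ∨ ∀ w ∈ Set.uIcc y z, (F w).im ≠ 0) :
    ‖Complex.log (F y) - Complex.log (F z)‖ ≤ M / r * |y - z| := by
  have hderiv (w : ℝ) (hw : w ∈ Set.uIcc y z) :
      HasDerivAt (fun u => Complex.log (F u)) (deriv F w / F w) w := by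
    rcases him with him | him
    · exact hasDerivAt_log_of_im_eq_zero hF.differentiableAt.hasDerivAt
        (norm_pos_iff.1 (hr.trans_le (hlow w hw))) him
    · exact hF.differentiableAt.hasDerivAt.clog_real
        (Complex.mem_slitPlane_iff.2 (Or.inr (him w hw)))
  rw [← Real.norm_eq_abs]
  refine (convex_uIcc y z).norm_image_sub_le_of_norm_hasDerivWithin_le
    (fun w hw => (hderiv w hw).hasDerivWithinAt) (fun w hw => ?_)
    Set.right_mem_uIcc Set.left_mem_uIcc
  rw [norm_div]
  exact div_le_div₀ ((norm_nonneg _).trans (hM 0)) (hM w) hr (hlow w hw)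

section TameLog

variable {F G : ℝ → ℂ} (hF : AnalyticOnNhd ℝ F Set.univ) (hp : Function.Periodic F 1)
include hF hp

theorem isSubpoly_clm_log (hF0 : F ≠ 0)
    (hrat : ∀ s, F s = 0 → ∃ (q : ℕ) (k : ℤ), 0 < q ∧ q * s = k) {t : ℝ} (ht : IsDiophantine t)
    (φ : ℂ →L[ℝ] ℝ) : IsSubpoly (fun m => φ (Complex.log (F (m * t)))) := by
  obtain ⟨M, hM0, hM⟩ := exists_norm_le_of_periodic hp (hF.contDiff (n := ω)).continuous
  obtain ⟨b, A, hb, hA, hlow⟩ := exists_mul_rpow_neg_le_norm_natCast_mul hF hF0 hrat hp ht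
  intro ε hε
  obtain ⟨C, hC, hlog⟩ := exists_norm_log_le_rpow_neg hM0 (ε := ε / (A + 1)) (by positivity)
  refine ⟨‖φ‖ * (C * b ^ (-(ε / (A + 1)))), fun m hm => ?_⟩
  have hm1 : (1 : ℝ) ≤ m := by exact_mod_cast hm
  have hexp : A * (ε / (A + 1)) ≤ ε := by
    rw [mul_div_left_comm]
    exact mul_le_of_le_one_right hε.le ((div_le_one (by positivity)).2 (by linarith))
  calc |φ (Complex.log (F (m * t)))| ≤ ‖φ‖ * ‖Complex.log (F (m * t))‖ := φ.le_opNorm _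
    _ ≤ ‖φ‖ * (C * (b * (m : ℝ) ^ (-A)) ^ (-(ε / (A + 1)))) := by
        gcongr
        exact hlog _ _ (by positivity) (hlow m hm) (hM _)
    _ = ‖φ‖ * (C * b ^ (-(ε / (A + 1)))) * (m : ℝ) ^ (A * (ε / (A + 1))) := by
        rw [Real.mul_rpow hb.le (by positivity), ← Real.rpow_mul m.cast_nonneg, neg_mul_neg]
        ring
    _ ≤ ‖φ‖ * (C * b ^ (-(ε / (A + 1)))) * (m : ℝ) ^ ε := by gcongr

/-- The principal logarithm jumps across the negative real axis, so the gauge of `log ∘ F` has to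
vanish where `F` crosses it; the imaginary part of `F` does so unless it is identically zero, in
which case `F` does not cross. -/
theorem exists_analyticOnNhd_im_ne_zero (hF0 : F ≠ 0) :
    ∃ G : ℝ → ℂ, AnalyticOnNhd ℝ G Set.univ ∧ Function.Periodic G 1 ∧ F * G ≠ 0 ∧
      ((∀ u, (F u).im = 0) ∨ ∀ w, G w ≠ 0 → (F w).im ≠ 0) := by
  by_cases him : ∀ u, (F u).im = 0
  · exact ⟨1, analyticOnNhd_const, fun _ => rfl, by rwa [mul_one], Or.inl him⟩
  have hIm : AnalyticOnNhd ℝ (fun u => ((F u).im : ℂ)) Set.univ := fun x hx =>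
    (Complex.ofRealCLM.analyticAt _).comp ((Complex.imCLM.analyticAt _).comp (hF x hx))
  refine ⟨fun u => (F u).im, hIm, fun s => by simp only [hp s], fun hmul => ?_,
    Or.inr fun w hw => by simpa using hw⟩
  rcases AnalyticOnNhd.eq_zero_or_eq_zero_of_mul_eq_zero hF hIm (fun z _ => congrFun hmul z)
    isPreconnected_univ with h | h
  · exact hF0 (funext fun s => h s (Set.mem_univ s))
  · exact him fun u => by simpa using h u (Set.mem_univ u)

theorem isTame_clm_log (hG : Continuous G) (hGp : Function.Periodic G 1)
    (him : (∀ u, (F u).im = 0) ∨ ∀ w, G w ≠ 0 → (F w).im ≠ 0) (φ : ℂ →L[ℝ] ℝ) :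
    IsTame (fun s => ‖F s * G s‖) (fun s => φ (Complex.log (F s))) := by
  have hFd : ContDiff ℝ ω F := hF.contDiff
  obtain ⟨M, hM0, hM⟩ := exists_norm_le_of_periodic hp hFd.continuous
  obtain ⟨M', hM'0, hM'⟩ := exists_norm_le_of_periodic hGp hG
  obtain ⟨D, hD0, hD⟩ := exists_norm_le_of_periodic (periodic_deriv hp)
    (hFd.continuous_deriv (by simp))
  have hlow (s : ℝ) : ‖F s * G s‖ / M' ≤ ‖F s‖ := by
    rw [norm_mul, div_le_iff₀ hM'0]
    exact mul_le_mul_of_nonneg_left (hM' s) (norm_nonneg _)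
  refine ⟨fun s => by simp only [hp s],
    φ.measurable.comp (Complex.measurable_log.comp hFd.continuous.measurable), fun ε hε => ?_, ?_⟩
  · obtain ⟨C, hC, hlog⟩ := exists_norm_log_le_rpow_neg hM0 hε
    refine ⟨‖φ‖ * (C * M' ^ ε), by positivity, fun s hs => ?_⟩
    calc |φ (Complex.log (F s))| ≤ ‖φ‖ * ‖Complex.log (F s)‖ := φ.le_opNorm _
      _ ≤ ‖φ‖ * (C * (‖F s * G s‖ / M') ^ (-ε)) := by
          gcongr
          exact hlog _ _ (by positivity) (hlow s) (hM s)
      _ = ‖φ‖ * (C * M' ^ ε) * ‖F s * G s‖ ^ (-ε) := by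
          rw [Real.div_rpow hs.le hM'0.le, Real.rpow_neg hM'0.le, div_inv_eq_mul]
          ring
  · refine ⟨‖φ‖ * (D * M'), 1, by positivity, fun ρ hρ _ y z hyz => ?_⟩
    have hlog := norm_log_sub_log_le (hFd.differentiable (by simp)) hD
      (by positivity : 0 < ρ / M') (y := y) (z := z)
      (fun w hw => (div_le_div_of_nonneg_right (hyz w hw) hM'0.le).trans (hlow w))
      (him.imp_right fun h w hw => h w
        (right_ne_zero_of_mul (norm_pos_iff.1 (hρ.trans_le (hyz w hw)))))
    rw [← map_sub]
    calc |φ (Complex.log (F y) - Complex.log (F z))|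
        ≤ ‖φ‖ * ‖Complex.log (F y) - Complex.log (F z)‖ := φ.le_opNorm _
      _ ≤ ‖φ‖ * (D / (ρ / M') * |y - z|) := by gcongr
      _ = ‖φ‖ * (D * M') * ρ⁻¹ ^ 1 * |y - z| := by field_simp

theorem exists_isGauge_isTame_clm_log (hF0 : F ≠ 0) :
    ∃ Q, IsGauge Q ∧ ∀ φ : ℂ →L[ℝ] ℝ, IsTame Q (fun s => φ (Complex.log (F s))) := by
  obtain ⟨G, hG, hGp, hFG, him⟩ := exists_analyticOnNhd_im_ne_zero hF hp hF0
  exact ⟨_, isGauge_norm (hF.mul hG) hFG (hp.mul hGp),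
    isTame_clm_log hF hp (hG.contDiff (n := ω)).continuous hGp him⟩

end TameLog

/-! ### Reduction of the complex limit theorem to characteristic functions -/

theorem prod_map_parts_partition_eq_exp {n : ℕ} (σ : Equiv.Perm (Fin n)) (c : ℕ → ℝ) (α : ℝ) :
    (σ.partition.parts.map (phaseWeight c α)).prod
      = Complex.exp (((α * ∑ m ∈ Finset.Icc 1 n, (cycleCount σ m : ℝ) * c m : ℝ) : ℂ)
          * Complex.I) := by
  have hsub : σ.partition.parts.toFinset ⊆ Finset.Icc 1 n := fun m hm => by
    rw [Multiset.mem_toFinset] at hm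
    refine Finset.mem_Icc.2 ⟨σ.partition.parts_pos hm, ?_⟩
    have := Multiset.single_le_sum (fun _ _ => Nat.zero_le _) _ hm
    rwa [σ.partition.parts_sum, Fintype.card_fin] at this
  rw [Finset.prod_multiset_map_count, Finset.prod_subset hsub fun m _ hm => by
      rw [Multiset.count_eq_zero_of_notMem (mt Multiset.mem_toFinset.2 hm), pow_zero],
    Finset.mul_sum, Complex.ofReal_sum, Finset.sum_mul, Complex.exp_sum]
  refine Finset.prod_congr rfl fun m _ => ?_
  rw [phaseWeight, ← Complex.exp_nat_mul, cycleCount]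
  congr 1
  push_cast
  ring

theorem integral_ewensMeasure {θ : ℝ} (hθ : 0 < θ) (n : ℕ) (g : Equiv.Perm (Fin n) → ℂ) :
    ∫ σ, g σ ∂(ewensMeasure θ hθ n) = ∑ σ, (ewensWeight θ σ : ℂ) * g σ := by
  have hnonneg (σ : Equiv.Perm (Fin n)) : 0 ≤ ewensWeight θ σ :=
    div_nonneg (pow_nonneg hθ.le _) (Finset.prod_nonneg fun i _ => by positivity)
  rw [ewensMeasure, integral_finsetSum_measure fun σ _ =>
    (Integrable.of_finite (μ := Measure.dirac σ)).smul_measure ENNReal.ofReal_ne_top]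
  refine Finset.sum_congr rfl fun σ _ => ?_
  rw [integral_smul_measure, integral_dirac, ENNReal.toReal_ofReal (hnonneg σ),
    Complex.real_smul]

/-- The mean of `⟪ξ, z⟫ ^ 2`, when `‖z‖ ^ 2` has mean `A` and `z ^ 2` has mean `B`. -/
noncomputable def secondMoment (A : ℝ) (B ξ : ℂ) : ℝ :=
  (‖ξ‖ ^ 2 * A + inner ℝ (ξ ^ 2) B) / 2

theorem inner_sq_eq_secondMoment (ξ z : ℂ) :
    inner ℝ ξ z ^ 2 = secondMoment (‖z‖ ^ 2) (z ^ 2) ξ := by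
  simp only [secondMoment, Complex.inner, Complex.sq_norm, Complex.normSq_apply]
  simp only [sq, Complex.mul_re, Complex.mul_im, Complex.conj_re, Complex.conj_im]
  ring

theorem secondMoment_smul (r A : ℝ) (B ξ : ℂ) :
    secondMoment (r * A) (r • B) ξ = r * secondMoment A B ξ := by
  rw [secondMoment, secondMoment, inner_smul_right]
  ring

theorem secondMoment_eq (A : ℝ) (B ξ : ℂ) :
    secondMoment A B ξ = ξ.re ^ 2 * ((A + B.re) / 2) + 2 * (ξ.re * ξ.im) * (B.im / 2)
      + ξ.im ^ 2 * ((A - B.re) / 2) := by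
  simp only [secondMoment, Complex.inner, Complex.sq_norm, Complex.normSq_apply]
  simp only [sq, Complex.mul_re, Complex.mul_im, Complex.conj_re, Complex.conj_im]
  ring

theorem exists_isGaussian_charFun_eq {A : ℝ} {B : ℂ} (hnn : ∀ ξ, 0 ≤ secondMoment A B ξ) :
    ∃ N : Measure ℂ, ∃ _ : IsGaussian N,
      (∀ ξ, charFun N ξ = Complex.exp ((-(secondMoment A B ξ / 2) : ℝ) : ℂ)) ∧
      cov[Complex.re, Complex.im; N] = B.im / 2 := by
  let S : Matrix (Fin 2) (Fin 2) ℝ := !![(A + B.re) / 2, B.im / 2; B.im / 2, (A - B.re) / 2]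
  have hform (v : Fin 2 → ℝ) : v ⬝ᵥ S.mulVec v = secondMoment A B ⟨v 0, v 1⟩ := by
    simp only [secondMoment_eq, S, Matrix.mulVec, dotProduct, Fin.sum_univ_two, Matrix.of_apply,
      Matrix.cons_val_zero, Matrix.cons_val_one]
    ring
  have hS : S.PosSemidef := by
    refine Matrix.PosSemidef.of_dotProduct_mulVec_nonneg ?_ fun v => ?_
    · ext i j
      fin_cases i <;> fin_cases j <;> simp [S]
    · rw [star_trivial, hform]
      exact hnn _
  let e := Complex.orthonormalBasisOneI.repr.symm
  refine ⟨(multivariateGaussian 0 S).map e,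
    isGaussian_map (e : EuclideanSpace ℝ (Fin 2) →L[ℝ] ℂ), fun ξ => ?_, ?_⟩
  · have hadj (v : EuclideanSpace ℝ (Fin 2)) : inner ℝ (e v) ξ = inner ℝ v (e.symm ξ) := by
      rw [← e.inner_map_map v, e.apply_symm_apply]
    rw [charFun_apply, integral_map (by fun_prop) (by fun_prop)]
    simp_rw [hadj]
    rw [← charFun_apply, charFun_multivariateGaussian hS, hform]
    simp [e]
  · have hre : Complex.re ∘ e = fun v => v 0 := funext fun v => by simp [e]
    have him : Complex.im ∘ e = fun v => v 1 := funext fun v => by simp [e]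
    rw [covariance_map (by fun_prop) (by fun_prop) (by fun_prop), hre, him,
      covariance_eval_multivariateGaussian hS 0 1]
    simp [S]

theorem indepFun_re_im_iff_covariance_eq_zero (N : Measure ℂ) [IsGaussian N] :
    IndepFun Complex.re Complex.im N ↔ cov[Complex.re, Complex.im; N] = 0 := by
  have hlaw : HasGaussianLaw (fun z : ℂ => (z.re, z.im)) N :=
    (IsGaussian.hasGaussianLaw_id (μ := N)).map_fun (Complex.equivRealProdCLM : ℂ →L[ℝ] ℝ × ℝ)
  exact ⟨fun hind => hind.covariance_eq_zero hlaw.fst.memLp_two hlaw.snd.memLp_two,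
    hlaw.indepFun_of_covariance_eq_zero⟩

section Complex

variable {θ : ℝ} (hθ : 0 < θ) (a : ℕ → ℂ) (μ : ℂ)

theorem charFun_map_sum_cycleCount_mul (n : ℕ) (ξ : ℂ) :
    charFun ((ewensMeasure θ hθ n).map fun σ =>
      (∑ m ∈ Finset.Icc 1 n, (cycleCount σ m : ℂ) * a m) / (√(Real.log n) : ℂ)
        - (θ : ℂ) * (√(Real.log n) : ℂ) * μ) ξ
      = Complex.exp (((-(1 * θ * inner ℝ ξ μ * √(Real.log n)) : ℝ) : ℂ) * Complex.I)
        * ewensMean θ (phaseWeight (fun m => inner ℝ ξ (a m)) (1 / √(Real.log n))) n := by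
  set L := √(Real.log n)
  rw [charFun_apply, integral_map AEMeasurable.of_discrete (by fun_prop), integral_ewensMeasure,
    ewensMean, Finset.mul_sum]
  refine Finset.sum_congr rfl fun σ _ => ?_
  have hsum : (∑ m ∈ Finset.Icc 1 n, (cycleCount σ m : ℂ) * a m) / (L : ℂ) - (θ : ℂ) * (L : ℂ) * μ
      = (1 / L) • (∑ m ∈ Finset.Icc 1 n, (cycleCount σ m : ℝ) • a m) - (θ * L) • μ := by
    simp only [Complex.real_smul]
    push_cast
    ring
  have hinner : inner ℝ ((∑ m ∈ Finset.Icc 1 n, (cycleCount σ m : ℂ) * a m) / (L : ℂ)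
        - (θ : ℂ) * (L : ℂ) * μ) ξ
      = -(1 * θ * inner ℝ ξ μ * L)
        + 1 / L * ∑ m ∈ Finset.Icc 1 n, (cycleCount σ m : ℝ) * inner ℝ ξ (a m) := by
    rw [real_inner_comm, hsum, inner_sub_right, inner_smul_right, inner_smul_right, inner_sum]
    simp only [inner_smul_right]
    ring
  rw [prod_map_parts_partition_eq_exp, mul_left_comm, ← Complex.exp_add, ← add_mul,
    ← Complex.ofReal_add, hinner]

variable {a μ}

theorem exists_tendstoInDistribution_of_hasCycleMoments {A : ℝ} {B : ℂ}
    (h : ∀ ξ : ℂ, HasCycleMoments (fun m => inner ℝ ξ (a m)) (inner ℝ ξ μ) (secondMoment A B ξ)) :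
    ∃ N : Measure ℂ, ∃ _ : IsGaussian N,
      TendstoInDistribution (fun (n : ℕ) (σ : Equiv.Perm (Fin n)) =>
        (∑ m ∈ Finset.Icc 1 n, (cycleCount σ m : ℂ) * a m) / (√(Real.log n) : ℂ)
          - (θ : ℂ) * (√(Real.log n) : ℂ) * μ) atTop id (ewensMeasure θ hθ) N ∧
      cov[Complex.re, Complex.im; N] = θ / 2 * B.im ∧
      (IndepFun Complex.re Complex.im N ↔ cov[Complex.re, Complex.im; N] = 0) := by
  obtain ⟨N, hN, hchar, hcov⟩ := exists_isGaussian_charFun_eq (A := θ * A) (B := θ • B) fun ξ => by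
    rw [secondMoment_smul]
    exact mul_nonneg hθ.le ((sq_nonneg _).trans (h ξ).sq_le)
  refine ⟨N, hN, ⟨fun n => AEMeasurable.of_discrete, aemeasurable_id, ?_⟩, ?_,
    indepFun_re_im_iff_covariance_eq_zero N⟩
  · refine ProbabilityMeasure.tendsto_iff_tendsto_charFun.2 fun ξ => ?_
    simp only [ProbabilityMeasure.coe_mk, Measure.map_id, charFun_map_sum_cycleCount_mul]
    have hlim := tendsto_exp_mul_ewensMean hθ 1 (h ξ)
    rwa [one_pow, mul_one, ← secondMoment_smul, ← hchar] at hlim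
  · rw [hcov, Complex.smul_im, smul_eq_mul]
    ring

end Complex

/-! ### The limit theorem at a root of unity -/

section Periodic

variable {c : ℕ → ℝ} {p : ℕ} (hp : 0 < p) (hc : Function.Periodic c p)
include hp hc

theorem abs_le_sum_of_periodic (m : ℕ) : |c m| ≤ ∑ j ∈ Finset.range p, |c j| := by
  rw [← hc.map_mod_nat m]
  exact Finset.single_le_sum (f := fun j => |c j|) (fun j _ => abs_nonneg _)
    (Finset.mem_range.2 (Nat.mod_lt m hp))

theorem isSubpoly_of_periodic : IsSubpoly c := fun ε hε =>
  ⟨∑ j ∈ Finset.range p, |c j|, fun m hm => (abs_le_sum_of_periodic hp hc m).trans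
    (le_mul_of_one_le_right (Finset.sum_nonneg fun j _ => abs_nonneg _)
      (Real.one_le_rpow (by exact_mod_cast hm) hε.le))⟩

theorem periodic_sum_Icc_sub_mul_mean :
    Function.Periodic (fun N : ℕ => ∑ m ∈ Finset.Icc 1 N, c m
      - N * (1 / (p : ℝ) * ∑ m ∈ Finset.Icc 1 p, c m)) p := fun N => by
  induction N with
  | zero => simp [hp.ne']
  | succ N ih =>
    simp only at ih
    simp only [add_right_comm N 1 p, Finset.sum_Icc_succ_top (Nat.le_add_left 1 _)]
    rw [← add_right_comm N 1 p, hc]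
    push_cast at ih ⊢
    linarith

theorem hasPowerMean_of_periodic : HasPowerMean c (1 / p * ∑ m ∈ Finset.Icc 1 p, c m) :=
  have hperiodic := periodic_sum_Icc_sub_mul_mean hp hc
  ⟨1 / 2, _, by norm_num, by norm_num, fun N hN =>
    (abs_le_sum_of_periodic hp hperiodic N).trans
      (le_mul_of_one_le_right (Finset.sum_nonneg fun j _ => abs_nonneg _)
        (Real.one_le_rpow (by exact_mod_cast hN) (by norm_num)))⟩

end Periodic

theorem hasCycleMoments_inner_of_periodic {a : ℕ → ℂ} {p : ℕ} (hp : 0 < p)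
    (ha : Function.Periodic a p) (ξ : ℂ) :
    HasCycleMoments (fun m => inner ℝ ξ (a m))
      (inner ℝ ξ ((1 / (p : ℂ)) * ∑ m ∈ Finset.Icc 1 p, a m))
      (secondMoment (1 / p * ∑ m ∈ Finset.Icc 1 p, ‖a m‖ ^ 2)
        ((1 / (p : ℂ)) * ∑ m ∈ Finset.Icc 1 p, a m ^ 2) ξ) := by
  have hsmul (z : ℂ) : 1 / (p : ℂ) * z = (1 / (p : ℝ)) • z := by
    rw [Complex.real_smul]
    push_cast
    rfl
  have hmean (u : ℂ → ℝ) := hasPowerMean_of_periodic hp (ha.comp u)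
  refine ⟨?_, ?_, ⟨_, hmean fun z => inner ℝ ξ z ^ 4⟩,
    isSubpoly_of_periodic hp (ha.comp (inner ℝ ξ))⟩
  · rw [hsmul, inner_smul_right, inner_sum]
    exact hmean (inner ℝ ξ)
  · have hsum : ∑ m ∈ Finset.Icc 1 p, inner ℝ ξ (a m) ^ 2
        = secondMoment (∑ m ∈ Finset.Icc 1 p, ‖a m‖ ^ 2) (∑ m ∈ Finset.Icc 1 p, a m ^ 2) ξ := by
      simp only [inner_sq_eq_secondMoment, secondMoment, inner_sum, Finset.mul_sum,
        ← Finset.sum_add_distrib, Finset.sum_div]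
    rw [hsmul, secondMoment_smul, ← hsum]
    exact hmean fun z => inner ℝ ξ z ^ 2

theorem exists_tendstoInDistribution_of_isOfFinOrder {θ : ℝ} (hθ : 0 < θ) (f : Circle → ℂ)
    {x : Circle} (hx : IsOfFinOrder x) :
    ∃ N : Measure ℂ, ∃ _ : IsGaussian N,
      TendstoInDistribution (normalizedLog θ f x) atTop id (ewensMeasure θ hθ) N ∧
      cov[Complex.re, Complex.im; N] = θ / 2 * ((1 / (orderOf x : ℂ)) *
        ∑ m ∈ Finset.Icc 1 (orderOf x), Complex.log (f (x ^ m)) ^ 2).im ∧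
      (IndepFun Complex.re Complex.im N ↔ cov[Complex.re, Complex.im; N] = 0) := by
  have hperiodic : Function.Periodic (fun m => Complex.log (f (x ^ m))) (orderOf x) := fun m => by
    simp only [pow_add, pow_orderOf_eq_one, mul_one]
  have hnormalized : normalizedLog θ f x = fun n σ => _ :=
    funext₂ fun n σ => by rw [normalizedLog, logClassFun, logMahler, if_pos hx]
  rw [hnormalized]
  exact exists_tendstoInDistribution_of_hasCycleMoments hθ
    (hasCycleMoments_inner_of_periodic hx.orderOf_pos hperiodic)

/-! ### The limit theorem at a point of finite type -/

section Tame

variable {Q : ℝ → ℝ} {g : ℝ → ℂ} (hQ : IsGauge Q) (hg : ∀ φ : ℂ →L[ℝ] ℝ, IsTame Q fun s => φ (g s))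
include hQ hg

theorem intervalIntegrable_of_isTame_clm : IntervalIntegrable g volume 0 1 := by
  have hre : IntervalIntegrable (fun s => (g s).re) volume 0 1 :=
    (hg Complex.reCLM).intervalIntegrable hQ
  have him : IntervalIntegrable (fun s => (g s).im) volume 0 1 :=
    (hg Complex.imCLM).intervalIntegrable hQ
  exact ⟨Integrable.re_im_iff.1 ⟨hre.1, him.1⟩, Integrable.re_im_iff.1 ⟨hre.2, him.2⟩⟩

theorem intervalIntegrable_norm_sq_of_isTame_clm :
    IntervalIntegrable (fun s => ‖g s‖ ^ 2) volume 0 1 := by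
  have hre := hg Complex.reCLM
  have him := hg Complex.imCLM
  simpa only [Complex.sq_norm, Complex.normSq_apply, Complex.reCLM_apply,
    Complex.imCLM_apply] using
    ((hre.mul hre).intervalIntegrable hQ).add ((him.mul him).intervalIntegrable hQ)

theorem intervalIntegrable_sq_of_isTame_clm :
    IntervalIntegrable (fun s => g s ^ 2) volume 0 1 := by
  have hmeas := (intervalIntegrable_of_isTame_clm hQ hg).aestronglyMeasurable_restrict_uIoc
  exact (intervalIntegrable_norm_sq_of_isTame_clm hQ hg).mono_fun (hmeas.pow 2)
    (.of_forall fun s => by simp)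

theorem hasCycleMoments_inner_of_isTame_clm {t : ℝ} (ht : IsDiophantine t)
    (hsub : ∀ φ : ℂ →L[ℝ] ℝ, IsSubpoly fun m => φ (g (m * t))) (ξ : ℂ) :
    HasCycleMoments (fun m => inner ℝ ξ (g (m * t))) (inner ℝ ξ (∫ s in (0 : ℝ)..1, g s))
      (secondMoment (∫ s in (0 : ℝ)..1, ‖g s‖ ^ 2) (∫ s in (0 : ℝ)..1, g s ^ 2) ξ) := by
  have htame : IsTame Q fun s => inner ℝ ξ (g s) := hg (innerSL ℝ ξ)
  have hsubpoly : IsSubpoly fun m => inner ℝ ξ (g (m * t)) := hsub (innerSL ℝ ξ)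
  have hpow {k : ℕ} (hk : k ≠ 0) := (htame.pow hk).hasPowerMean hQ ht (hsubpoly.pow hk)
  have hinner {h : ℝ → ℂ} (hh : IntervalIntegrable h volume 0 1) (ζ : ℂ) :
      ∫ s in (0 : ℝ)..1, inner ℝ ζ (h s) = inner ℝ ζ (∫ s in (0 : ℝ)..1, h s) :=
    (innerSL ℝ ζ).intervalIntegral_comp_comm hh
  have hsq := intervalIntegrable_sq_of_isTame_clm hQ hg
  have hproj : IntervalIntegrable (fun s => inner ℝ (ξ ^ 2) (g s ^ 2)) volume 0 1 :=
    ⟨(innerSL ℝ (ξ ^ 2)).integrable_comp hsq.1, (innerSL ℝ (ξ ^ 2)).integrable_comp hsq.2⟩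
  have hsecond : ∫ s in (0 : ℝ)..1, inner ℝ ξ (g s) ^ 2
      = secondMoment (∫ s in (0 : ℝ)..1, ‖g s‖ ^ 2) (∫ s in (0 : ℝ)..1, g s ^ 2) ξ := by
    simp only [inner_sq_eq_secondMoment, secondMoment]
    rw [intervalIntegral.integral_div, intervalIntegral.integral_add
      ((intervalIntegrable_norm_sq_of_isTame_clm hQ hg).const_mul _) hproj,
      intervalIntegral.integral_const_mul, hinner hsq]
  refine ⟨?_, ?_, ⟨_, hpow four_ne_zero⟩, hsubpoly⟩
  · rw [← hinner (intervalIntegrable_of_isTame_clm hQ hg)]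
    exact htame.hasPowerMean hQ ht hsubpoly
  · rw [← hsecond]
    exact hpow two_ne_zero

end Tame

theorem periodic_comp_circleExp (f : Circle → ℂ) :
    Function.Periodic (fun s : ℝ => f (Circle.exp (2 * Real.pi * s))) 1 := fun s => by
  simp only [mul_add, mul_one, Circle.exp_add_two_pi]

theorem RealAnalyticOnCircle.analyticOnNhd {f : Circle → ℂ} (hf : RealAnalyticOnCircle f) :
    AnalyticOnNhd ℝ (fun s : ℝ => f (Circle.exp (2 * Real.pi * s))) Set.univ := by
  have h : ContDiff ℝ ω (fun s : ℝ => f (Circle.exp s)) :=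
    contMDiff_iff_contDiff.1 (hf.comp contMDiff_circleExp)
  exact contDiff_omega_iff_analyticOnNhd.1 (h.comp (contDiff_const.mul contDiff_id))

theorem exists_mul_eq_of_isOfFinOrder_circleExp {s : ℝ}
    (h : IsOfFinOrder (Circle.exp (2 * Real.pi * s))) : ∃ (q : ℕ) (k : ℤ), 0 < q ∧ q * s = k := by
  obtain ⟨q, hq, hpow⟩ := isOfFinOrder_iff_pow_eq_one.1 h
  rw [← Circle.exp_natCast_mul, Circle.exp_eq_one] at hpow
  obtain ⟨k, hk⟩ := hpow
  refine ⟨q, k, hq, mul_right_cancel₀ Real.two_pi_pos.ne' ?_⟩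
  rw [← hk]
  ring

theorem exists_tendstoInDistribution_of_isFiniteType {θ : ℝ} (hθ : 0 < θ) {f : Circle → ℂ}
    (hf : RealAnalyticOnCircle f) {x : Circle} (hx : ¬ IsOfFinOrder x) (hxt : IsFiniteType x)
    (hz : ∀ z : Circle, f z = 0 → IsOfFinOrder z) :
    IntervalIntegrable (logOnCircle f) volume 0 1 ∧
    IntervalIntegrable (fun s => logOnCircle f s ^ 2) volume 0 1 ∧
    ∃ N : Measure ℂ, ∃ _ : IsGaussian N,
      TendstoInDistribution (normalizedLog θ f x) atTop id (ewensMeasure θ hθ) N ∧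
      cov[Complex.re, Complex.im; N] = θ / 2 * (∫ s in (0 : ℝ)..1, logOnCircle f s ^ 2).im ∧
      (IndepFun Complex.re Complex.im N ↔ cov[Complex.re, Complex.im; N] = 0) := by
  obtain ⟨t, rfl, ht⟩ := hxt
  have hperiodic := periodic_comp_circleExp f
  have hne : (fun s : ℝ => f (Circle.exp (2 * Real.pi * s))) ≠ 0 :=
    fun h => hx (hz _ (congrFun h t))
  obtain ⟨Q, hQ, htame⟩ := exists_isGauge_isTame_clm_log hf.analyticOnNhd hperiodic hne
  have hsub := isSubpoly_clm_log hf.analyticOnNhd hperiodic hne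
    (fun s hs => exists_mul_eq_of_isOfFinOrder_circleExp (hz _ hs)) ht
  refine ⟨intervalIntegrable_of_isTame_clm hQ htame,
    intervalIntegrable_sq_of_isTame_clm hQ htame, ?_⟩
  have hpow (m : ℕ) : Circle.exp (2 * Real.pi * t) ^ m = Circle.exp (2 * Real.pi * (m * t)) := by
    rw [← Circle.exp_natCast_mul, mul_left_comm]
  have hnormalized : normalizedLog θ f (Circle.exp (2 * Real.pi * t)) = fun n σ => _ :=
    funext₂ fun n σ => by simp only [normalizedLog, logClassFun, logMahler, if_neg hx, hpow]; rfl
  rw [hnormalized]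
  exact exists_tendstoInDistribution_of_hasCycleMoments hθ
    (hasCycleMoments_inner_of_isTame_clm hQ htame ht hsub)

end EwensCLT

theorem mainTheorem1 (θ : ℝ) (hθ : 0 < θ) (f : Circle → ℂ)
    (hf : EwensCLT.RealAnalyticOnCircle f) (x : Circle) :
    (¬ IsOfFinOrder x → EwensCLT.IsFiniteType x → (∀ z : Circle, f z = 0 → IsOfFinOrder z) →
      IntervalIntegrable (EwensCLT.logOnCircle f) volume 0 1 ∧
      IntervalIntegrable (fun s => EwensCLT.logOnCircle f s ^ 2) volume 0 1 ∧
      ∃ N : Measure ℂ, ∃ _ : IsGaussian N,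
          TendstoInDistribution (EwensCLT.normalizedLog θ f x) atTop id
            (EwensCLT.ewensMeasure θ hθ) N ∧
          cov[Complex.re, Complex.im; N] =
            θ / 2 * (∫ s in (0 : ℝ)..1, EwensCLT.logOnCircle f s ^ 2).im ∧
          (IndepFun Complex.re Complex.im N ↔ cov[Complex.re, Complex.im; N] = 0)) ∧
    (∀ p : ℕ, 0 < p → orderOf x = p → (∀ m ∈ Finset.Icc 1 p, f (x ^ m) ≠ 0) →
      ∃ N : Measure ℂ, ∃ _ : IsGaussian N,
          TendstoInDistribution (EwensCLT.normalizedLog θ f x) atTop id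
            (EwensCLT.ewensMeasure θ hθ) N ∧
          cov[Complex.re, Complex.im; N] =
            θ / 2 * ((1 / (p : ℂ)) * ∑ m ∈ Finset.Icc 1 p, Complex.log (f (x ^ m)) ^ 2).im ∧
          (IndepFun Complex.re Complex.im N ↔ cov[Complex.re, Complex.im; N] = 0)) := by
  refine ⟨fun hx hxt hz =>
    EwensCLT.exists_tendstoInDistribution_of_isFiniteType hθ hf hx hxt hz, ?_⟩
  rintro p hp rfl -
  exact EwensCLT.exists_tendstoInDistribution_of_isOfFinOrder hθ f (orderOf_pos_iff.1 hp)
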